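/- **Spectral data.** Let $\Gamma$ be a (possibly disconnected) complex curve whose irreducible components are $N$ projective lines $\Gamma_1,\dots,\Gamma_N$, with global coordinates $z_i$ on $\Gamma_i$, whose only singularities are finitely many ordinary double points, each of them an intersection point $a$ of two different components $\Gamma_i,\Gamma_j$ with the same coordinate $z_i(a)=z_j(a)$ on both. Put $P_i=\{z_i=\infty\}$ and $Q_i=\{z_i=0\}$, assume that these points are nonsingular, take $z_i^{-1}$ as the local parameter at $P_i$, and assume that $\sigma(z_i)=-z_i$ $(i=1,\dots,N)$ defines an involution $\sigma$ of $\Gamma$. Let $P=\sum P_i$, $Q=\sum Q_i$, let $D$ be an effective divisor and $R=R_1+\dots+R_l$ a sum of distinct points, both consisting of nonsingular points different from the $P_i$ and $Q_i$, and let $d_1,\dots,d_l\in\mathbb C$ be not all zero. Assume that there is a meromorphic differential $\Omega$ on $\Gamma$, regular at the double points (that is, it has simple poles with opposite residues at the two preimages of every double point), whose zero and pole divisors, which have no common points, are otherwise $$(\Omega)_0=D+\sigma D+P,\qquad (\Omega)_\infty=R+\sigma R+Q .$$ Let $U\subset\mathbb C^N$ be an open set such that for every $u\in U$ there is exactly one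 Baker--Akhiezer function $\psi(u,\cdot)$: a function on $\Gamma$, meromorphic on $\Gamma\setminus\{P_1,\dots,P_N\}$ with pole divisor at most $D$ (in particular with equal values at the two preimages of each double point), such that $\psi e^{-u^iz_i}$ is analytic near $P_i$ for all $i$, and $\psi(u,R_k)=d_k$ for $k=1,\dots,l$. Let $x^k(u)=\psi(u,Q_k)$, $\eta_{kl}=\delta_{kl}\operatorname{res}_{Q_k}\Omega$, $h_i(u)=\lim_{P\to P_i}\psi e^{-u^iz_i}$ and $H_i=\varepsilon_ih_i$, where $\Omega=(\varepsilon_i^2w+O(w^2))\,dw$, $w=z_i^{-1}$, near $P_i$. Let $V\subset U$ be the set of all $u\in U$ with $H_i(u)\ne0$ for all $i$. **Theorem.** 1) The set $V$ is open, the functions $x^k$ and $H_i$ are holomorphic on $V$, the constant matrix $\eta$ is nondegenerate, and on $V$ $$ds^2=\sum_{k,l}\eta_{kl}\,dx^kdx^l=\sum_iH_i^2\,(du^i)^2 .$$ This metric is a flat Egorov (Darboux--Egorov) metric: its Riemann curvature tensor vanishes and its rotation coefficients $\beta_{ij}=H_j^{-1}\partial H_i/\partial u^j$ are symmetric, $\beta_{ij}=\beta_{ji}$.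 It gives solutions of the associativity equations: near every point of $V$ the functions $x^1,\dots,x^N$ are local coordinates, and in these coordinates there is a function $F(x)$ such that $$c_{\alpha\beta\gamma}(x):=\sum_iH_i^2\frac{\partial u^i}{\partial x^\alpha}\frac{\partial u^i}{\partial x^\beta}\frac{\partial u^i}{\partial x^\gamma}=\frac{\partial^3F}{\partial x^\alpha\partial x^\beta\partial x^\gamma}$$ and, with $(\eta^{\lambda\mu})=\eta^{-1}$ and summation over $\lambda,\mu$, $$\frac{\partial^3F}{\partial x^\alpha\partial x^\beta\partial x^\lambda}\eta^{\lambda\mu}\frac{\partial^3F}{\partial x^\gamma\partial x^\delta\partial x^\mu}=\frac{\partial^3F}{\partial x^\gamma\partial x^\beta\partial x^\lambda}\eta^{\lambda\mu}\frac{\partial^3F}{\partial x^\alpha\partial x^\delta\partial x^\mu}\quad\text{for all }\alpha,\beta,\gamma,\delta .$$ 2) If moreover $\Gamma$ is connected and $\psi$ is normalized at a single point, i.e. $l=1$ and $\psi(u,r)=1$ with $R=r$, then the functions $c_{\alpha\beta\gamma}$ are homogeneous of degree $-1$, $$c_{\alpha\beta\gamma}(\lambda x)=\lambda^{-1}c_{\alpha\beta\gamma}(x),\qquad\lambda\neq0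 ,$$ for every branch of the (in general multivalued) inverse $u(x)$ of $x(u)$ with values in $V$, on an open subset of the $x$-space that contains the segment from $x$ to $\lambda x$. 3) If moreover the spectral data are real, i.e. $\Gamma$, $D$, $R$ and the numbers $d_k$ are invariant under the complex conjugations $z_i\mapsto\bar z_i$ of the components, and $\Omega$ goes to $\overline\Omega$, then $\eta$, the numbers $\varepsilon_i^2$ and, for $u\in V\cap\mathbb R^N$, the values $x^k(u)$ and $h_i(u)$ are real, and 1) and, under its assumptions, 2) hold over $\mathbb R$ on $V\cap\mathbb R^N$ for the pseudo-Riemannian metric $\sum_{k,l}\eta_{kl}dx^kdx^l=\sum_i e_iH_i^2(du^i)^2$, where $e_i=\operatorname{sign}\varepsilon_i^2=\pm1$ and $H_i=|\varepsilon_i^2|^{1/2}h_i$, with $e_iH_i^2$ in place of $H_i^2$, smooth in place of holomorphic, and with the Egorov condition $\beta_{ij}=e_ie_j\beta_{ji}$. -/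

import Mathlib

open Filter Topology
open scoped ContDiff ComplexConjugate

noncomputable section

namespace FiniteGap

/-! ### Meromorphic differentials on the projective line

A meromorphic differential on `ℂP¹` is `r(z) dz` with a rational function `r`. -/

/-- Order of `r(z) dz` at a finite point `a` (positive at zeros, negative at poles). -/
def diffOrd (r : RatFunc ℂ) (a : ℂ) : ℤ :=
  (r.num.rootMultiplicity a : ℤ) - (r.denom.rootMultiplicity a : ℤ)

/-- Order of `r(z) dz` at `z = ∞`; in the local parameter `w = 1/z` one has `dz = -w⁻² dw`. -/
def diffOrdInfty (r : RatFunc ℂ) : ℤ := -r.intDegree - 2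

/-- Residue of `r(z) dz` at `a`, for a differential with at most a simple pole at `a`. -/
def simpleResidue (r : RatFunc ℂ) (a : ℂ) : ℂ :=
  if r.denom.eval a = 0 then r.num.eval a / r.denom.derivative.eval a else 0

/-- If `r(z) dz` has a simple zero at `∞`, then `r(z) dz = (κ w + O(w²)) dw` in the local
parameter `w = 1/z`, with `κ` the number defined here. -/
def inftyCoeff (r : RatFunc ℂ) : ℂ := -(r.num.leadingCoeff / r.denom.leadingCoeff)

/-! ### Spectral data

The curve `Γ` is a union of `N` projective lines `Γ_i` with coordinates `z_i`; the marked points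
are `P_i = ∞` and `Q_i = 0` on `Γ_i`, the local parameter at `P_i` is `1 / z_i`, and the
involution is `z_i ↦ -z_i` on every component. -/

/-- Spectral data with `N` components and `l` normalization points. -/
structure SpectralData (N l : ℕ) where
  /-- `glue i j` is the set of the coordinates of the intersection points of `Γ_i` and `Γ_j`:
  for `a ∈ glue i j` the points `z_i = a` and `z_j = a` are identified. -/
  glue : Fin N → Fin N → Finset ℂ
  /-- the part of the pole divisor `D` on `Γ_i`, with multiplicities -/
  D : Fin N → Multiset ℂ
  /-- the normalization points: component and coordinate -/
  R : Fin l → Fin N × ℂ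
  /-- the normalization constants -/
  d : Fin l → ℂ
  /-- the differential: it is `Ω i (z_i) dz_i` on `Γ_i` -/
  Ω : Fin N → RatFunc ℂ
  glue_symm : ∀ i j, glue i j = glue j i
  glue_irrefl : ∀ i, glue i i = ∅
  /-- singular points are double points: no point is identified with two others -/
  glue_double : ∀ i j k, j ≠ k → Disjoint (glue i j) (glue i k)
  /-- the involution `z_i ↦ -z_i` descends to `Γ` -/
  glue_neg : ∀ i j, ∀ a ∈ glue i j, -a ∈ glue i j
  /-- the points `Q_i` are nonsingular -/
  glue_ne_zero : ∀ i j, ∀ a ∈ glue i j, a ≠ 0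
  R_injective : Function.Injective R
  R_ne_zero : ∀ k, (R k).2 ≠ 0
  R_not_glue : ∀ k j, (R k).2 ∉ glue (R k).1 j
  D_ne_zero : ∀ i, ∀ γ ∈ D i, γ ≠ 0
  D_not_glue : ∀ i j, ∀ γ ∈ D i, γ ∉ glue i j
  /-- zeros `D + σD + P` and poles `R + σR + Q` of the differential do not cancel -/
  D_not_R : ∀ k, (R k).2 ∉ D (R k).1 ∧ -(R k).2 ∉ D (R k).1
  /-- the normalization constants do not vanish simultaneously -/
  d_ne_zero : ∃ k, d k ≠ 0
  /-- On the finite part of `Γ_i` the divisor of the differential is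
  `D + σD - R - σR - Q_i`, minus a simple pole at every preimage of a singular point. -/
  Ω_ord : ∀ i a, diffOrd (Ω i) a =
    ((D i).count a : ℤ) + ((D i).count (-a) : ℤ)
      - (if ∃ k, R k = (i, a) then 1 else 0)
      - (if ∃ k, R k = (i, -a) then 1 else 0)
      - (if a = 0 then 1 else 0)
      - (if ∃ j, a ∈ glue i j then 1 else 0)
  /-- the differential has a simple zero at `P_i` -/
  Ω_ord_infty : ∀ i, diffOrdInfty (Ω i) = 1
  /-- regularity of the differential at the double points -/
  Ω_regular : ∀ i j, ∀ a ∈ glue i j, simpleResidue (Ω i) a + simpleResidue (Ω j) a = 0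

namespace SpectralData

variable {N l : ℕ} (S : SpectralData N l)

/-- The dual graph of the curve, without multiplicities: components that intersect. -/
def dualGraph : SimpleGraph (Fin N) where
  Adj i j := (S.glue i j).Nonempty
  symm := ⟨fun i j h => by rw [S.glue_symm j i]; exact h⟩
  loopless := ⟨fun i h => by rw [S.glue_irrefl i] at h; exact Finset.not_nonempty_empty h⟩

/-- The curve `Γ` is connected. -/
def CurveConnected : Prop := S.dualGraph.Connected

/-- `ψ` (with `ψ i` its restriction to `Γ_i`) is a Baker--Akhiezer function of the spectral data
for the parameter value `u`. Its values at the points of `D` are irrelevant. -/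
structure IsBakerAkhiezer (u : Fin N → ℂ) (ψ : Fin N → ℂ → ℂ) : Prop where
  /-- holomorphic on `Γ` outside of `P` and `D` -/
  analytic : ∀ i z, z ∉ S.D i → AnalyticAt ℂ (ψ i) z
  /-- meromorphic outside of `P` -/
  meromorphic : ∀ i z, MeromorphicAt (ψ i) z
  /-- the divisor of poles is at most `D` -/
  poles : ∀ i z, ((-((S.D i).count z : ℤ) : ℤ) : WithTop ℤ) ≤ meromorphicOrderAt (ψ i) z
  /-- `ψ exp (-uⁱ z_i)` is analytic near `P_i`, in the local parameter `w = 1 / z_i` -/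
  infinity : ∀ i, ∃ g : ℂ → ℂ, AnalyticAt ℂ g 0 ∧
    ∀ᶠ w in 𝓝[≠] (0 : ℂ), g w = ψ i w⁻¹ * Complex.exp (-(u i * w⁻¹))
  /-- `ψ` descends to the singular curve -/
  glue : ∀ i j, ∀ a ∈ S.glue i j, ψ i a = ψ j a
  /-- normalization -/
  norm : ∀ k, ψ (S.R k).1 (S.R k).2 = S.d k

/-- `ψ` is the unique Baker--Akhiezer function for the parameter value `u`. -/
def IsUniqueBakerAkhiezer (u : Fin N → ℂ) (ψ : Fin N → ℂ → ℂ) : Prop :=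
  S.IsBakerAkhiezer u ψ ∧
    ∀ φ, S.IsBakerAkhiezer u φ → ∀ i z, z ∉ S.D i → φ i z = ψ i z

/-- The constant flat metric `η_{kl} = δ_{kl} res_{Q_k} Ω`. -/
def eta : Matrix (Fin N) (Fin N) ℂ := Matrix.diagonal fun k => simpleResidue (S.Ω k) 0

/-- The numbers `ε_i²` with `Ω = (ε_i² w + O(w²)) dw`, `w = 1 / z_i`, near `P_i`. -/
def epsSq (i : Fin N) : ℂ := inftyCoeff (S.Ω i)

/-- The spectral data are invariant under the antiholomorphic involution `z_i ↦ conj z_i`. -/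
structure IsReal : Prop where
  glue : ∀ i j, ∀ a ∈ S.glue i j, conj a ∈ S.glue i j
  D : ∀ i, (S.D i).map (starRingEnd ℂ) = S.D i
  R : ∀ k, ∃ m, S.R m = ((S.R k).1, conj (S.R k).2) ∧ S.d m = conj (S.d k)
  Ω : ∀ i, (S.Ω i).num.map (starRingEnd ℂ) = (S.Ω i).num ∧
    (S.Ω i).denom.map (starRingEnd ℂ) = (S.Ω i).denom

end SpectralData

/-! ### Flat metrics, Egorov metrics and the associativity equations

Everything below is stated over `𝕜 = ℝ` (pseudo-Riemannian metrics) and `𝕜 = ℂ` (holomorphic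
metrics) at the same time. -/

section Metrics

variable {𝕜 : Type*} [RCLike 𝕜] {N : ℕ}

/-- Partial derivative `∂f/∂uⁱ` at `u`. -/
def pd (i : Fin N) (f : (Fin N → 𝕜) → 𝕜) (u : Fin N → 𝕜) : 𝕜 :=
  fderiv 𝕜 f u (Pi.single i 1)

/-- Christoffel symbols `Γ^k_{ij}` of the metric `g`. -/
def christoffel (g : (Fin N → 𝕜) → Matrix (Fin N) (Fin N) 𝕜) (k i j : Fin N)
    (u : Fin N → 𝕜) : 𝕜 :=
  2⁻¹ * ∑ m, (g u)⁻¹ k m *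
    (pd i (fun y => g y m j) u + pd j (fun y => g y m i) u - pd m (fun y => g y i j) u)

/-- Components `R^m_{kij}` of the Riemann curvature tensor of the metric `g`. -/
def riemann (g : (Fin N → 𝕜) → Matrix (Fin N) (Fin N) 𝕜) (m k i j : Fin N)
    (u : Fin N → 𝕜) : 𝕜 :=
  pd i (christoffel g m j k) u - pd j (christoffel g m i k) u +
    ∑ p, (christoffel g m i p u * christoffel g p j k u
      - christoffel g m j p u * christoffel g p i k u)

/-- The metric `g` has zero curvature on `U`. -/
def IsFlat (U : Set (Fin N → 𝕜)) (g : (Fin N → 𝕜) → Matrix (Fin N) (Fin N) 𝕜) : Prop :=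
  ∀ u ∈ U, ∀ m k i j, riemann g m k i j u = 0

/-- The diagonal metric `∑ e_i H_i² (duⁱ)²`. -/
def diagMetric (e : Fin N → 𝕜) (H : (Fin N → 𝕜) → Fin N → 𝕜) (u : Fin N → 𝕜) :
    Matrix (Fin N) (Fin N) 𝕜 :=
  Matrix.diagonal fun i => e i * H u i ^ 2

/-- Rotation coefficients `β_{ij} = H_j⁻¹ ∂H_i/∂u^j`. -/
def rotation (H : (Fin N → 𝕜) → Fin N → 𝕜) (i j : Fin N) (u : Fin N → 𝕜) : 𝕜 :=
  (H u j)⁻¹ * pd j (fun y => H y i) u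

/-- The metric `∑ e_i H_i² (duⁱ)²` satisfies the Egorov condition in the coordinates `u`. -/
def IsEgorov (U : Set (Fin N → 𝕜)) (e : Fin N → 𝕜) (H : (Fin N → 𝕜) → Fin N → 𝕜) : Prop :=
  ∀ u ∈ U, ∀ i j, rotation H i j u = e i * e j * rotation H j i u

/-- On the open set `U` the functions `H_i` are nowhere vanishing Lame coefficients of a flat
Egorov metric with the signs `e_i`, and this metric is the pullback of the constant
nondegenerate metric `η_{kl} dx^k dx^l` under the map `x`. -/
structure IsFlatEgorov (U : Set (Fin N → 𝕜)) (e : Fin N → 𝕜) (H : (Fin N → 𝕜) → Fin N → 𝕜)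
    (η : Matrix (Fin N) (Fin N) 𝕜) (x : (Fin N → 𝕜) → Fin N → 𝕜) : Prop where
  isOpen : IsOpen U
  sign : ∀ i, e i = 1 ∨ e i = -1
  smooth_H : ContDiffOn 𝕜 ∞ H U
  H_ne_zero : ∀ u ∈ U, ∀ i, H u i ≠ 0
  η_symm : η.IsSymm
  η_det : η.det ≠ 0
  smooth_x : ContDiffOn 𝕜 ∞ x U
  metric_eq : ∀ u ∈ U, ∀ i j,
    ∑ k, ∑ m, η k m * pd i (fun y => x y k) u * pd j (fun y => x y m) u = diagMetric e H u i j
  flat : IsFlat U (diagMetric e H)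
  egorov : IsEgorov U e H

/-- `v` expresses the coordinates `u ∈ U` through the coordinates `x` on the open set `W` of the
`x`-space: a smooth local inverse of `u ↦ x(u)`. -/
structure IsBranch (U : Set (Fin N → 𝕜)) (x : (Fin N → 𝕜) → Fin N → 𝕜)
    (W : Set (Fin N → 𝕜)) (v : (Fin N → 𝕜) → Fin N → 𝕜) : Prop where
  isOpen : IsOpen W
  smooth : ContDiffOn 𝕜 ∞ v W
  mapsTo : Set.MapsTo v W U
  rightInv : ∀ w ∈ W, x (v w) = w

/-- The correlators
`c_{αβγ}(x) = ∑_i e_i H_i² (∂uⁱ/∂x^α) (∂uⁱ/∂x^β) (∂uⁱ/∂x^γ)` with `u = v(x)`. -/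
def correlator (e : Fin N → 𝕜) (H : (Fin N → 𝕜) → Fin N → 𝕜) (v : (Fin N → 𝕜) → Fin N → 𝕜)
    (α β γ : Fin N) (w : Fin N → 𝕜) : 𝕜 :=
  ∑ i, e i * H (v w) i ^ 2 *
    pd α (fun y => v y i) w * pd β (fun y => v y i) w * pd γ (fun y => v y i) w

/-- Third partial derivative of `F`. -/
def pd3 (F : (Fin N → 𝕜) → 𝕜) (α β γ : Fin N) (w : Fin N → 𝕜) : 𝕜 :=
  pd α (pd β (pd γ F)) w

/-- `F` satisfies the associativity equations on `W` with the constant metric `η`. -/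
def SolvesAssociativity (W : Set (Fin N → 𝕜)) (η : Matrix (Fin N) (Fin N) 𝕜)
    (F : (Fin N → 𝕜) → 𝕜) : Prop :=
  ∀ w ∈ W, ∀ α β γ δ,
    ∑ p, ∑ q, pd3 F α β p w * η⁻¹ p q * pd3 F γ δ q w =
      ∑ p, ∑ q, pd3 F γ β p w * η⁻¹ p q * pd3 F α δ q w

/-- Near every point of `U` the functions `x` are coordinates in which the correlators are the
third derivatives of a solution `F` of the associativity equations. -/
def GivesAssociativity (U : Set (Fin N → 𝕜)) (e : Fin N → 𝕜) (H : (Fin N → 𝕜) → Fin N → 𝕜)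
    (η : Matrix (Fin N) (Fin N) 𝕜) (x : (Fin N → 𝕜) → Fin N → 𝕜) : Prop :=
  ∀ u ∈ U, ∃ (W : Set (Fin N → 𝕜)) (v : (Fin N → 𝕜) → Fin N → 𝕜) (F : (Fin N → 𝕜) → 𝕜),
    IsBranch U x W v ∧ x u ∈ W ∧ v (x u) = u ∧ ContDiffOn 𝕜 ∞ F W ∧
    (∀ w ∈ W, ∀ α β γ, pd3 F α β γ w = correlator e H v α β γ w) ∧
    SolvesAssociativity W η F

/-- The correlators are homogeneous of degree `-1`: `c(λ x) = λ⁻¹ c(x)` for every branch of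
`u(x)`. Since `u(x)` is multivalued in general, the points `x` and `λ x` are required to be
joined by a segment in the domain of the branch. -/
def CorrelatorsHomogeneous (U : Set (Fin N → 𝕜)) (e : Fin N → 𝕜)
    (H : (Fin N → 𝕜) → Fin N → 𝕜) (x : (Fin N → 𝕜) → Fin N → 𝕜) : Prop :=
  ∀ (W : Set (Fin N → 𝕜)) (v : (Fin N → 𝕜) → Fin N → 𝕜), IsBranch U x W v →
    ∀ w ∈ W, ∀ c : 𝕜, c ≠ 0 → segment ℝ w (c • w) ⊆ W →
      ∀ α β γ, correlator e H v α β γ (c • w) = c⁻¹ * correlator e H v α β γ w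

end Metrics

end FiniteGap

end
/-!
On the component `Γ_i` a Baker–Akhiezer function is `A_i(z) exp (uⁱ z) / ∏_{γ ∈ D_i} (z - γ)` with a
polynomial `A_i` of degree at most `deg D_i` and leading coefficient `h_i`. The gluing and
normalization conditions form a linear system for the coefficients of `A`; uniqueness of `ψ` makes
it nondegenerate, so by Cramer's rule `A` is holomorphic in `u`.

Uniqueness says more: a function of this kind that vanishes at `R`, with a pole of one order more
at the points `P_p`, is a combination of the `∂_p ψ`, determined by its leading terms. In
particular `∂_i ∂_j ψ - δ_{ij} z ∂_i ψ = ∑ Γ_{ij}^p ∂_p ψ`. In the expansions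
`ψ = x^k + f^k z + ⋯` at `Q_k` this reads `∂_i ∂_j x = ∑ Γ_{ij}^p ∂_p x` and
`∂_i ∂_j f = ∑ Γ_{ij}^p ∂_p f + δ_{ij} ∂_i x`, while the sum of the residues of
`∂_i ψ(z) ∂_j ψ(-z) Ω` over all components gives `∑ η_{kk} ∂_i x^k ∂_j x^k = δ_{ij} ε_i² h_i²`.
Hence the `x^k` are flat coordinates, the `Γ_{ij}^p` are the Christoffel symbols, the Ricci identity
for `f` is the Egorov condition, and in the coordinates `x` the correlators are the second
derivatives of the functions `∑ η_{γm} f^m`.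

If all points of `R` have the same coordinate `r`, then `(z - r) ψ = ∑ ∂_i ψ`; at `z = 0` this is
`∑ ∂_i x = -r x`, so that translations in `u` along `(1, …, 1)` act on `x` by homotheties.
-/

namespace FiniteGap

section LinearSystems

variable {𝕜 : Type*} [NontriviallyNormedField 𝕜]
  {P : Type*} [NormedAddCommGroup P] [NormedSpace 𝕜 P]
  {E : Type*} [NormedAddCommGroup E] [NormedSpace 𝕜 E] [CompleteSpace E]
  {F : Type*} [NormedAddCommGroup F] [NormedSpace 𝕜 F]

theorem contDiffAt_of_apply_eq {n : WithTop ℕ∞} {T : P → E →L[𝕜] F} {a : P → E} {b : P → F}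
    {u₀ : P} {L : F →L[𝕜] E} (hL : L ∘L T u₀ = .id 𝕜 E) (hT : ContDiffAt 𝕜 n T u₀)
    (hb : ContDiffAt 𝕜 n b u₀) (h : ∀ᶠ u in 𝓝 u₀, T u (a u) = b u) :
    ContDiffAt 𝕜 n a u₀ := by
  have hM : ContDiffAt 𝕜 n (fun u => L ∘L T u) u₀ := contDiffAt_const.clm_comp hT
  have hunit : IsUnit (L ∘L T u₀) := hL ▸ isUnit_one
  have hinv : ContDiffAt 𝕜 n (fun u => Ring.inverse (L ∘L T u)) u₀ :=
    ContDiffAt.comp u₀ (g := Ring.inverse) (contDiffAt_ringInverse 𝕜 hunit.unit) hM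
  refine (hinv.clm_apply (contDiffAt_const.clm_apply hb : ContDiffAt 𝕜 n (fun u => L (b u)) u₀))
    |>.congr_of_eventuallyEq ?_
  filter_upwards [h, hM.continuousAt.eventually (Units.isOpen.mem_nhds hunit)] with u hu hunit
  calc a u = (Ring.inverse (L ∘L T u) * (L ∘L T u)) (a u) := by
        rw [Ring.inverse_mul_cancel _ hunit, one_apply_eq_self]
    _ = Ring.inverse (L ∘L T u) (L (b u)) := by
        rw [mul_apply_eq_comp, ContinuousLinearMap.comp_apply, hu]

end LinearSystems

section PartialDerivatives

variable {𝕜 : Type*} [RCLike 𝕜] {N : ℕ} {U : Set (Fin N → 𝕜)} {u : Fin N → 𝕜}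
  {f g : (Fin N → 𝕜) → 𝕜}

theorem fderiv_apply_eq_sum_pd (f : (Fin N → 𝕜) → 𝕜) (u w : Fin N → 𝕜) :
    fderiv 𝕜 f u w = ∑ i, w i * pd i f u := by
  conv_lhs => rw [pi_eq_sum_univ' w, map_sum]
  exact Finset.sum_congr rfl fun i _ => by rw [map_smul, smul_eq_mul, pd]

theorem pd_congr_of_isOpen (hU : IsOpen U) (hu : u ∈ U) (i : Fin N) (h : ∀ y ∈ U, f y = g y) :
    pd i f u = pd i g u := by
  rw [pd, pd, (eventuallyEq_of_mem (hU.mem_nhds hu) h).fderiv_eq]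

theorem pd_add (i : Fin N) (hf : DifferentiableAt 𝕜 f u) (hg : DifferentiableAt 𝕜 g u) :
    pd i (fun y => f y + g y) u = pd i f u + pd i g u := by
  simp only [pd, fderiv_fun_add hf hg, add_apply]

theorem pd_sub (i : Fin N) (hf : DifferentiableAt 𝕜 f u) (hg : DifferentiableAt 𝕜 g u) :
    pd i (fun y => f y - g y) u = pd i f u - pd i g u := by
  simp only [pd, fderiv_fun_sub hf hg, sub_apply]

theorem pd_mul (i : Fin N) (hf : DifferentiableAt 𝕜 f u) (hg : DifferentiableAt 𝕜 g u) :
    pd i (fun y => f y * g y) u = pd i f u * g u + f u * pd i g u := by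
  simp only [pd, fderiv_fun_mul hf hg, add_apply,
    smul_apply, smul_eq_mul]
  ring

theorem pd_const_mul (i : Fin N) (c : 𝕜) (hf : DifferentiableAt 𝕜 f u) :
    pd i (fun y => c * f y) u = c * pd i f u := by
  simp only [pd, fderiv_const_mul hf, smul_apply, smul_eq_mul]

theorem pd_sum {ι : Type*} (s : Finset ι) {F : ι → (Fin N → 𝕜) → 𝕜} (i : Fin N)
    (hF : ∀ a ∈ s, DifferentiableAt 𝕜 (F a) u) :
    pd i (fun y => ∑ a ∈ s, F a y) u = ∑ a ∈ s, pd i (F a) u := by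
  simp only [pd, fderiv_fun_sum hF, sum_apply]

theorem pd_const (i : Fin N) (c : 𝕜) : pd i (fun _ => c) u = 0 := by
  simp only [pd, fderiv_const_apply, zero_apply]

theorem fderiv_apply_apply {x : (Fin N → 𝕜) → Fin N → 𝕜} (hx : DifferentiableAt 𝕜 x u)
    (w : Fin N → 𝕜) (k : Fin N) : fderiv 𝕜 x u w k = fderiv 𝕜 (fun y => x y k) u w := by
  rw [fderiv_pi (differentiableAt_pi.1 hx), ContinuousLinearMap.pi_apply]

theorem pd_coord (i j : Fin N) : pd i (fun y : Fin N → 𝕜 => y j) u = if i = j then 1 else 0 := by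
  rw [pd, ← fderiv_apply_apply differentiableAt_fun_id, fderiv_fun_id,
    ContinuousLinearMap.id_apply, Pi.single_apply]
  exact if_congr eq_comm rfl rfl

theorem pd_linear (i : Fin N) (c : Fin N → 𝕜) :
    pd i (fun y : Fin N → 𝕜 => ∑ j, c j * y j) u = c i := by
  rw [pd_sum _ _ fun j _ => by fun_prop]
  simp only [pd_const_mul _ _ (differentiableAt_apply (𝕜 := 𝕜) _ _), pd_coord, mul_ite, mul_one,
    mul_zero, Finset.sum_ite_eq, Finset.mem_univ, if_true]

theorem contDiffOn_pd (hU : IsOpen U) (hf : ContDiffOn 𝕜 ∞ f U) (i : Fin N) :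
    ContDiffOn 𝕜 ∞ (pd i f) U :=
  ((contDiffOn_infty_iff_fderiv_of_isOpen hU).1 hf).2.clm_apply contDiffOn_const

theorem differentiableAt_of_contDiffOn {E : Type*} [NormedAddCommGroup E] [NormedSpace 𝕜 E]
    {f : (Fin N → 𝕜) → E} (hU : IsOpen U) (hf : ContDiffOn 𝕜 ∞ f U) (hu : u ∈ U) :
    DifferentiableAt 𝕜 f u :=
  (hf.contDiffAt (hU.mem_nhds hu)).differentiableAt (by simp)

theorem differentiableAt_pd (hU : IsOpen U) (hf : ContDiffOn 𝕜 ∞ f U) (hu : u ∈ U) (i : Fin N) :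
    DifferentiableAt 𝕜 (pd i f) u :=
  differentiableAt_of_contDiffOn hU (contDiffOn_pd hU hf i) hu

theorem pd_comm (hU : IsOpen U) (hf : ContDiffOn 𝕜 ∞ f U) (hu : u ∈ U) (i j : Fin N) :
    pd i (pd j f) u = pd j (pd i f) u := by
  have hd : DifferentiableAt 𝕜 (fderiv 𝕜 f) u :=
    differentiableAt_of_contDiffOn hU ((contDiffOn_infty_iff_fderiv_of_isOpen hU).1 hf).2 hu
  have hsnd : ∀ a b : Fin N, pd a (pd b f) u =
      fderiv 𝕜 (fderiv 𝕜 f) u (Pi.single a 1) (Pi.single b 1) := fun a b => by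
    change fderiv 𝕜 (fun y => fderiv 𝕜 f y (Pi.single b 1)) u (Pi.single a 1) = _
    simp [fderiv_clm_apply hd (differentiableAt_const _)]
  have hsymm := (hf.contDiffAt (hU.mem_nhds hu)).isSymmSndFDerivAt (by
    rw [minSmoothness_of_isRCLikeNormedField]
    exact WithTop.coe_le_coe.2 (le_top : (2 : ℕ∞) ≤ ⊤))
  rw [hsnd, hsnd, hsymm.eq]

theorem pd_comp {v : (Fin N → 𝕜) → Fin N → 𝕜} {w : Fin N → 𝕜} (i : Fin N)
    (hf : DifferentiableAt 𝕜 f (v w)) (hv : DifferentiableAt 𝕜 v w) :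
    pd i (fun y => f (v y)) w = ∑ j, pd i (fun y => v y j) w * pd j f (v w) := by
  have hcomp : HasFDerivAt (fun y => f (v y)) (fderiv 𝕜 f (v w) ∘L fderiv 𝕜 v w) w :=
    hf.hasFDerivAt.comp w hv.hasFDerivAt
  rw [pd, hcomp.fderiv, ContinuousLinearMap.comp_apply, fderiv_apply_eq_sum_pd]
  simp only [fderiv_apply_apply hv, pd]

end PartialDerivatives

section FlatCoordinates

variable {𝕜 : Type*} [RCLike 𝕜] {N : ℕ} {U : Set (Fin N → 𝕜)} {u : Fin N → 𝕜}
  {g : (Fin N → 𝕜) → Matrix (Fin N) (Fin N) 𝕜} {η : Matrix (Fin N) (Fin N) 𝕜}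
  {x : (Fin N → 𝕜) → Fin N → 𝕜} {φ ξ : (Fin N → 𝕜) → 𝕜}

/-- The Jacobian matrix `∂xᵏ/∂uⁱ` of the map `x`, with row index `k` and column index `i`. -/
noncomputable def jacobian (x : (Fin N → 𝕜) → Fin N → 𝕜) (u : Fin N → 𝕜) :
    Matrix (Fin N) (Fin N) 𝕜 :=
  Matrix.of fun k i => pd i (fun y => x y k) u

theorem jacobian_mulVec (c : Fin N → 𝕜) (k : Fin N) :
    (jacobian x u).mulVec c k = ∑ p, c p * pd p (fun y => x y k) u := by
  simp only [Matrix.mulVec, dotProduct, jacobian, Matrix.of_apply, mul_comm]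

theorem fderiv_apply_eq_mulVec (hx : DifferentiableAt 𝕜 x u) (c : Fin N → 𝕜) :
    fderiv 𝕜 x u c = (jacobian x u).mulVec c := by
  ext k
  rw [fderiv_apply_apply hx, fderiv_apply_eq_sum_pd, jacobian_mulVec]

/-- The map `x` consists of flat coordinates of the metric `g` on `U`: the nondegenerate metric `g`
is the pullback of the constant metric `η` under `x`. -/
structure HasFlatCoordinates (U : Set (Fin N → 𝕜)) (g : (Fin N → 𝕜) → Matrix (Fin N) (Fin N) 𝕜)
    (η : Matrix (Fin N) (Fin N) 𝕜) (x : (Fin N → 𝕜) → Fin N → 𝕜) : Prop where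
  isOpen : IsOpen U
  smooth_x : ContDiffOn 𝕜 ∞ x U
  η_symm : η.IsSymm
  det_ne_zero : ∀ u ∈ U, (g u).det ≠ 0
  metric_eq : ∀ u ∈ U, ∀ i j,
    ∑ k, ∑ m, η k m * pd i (fun y => x y k) u * pd j (fun y => x y m) u = g u i j

/-- The covariant Hessian of `φ` with respect to the metric `g` is the diagonal matrix
`δ_{ij} ∂ξ/∂uⁱ`. -/
def HasCovariantHessian (U : Set (Fin N → 𝕜)) (g : (Fin N → 𝕜) → Matrix (Fin N) (Fin N) 𝕜)
    (φ ξ : (Fin N → 𝕜) → 𝕜) : Prop :=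
  ∀ u ∈ U, ∀ i j, pd i (pd j φ) u =
    ∑ p, christoffel g p i j u * pd p φ u + if i = j then pd i ξ u else 0

theorem HasCovariantHessian.pd_pd_pd (hφ : HasCovariantHessian U g φ ξ) (hU : IsOpen U)
    (hφs : ContDiffOn 𝕜 ∞ φ U) (hξs : ContDiffOn 𝕜 ∞ ξ U) (hu : u ∈ U)
    (hΓ : ∀ k i j, DifferentiableAt 𝕜 (christoffel g k i j) u) (i j k : Fin N) :
    pd i (pd j (pd k φ)) u =
      ∑ m, (pd i (christoffel g m j k) u + ∑ p, christoffel g m i p u * christoffel g p j k u)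
        * pd m φ u
      + christoffel g i j k u * pd i ξ u + if j = k then pd i (pd j ξ) u else 0 := by
  have hd := differentiableAt_pd hU hφs hu
  have hprod : ∀ p, DifferentiableAt 𝕜 (fun y => christoffel g p j k y * pd p φ y) u :=
    fun p => (hΓ p j k).fun_mul (hd p)
  have hite : DifferentiableAt 𝕜 (fun y => if j = k then pd j ξ y else 0) u := by
    split_ifs
    · exact differentiableAt_pd hU hξs hu j
    · exact differentiableAt_const _
  have hpd_ite : pd i (fun y => if j = k then pd j ξ y else 0) u =
      if j = k then pd i (pd j ξ) u else 0 := by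
    split_ifs
    · rfl
    · exact pd_const i 0
  rw [pd_congr_of_isOpen hU hu i fun y hy => hφ y hy j k,
    pd_add i (DifferentiableAt.fun_sum fun p _ => hprod p) hite, pd_sum _ _ fun p _ => hprod p,
    hpd_ite]
  simp only [pd_mul i (hΓ _ _ _) (hd _), hφ u hu, mul_add, add_mul, Finset.sum_add_distrib,
    mul_ite, mul_zero, Finset.sum_ite_eq, Finset.mem_univ, if_true, Finset.mul_sum, Finset.sum_mul,
    ← add_assoc]
  rw [Finset.sum_comm (f := fun m p => christoffel g m i p u * _ * _)]
  congr 3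
  exact Finset.sum_congr rfl fun p _ => Finset.sum_congr rfl fun m _ => by ring

theorem HasCovariantHessian.ricci_identity (hφ : HasCovariantHessian U g φ ξ) (hU : IsOpen U)
    (hφs : ContDiffOn 𝕜 ∞ φ U) (hξs : ContDiffOn 𝕜 ∞ ξ U) (hu : u ∈ U)
    (hΓ : ∀ k i j, DifferentiableAt 𝕜 (christoffel g k i j) u) (i j k : Fin N) :
    ∑ m, riemann g m k i j u * pd m φ u
      + (christoffel g i j k u * pd i ξ u + if j = k then pd i (pd j ξ) u else 0) =
      christoffel g j i k u * pd j ξ u + if i = k then pd j (pd i ξ) u else 0 := by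
  have hcomm := pd_comm hU (contDiffOn_pd hU hφs k) hu i j
  rw [hφ.pd_pd_pd hU hφs hξs hu hΓ, hφ.pd_pd_pd hU hφs hξs hu hΓ] at hcomm
  simp only [riemann, add_mul, sub_mul, Finset.sum_add_distrib, Finset.sum_sub_distrib] at hcomm ⊢
  linear_combination hcomm

namespace HasFlatCoordinates

theorem contDiffOn_apply (hg : HasFlatCoordinates U g η x) (k : Fin N) :
    ContDiffOn 𝕜 ∞ (fun y => x y k) U := contDiffOn_pi.1 hg.smooth_x k

theorem jacobian_transpose_mul_mul (hg : HasFlatCoordinates U g η x) (hu : u ∈ U) :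
    (jacobian x u).transpose * η * jacobian x u = g u := by
  ext i j
  rw [← hg.metric_eq u hu]
  simp only [Matrix.mul_apply, Finset.sum_mul, jacobian, Matrix.transpose_apply, Matrix.of_apply]
  rw [Finset.sum_comm]
  exact Finset.sum_congr rfl fun k _ => Finset.sum_congr rfl fun m _ => by ring

theorem jacobian_mul_inv (hg : HasFlatCoordinates U g η x) (hu : u ∈ U) :
    jacobian x u * ((g u)⁻¹ * (jacobian x u).transpose * η) = 1 := by
  rw [mul_eq_one_comm, Matrix.mul_assoc, Matrix.mul_assoc, ← Matrix.mul_assoc _ η,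
    hg.jacobian_transpose_mul_mul hu, Matrix.nonsing_inv_mul _ (hg.det_ne_zero u hu).isUnit]

theorem eq_zero_of_sum_mul_pd_eq_zero (hg : HasFlatCoordinates U g η x) (hu : u ∈ U)
    {c : Fin N → 𝕜} (hc : ∀ k, ∑ p, c p * pd p (fun y => x y k) u = 0) : c = 0 := by
  have hJ : (jacobian x u).mulVec c = 0 := funext fun k => (jacobian_mulVec c k).trans (hc k)
  rw [← Matrix.one_mulVec c, ← mul_eq_one_comm.1 (hg.jacobian_mul_inv hu), ← Matrix.mulVec_mulVec,
    hJ, Matrix.mulVec_zero]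

theorem pd_metric (hg : HasFlatCoordinates U g η x) (hu : u ∈ U) (i m j : Fin N) :
    pd i (fun y => g y m j) u = ∑ k, ∑ l, η k l *
      (pd i (pd m fun y => x y k) u * pd j (fun y => x y l) u
        + pd m (fun y => x y k) u * pd i (pd j fun y => x y l) u) := by
  have hd : ∀ a k, DifferentiableAt 𝕜 (pd a fun y => x y k) u := fun a k =>
    differentiableAt_pd hg.isOpen (hg.contDiffOn_apply k) hu a
  rw [← pd_congr_of_isOpen hg.isOpen hu i fun y hy => hg.metric_eq y hy m j,
    pd_sum _ _ fun k _ => by fun_prop]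
  refine Finset.sum_congr rfl fun k _ => ?_
  rw [pd_sum _ _ fun l _ => by fun_prop]
  refine Finset.sum_congr rfl fun l _ => ?_
  rw [pd_mul i (by fun_prop) (hd _ _), pd_const_mul i _ (hd _ _)]
  ring

theorem pd_metric_add_sub (hg : HasFlatCoordinates U g η x) (hu : u ∈ U) (i j m : Fin N) :
    pd i (fun y => g y m j) u + pd j (fun y => g y m i) u - pd m (fun y => g y i j) u =
      2 * ∑ k, pd m (fun y => x y k) u * ∑ l, η k l * pd i (pd j fun y => x y l) u := by
  have hcomm : ∀ a b k, pd a (pd b fun y => x y k) u = pd b (pd a fun y => x y k) u :=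
    fun a b k => pd_comm hg.isOpen (hg.contDiffOn_apply k) hu a b
  have hswap : ∑ k, ∑ l, η k l * (pd i (fun y => x y k) u * pd m (pd j fun y => x y l) u) =
      ∑ k, ∑ l, η k l * (pd m (pd j fun y => x y k) u * pd i (fun y => x y l) u) := by
    rw [Finset.sum_comm]
    refine Finset.sum_congr rfl fun k _ => Finset.sum_congr rfl fun l _ => ?_
    rw [hg.η_symm.apply, mul_comm (pd i _ u)]
  simp only [hg.pd_metric hu, mul_add, Finset.sum_add_distrib, hswap, hcomm _ m, hcomm j i,
    Finset.mul_sum, mul_left_comm (η _ _) (pd m _ u)]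
  ring_nf
  simp only [Finset.sum_mul]

theorem christoffel_eq_mulVec (hg : HasFlatCoordinates U g η x) (hu : u ∈ U) (i j : Fin N) :
    (fun p => christoffel g p i j u) =
      ((g u)⁻¹ * (jacobian x u).transpose * η).mulVec fun k => pd i (pd j fun y => x y k) u := by
  rw [← Matrix.mulVec_mulVec, ← Matrix.mulVec_mulVec]
  funext p
  simp only [christoffel, hg.pd_metric_add_sub hu, Matrix.mulVec, dotProduct, jacobian,
    Matrix.transpose_apply, Matrix.of_apply, mul_left_comm _ (2 : 𝕜)]
  rw [← Finset.mul_sum, inv_mul_cancel_left₀ two_ne_zero]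

theorem hasCovariantHessian (hg : HasFlatCoordinates U g η x) (k : Fin N) :
    HasCovariantHessian U g (fun y => x y k) fun _ => 0 := by
  intro u hu i j
  have hmul : (jacobian x u).mulVec (fun p => christoffel g p i j u) =
      fun k => pd i (pd j fun y => x y k) u := by
    rw [hg.christoffel_eq_mulVec hu, Matrix.mulVec_mulVec, hg.jacobian_mul_inv hu,
      Matrix.one_mulVec]
  rw [pd_const, ite_self, add_zero, ← congrFun hmul k, jacobian_mulVec]

theorem eq_christoffel (hg : HasFlatCoordinates U g η x) (hu : u ∈ U) {i j : Fin N}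
    {Γ : Fin N → 𝕜}
    (hΓ : ∀ k, pd i (pd j fun y => x y k) u = ∑ p, Γ p * pd p (fun y => x y k) u) (p : Fin N) :
    Γ p = christoffel g p i j u := by
  refine sub_eq_zero.1 (congrFun (hg.eq_zero_of_sum_mul_pd_eq_zero hu
    (c := fun p => Γ p - christoffel g p i j u) fun k => ?_) p)
  have hx := hg.hasCovariantHessian k u hu i j
  rw [pd_const, ite_self, add_zero] at hx
  simp only [sub_mul, Finset.sum_sub_distrib, ← hΓ, ← hx, sub_self]

theorem exists_comp_fderiv_eq_id (hg : HasFlatCoordinates U g η x) (hu : u ∈ U) :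
    ∃ L : (Fin N → 𝕜) →L[𝕜] (Fin N → 𝕜), L ∘L fderiv 𝕜 x u = .id 𝕜 _ := by
  refine ⟨(Matrix.mulVecLin
    ((g u)⁻¹ * (jacobian x u).transpose * η)).toContinuousLinearMap, ?_⟩
  ext1 c
  rw [ContinuousLinearMap.comp_apply,
    fderiv_apply_eq_mulVec (differentiableAt_of_contDiffOn hg.isOpen hg.smooth_x hu),
    LinearMap.coe_toContinuousLinearMap', Matrix.mulVecLin_apply, Matrix.mulVec_mulVec,
    mul_eq_one_comm.1 (hg.jacobian_mul_inv hu), Matrix.one_mulVec, ContinuousLinearMap.id_apply]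

theorem differentiableAt_christoffel (hg : HasFlatCoordinates U g η x) (hu : u ∈ U)
    (k i j : Fin N) : DifferentiableAt 𝕜 (christoffel g k i j) u := by
  obtain ⟨L, hL⟩ := hg.exists_comp_fderiv_eq_id hu
  have hsmooth : ContDiffOn 𝕜 ∞ (fun y m => pd i (pd j fun y => x y m) y) U :=
    contDiffOn_pi.2 fun m =>
      contDiffOn_pd hg.isOpen (contDiffOn_pd hg.isOpen (hg.contDiffOn_apply m) j) i
  have hnhds := hg.isOpen.mem_nhds hu
  -- The Christoffel symbols solve the linear system `dx(Γ_{ij}) = ∂_i ∂_j x`.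
  have hΓ : ContDiffAt 𝕜 ∞ (fun y p => christoffel g p i j y) u :=
    contDiffAt_of_apply_eq hL
      (((contDiffOn_infty_iff_fderiv_of_isOpen hg.isOpen).1 hg.smooth_x).2.contDiffAt hnhds)
      (hsmooth.contDiffAt hnhds) <| eventually_of_mem hnhds fun y hy => by
        rw [fderiv_apply_eq_mulVec (differentiableAt_of_contDiffOn hg.isOpen hg.smooth_x hy),
          hg.christoffel_eq_mulVec hy, Matrix.mulVec_mulVec, hg.jacobian_mul_inv hy,
          Matrix.one_mulVec]
  exact (contDiffAt_pi.1 hΓ k).differentiableAt (by simp)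

theorem isFlat (hg : HasFlatCoordinates U g η x) : IsFlat U g := fun u hu m k i j => by
  refine congrFun (hg.eq_zero_of_sum_mul_pd_eq_zero hu (c := fun m => riemann g m k i j u)
    fun a => ?_) m
  have hricci := (hg.hasCovariantHessian a).ricci_identity hg.isOpen (hg.contDiffOn_apply a)
    contDiffOn_const hu (hg.differentiableAt_christoffel hu) i j k
  have hzero : ∀ p : Fin N, pd p (fun _ : Fin N → 𝕜 => (0 : 𝕜)) = fun _ => 0 :=
    fun p => funext fun y => pd_const p 0
  simpa only [hzero, mul_zero, ite_self, add_zero] using hricci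

end HasFlatCoordinates

end FlatCoordinates

section Frames

variable {𝕜 : Type*} [RCLike 𝕜] {N : ℕ} {U : Set (Fin N → 𝕜)} {u : Fin N → 𝕜}
  {g x f : (Fin N → 𝕜) → Fin N → 𝕜} {η : Matrix (Fin N) (Fin N) 𝕜}

theorem pd_diagonal (i m j : Fin N) :
    pd i (fun y => Matrix.diagonal (g y) m j) u = if m = j then pd i (fun y => g y m) u else 0 := by
  simp only [Matrix.diagonal_apply]
  split_ifs
  · rfl
  · exact pd_const i 0

theorem christoffel_diagonal (hg : ∀ i, g u i ≠ 0) (k i j : Fin N) :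
    christoffel (fun y => Matrix.diagonal (g y)) k i j u = 2⁻¹ * ((g u k)⁻¹ *
      ((if k = j then pd i (fun y => g y k) u else 0)
        + (if k = i then pd j (fun y => g y k) u else 0)
        - if i = j then pd k (fun y => g y i) u else 0)) := by
  have hinv : (Matrix.diagonal (g u))⁻¹ = Matrix.diagonal fun i => (g u i)⁻¹ :=
    Matrix.inv_eq_right_inv <| by
      simp only [Matrix.diagonal_mul_diagonal, mul_inv_cancel₀ (hg _), Matrix.diagonal_one]
  simp only [christoffel, pd_diagonal, hinv]
  simp only [Matrix.diagonal_apply, ite_mul, zero_mul, Finset.sum_ite_eq, Finset.mem_univ, if_true]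

/-- Flat coordinates `x` of the diagonal metric `∑ g_i (duⁱ)²` together with functions `f` whose
covariant Hessians are `δ_{ij} ∂x/∂uⁱ`. A Baker--Akhiezer function has an expansion `x + f z + ⋯`
of this kind near the points `Q_k`. The Christoffel symbols enter only through their existence. -/
structure IsFlatFrame (U : Set (Fin N → 𝕜)) (g : (Fin N → 𝕜) → Fin N → 𝕜)
    (η : Matrix (Fin N) (Fin N) 𝕜) (x f : (Fin N → 𝕜) → Fin N → 𝕜) : Prop
    extends HasFlatCoordinates U (fun u => Matrix.diagonal (g u)) η x where
  η_det : η.det ≠ 0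
  smooth_f : ContDiffOn 𝕜 ∞ f U
  hessian : ∀ u ∈ U, ∀ i j, ∃ Γ : Fin N → 𝕜, ∀ k,
    (pd i (pd j fun y => x y k) u = ∑ p, Γ p * pd p (fun y => x y k) u) ∧
    pd i (pd j fun y => f y k) u =
      ∑ p, Γ p * pd p (fun y => f y k) u + if i = j then pd i (fun y => x y k) u else 0

namespace IsFlatFrame

theorem g_ne_zero (F : IsFlatFrame U g η x f) (hu : u ∈ U) (i : Fin N) : g u i ≠ 0 := by
  have hdet := F.det_ne_zero u hu
  rw [Matrix.det_diagonal, Finset.prod_ne_zero_iff] at hdet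
  exact hdet i (Finset.mem_univ i)

theorem contDiffOn_f_apply (F : IsFlatFrame U g η x f) (k : Fin N) :
    ContDiffOn 𝕜 ∞ (fun y => f y k) U := contDiffOn_pi.1 F.smooth_f k

theorem hasCovariantHessian_f (F : IsFlatFrame U g η x f) (k : Fin N) :
    HasCovariantHessian U (fun u => Matrix.diagonal (g u)) (fun y => f y k) fun y => x y k := by
  intro u hu i j
  obtain ⟨Γ, hΓ⟩ := F.hessian u hu i j
  simp only [← F.eq_christoffel hu fun k => (hΓ k).1]
  exact (hΓ k).2

theorem christoffel_add_christoffel (F : IsFlatFrame U g η x f) (hu : u ∈ U) {i j : Fin N}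
    (hij : i ≠ j) : christoffel (fun y => Matrix.diagonal (g y)) j i i u
      + christoffel (fun y => Matrix.diagonal (g y)) j j i u = 0 := by
  set Γ := christoffel fun y => Matrix.diagonal (g y) with hΓ
  -- The Ricci identity for `f`, without its curvature term, is a linear relation between the
  -- vectors `∂x/∂uᵖ`; the claim is the vanishing of the coefficient of `∂x/∂uʲ`.
  have hrel := F.eq_zero_of_sum_mul_pd_eq_zero hu (c := fun p =>
    (if p = i then Γ i j i u else 0) - (if p = j then Γ j i i u else 0) - Γ p j i u) fun k => by
      have hricci := (F.hasCovariantHessian_f k).ricci_identity F.isOpen (F.contDiffOn_f_apply k)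
        (F.contDiffOn_apply k) hu (F.differentiableAt_christoffel hu) i j i
      have hx := F.hasCovariantHessian k u hu j i
      simp only [F.isFlat u hu, zero_mul, Finset.sum_const_zero, zero_add, if_neg hij.symm,
        if_true, add_zero, pd_const, ← hΓ] at hricci hx
      simp only [sub_mul, Finset.sum_sub_distrib, ite_mul, zero_mul, Finset.sum_ite_eq',
        Finset.mem_univ, if_true, ← hx]
      linear_combination hricci
  have hj := congrFun hrel j
  simp only [if_neg hij.symm, if_true, Pi.zero_apply] at hj
  linear_combination -hj

theorem pd_metric_comm (F : IsFlatFrame U g η x f) (hu : u ∈ U) (i j : Fin N) :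
    pd j (fun y => g y i) u = pd i (fun y => g y j) u := by
  rcases eq_or_ne i j with rfl | hij
  · rfl
  have hΓ := F.christoffel_add_christoffel hu hij
  have hg := F.g_ne_zero hu j
  simp only [christoffel_diagonal fun k => F.g_ne_zero hu k, if_neg hij.symm, if_true] at hΓ
  field_simp at hΓ
  linear_combination -hΓ

variable {e : Fin N → 𝕜} {H : (Fin N → 𝕜) → Fin N → 𝕜}

theorem isEgorov (F : IsFlatFrame U g η x f) (he : ∀ i, e i = 1 ∨ e i = -1)
    (hH : ContDiffOn 𝕜 ∞ H U) (hg : ∀ u ∈ U, ∀ i, e i * H u i ^ 2 = g u i) : IsEgorov U e H := by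
  intro u hu i j
  have hH0 : ∀ i, H u i ≠ 0 := fun i h0 => F.g_ne_zero hu i (by rw [← hg u hu, h0]; ring)
  have hpd : ∀ i j, pd j (fun y => g y i) u = 2 * e i * H u i * pd j (fun y => H y i) u := by
    intro i j
    have hd := differentiableAt_of_contDiffOn F.isOpen (contDiffOn_pi.1 hH i) hu
    rw [← pd_congr_of_isOpen F.isOpen hu j fun y hy => hg y hy i]
    simp only [pow_two]
    rw [pd_const_mul j _ (hd.fun_mul hd), pd_mul j hd hd]
    ring
  have hcomm := F.pd_metric_comm hu i j
  rw [hpd, hpd] at hcomm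
  have he2 : e i * e i = 1 := by rcases he i with h | h <;> rw [h] <;> ring
  have hi := hH0 i
  have hj := hH0 j
  rw [rotation, rotation]
  field_simp
  linear_combination e i / 2 * hcomm - H u i * pd j (fun y => H y i) u * he2

theorem isFlatEgorov (F : IsFlatFrame U g η x f) (he : ∀ i, e i = 1 ∨ e i = -1)
    (hH : ContDiffOn 𝕜 ∞ H U) (hg : ∀ u ∈ U, ∀ i, e i * H u i ^ 2 = g u i) :
    IsFlatEgorov U e H η x := by
  have hdiag : ∀ u ∈ U, diagMetric e H u = Matrix.diagonal (g u) := fun u hu =>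
    congrArg Matrix.diagonal (funext (hg u hu))
  have hcoord : HasFlatCoordinates U (diagMetric e H) η x :=
    { F with
      det_ne_zero := fun u hu => hdiag u hu ▸ F.det_ne_zero u hu
      metric_eq := fun u hu => hdiag u hu ▸ F.metric_eq u hu }
  exact
    { F with
      sign := he
      smooth_H := hH
      H_ne_zero := fun u hu i h0 => F.g_ne_zero hu i (by rw [← hg u hu, h0]; ring)
      metric_eq := hcoord.metric_eq
      flat := hcoord.isFlat
      egorov := F.isEgorov he hH hg }

end IsFlatFrame

end Frames

section Potentials

variable {𝕜 : Type*} [RCLike 𝕜] {N : ℕ} {w₀ : Fin N → 𝕜} {r : ℝ} {p : Fin N → (Fin N → 𝕜) → 𝕜}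

theorem exists_pd_eq (hp : ∀ k, ContDiffOn 𝕜 ∞ (p k) (Metric.ball w₀ r))
    (hclosed : ∀ y ∈ Metric.ball w₀ r, ∀ i j, pd i (p j) y = pd j (p i) y) :
    ∃ Φ : (Fin N → 𝕜) → 𝕜, ContDiffOn 𝕜 ∞ Φ (Metric.ball w₀ r) ∧
      ∀ y ∈ Metric.ball w₀ r, ∀ k, pd k Φ y = p k y := by
  let π : Fin N → (Fin N → 𝕜) →L[𝕜] 𝕜 := fun k => ContinuousLinearMap.proj k
  let θ : (Fin N → 𝕜) → (Fin N → 𝕜) →L[𝕜] 𝕜 := fun y => ∑ k, p k y • π k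
  let θ' : (Fin N → 𝕜) → (Fin N → 𝕜) →L[𝕜] (Fin N → 𝕜) →L[𝕜] 𝕜 := fun y =>
    ∑ k, (fderiv 𝕜 (p k) y).smulRight (π k)
  have hθ : ContDiffOn 𝕜 ∞ θ (Metric.ball w₀ r) :=
    ContDiffOn.sum fun k _ => (hp k).smul contDiffOn_const
  have hθ' : ∀ y ∈ Metric.ball w₀ r, HasFDerivAt θ (θ' y) y := fun y hy =>
    HasFDerivAt.fun_sum fun k _ =>
      (differentiableAt_of_contDiffOn Metric.isOpen_ball (hp k) hy).hasFDerivAt.smul_const (π k)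
  have hsymm : ∀ y ∈ Metric.ball w₀ r, ∀ a b, θ' y a b = θ' y b a := by
    intro y hy a b
    simp only [θ', π, sum_apply, ContinuousLinearMap.smulRight_apply, smul_apply,
      ContinuousLinearMap.proj_apply, smul_eq_mul, fderiv_apply_eq_sum_pd, Finset.sum_mul]
    rw [Finset.sum_comm]
    refine Finset.sum_congr rfl fun i _ => Finset.sum_congr rfl fun j _ => ?_
    rw [hclosed y hy i j]
    ring
  have hθR : ∀ y ∈ Metric.ball w₀ r,
      HasFDerivWithinAt θ ((fun y => (θ' y).restrictScalars ℝ) y) (Metric.ball w₀ r) y :=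
    fun y hy => ((hθ' y hy).restrictScalars ℝ).hasFDerivWithinAt
  obtain ⟨Φ, hΦ⟩ :=
    (convex_ball w₀ r).exists_forall_hasFDerivWithinAt_of_hasFDerivWithinAt_symmetric hθR
      fun y hy a _ b _ => hsymm y hy a b
  have hΦ' : ∀ y ∈ Metric.ball w₀ r, HasFDerivAt Φ (θ y) y := fun y hy =>
    (hΦ y hy).hasFDerivAt (Metric.isOpen_ball.mem_nhds hy)
  refine ⟨Φ, (contDiffOn_infty_iff_fderiv_of_isOpen Metric.isOpen_ball).2
    ⟨fun y hy => (hΦ' y hy).differentiableAt.differentiableWithinAt,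
      hθ.congr fun y hy => (hΦ' y hy).fderiv⟩, fun y hy k => ?_⟩
  rw [pd, (hΦ' y hy).fderiv]
  simp [θ, π, Pi.single_apply]

theorem exists_pd3_eq (hp : ∀ k, ContDiffOn 𝕜 ∞ (p k) (Metric.ball w₀ r))
    (hsymm : ∀ y ∈ Metric.ball w₀ r, ∀ α β γ, pd α (pd β (p γ)) y = pd α (pd γ (p β)) y) :
    ∃ Φ : (Fin N → 𝕜) → 𝕜, ContDiffOn 𝕜 ∞ Φ (Metric.ball w₀ r) ∧
      ∀ y ∈ Metric.ball w₀ r, ∀ α β γ, pd3 Φ α β γ y = pd α (pd β (p γ)) y := by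
  set W := Metric.ball w₀ r
  have hW : IsOpen W := Metric.isOpen_ball
  have hpd : ∀ y ∈ W, ∀ β γ, DifferentiableAt 𝕜 (pd β (p γ)) y := fun y hy β γ =>
    differentiableAt_pd hW (hp γ) hy β
  let q : Fin N → (Fin N → 𝕜) → 𝕜 := fun γ y => p γ y - ∑ β, pd β (p γ) w₀ * y β
  have hq : ∀ y ∈ W, ∀ β γ, pd β (q γ) y = pd β (p γ) y - pd β (p γ) w₀ := fun y hy β γ => by
    rw [pd_sub β (differentiableAt_of_contDiffOn hW (hp γ) hy) (by fun_prop),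
      pd_linear β fun α => pd α (p γ) w₀]
  have hclosed : ∀ y ∈ W, ∀ β γ, pd β (q γ) y = pd γ (q β) y := by
    intro y hy β γ
    have hw₀ : w₀ ∈ W := Metric.mem_ball_self (Metric.nonempty_ball.1 ⟨y, hy⟩)
    have hconst := hW.is_const_of_fderiv_eq_zero (𝕜 := 𝕜)
      (f := fun y => pd β (p γ) y - pd γ (p β) y) (convex_ball _ _).isPreconnected
      (fun z hz => ((hpd z hz β γ).sub (hpd z hz γ β)).differentiableWithinAt)
      (fun z hz => ContinuousLinearMap.ext fun c => by
        rw [fderiv_apply_eq_sum_pd]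
        refine Finset.sum_eq_zero fun α _ => ?_
        rw [pd_sub α (hpd z hz β γ) (hpd z hz γ β), hsymm z hz, sub_self, mul_zero]) hy hw₀
    rw [hq y hy, hq y hy]
    linear_combination hconst
  obtain ⟨Φ, hΦ, hΦq⟩ := exists_pd_eq (p := q) (fun γ => (hp γ).sub (by fun_prop)) hclosed
  refine ⟨Φ, hΦ, fun y hy α β γ => ?_⟩
  rw [pd3, pd_congr_of_isOpen hW hy α fun z hz =>
    (pd_congr_of_isOpen hW hz β fun t ht => hΦq t ht γ).trans (hq z hz β γ),
    pd_sub α (hpd y hy β γ) (differentiableAt_const _), pd_const, sub_zero]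

end Potentials

section Branches

variable {𝕜 : Type*} [RCLike 𝕜] {N : ℕ} {U W : Set (Fin N → 𝕜)} {u w : Fin N → 𝕜}
  {g x f v : (Fin N → 𝕜) → Fin N → 𝕜} {η : Matrix (Fin N) (Fin N) 𝕜}
  {G : (Fin N → 𝕜) → Matrix (Fin N) (Fin N) 𝕜} {φ ξ : (Fin N → 𝕜) → 𝕜}
  {e : Fin N → 𝕜} {H : (Fin N → 𝕜) → Fin N → 𝕜}

theorem pd_pd_comp (hU : IsOpen U) (hW : IsOpen W) (hφ : ContDiffOn 𝕜 ∞ φ U)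
    (hv : ContDiffOn 𝕜 ∞ v W) (hmaps : Set.MapsTo v W U) (hw : w ∈ W) (α β : Fin N) :
    pd α (pd β fun y => φ (v y)) w =
      ∑ j, (pd α (pd β fun y => v y j) w * pd j φ (v w) +
        pd β (fun y => v y j) w * ∑ i, pd α (fun y => v y i) w * pd i (pd j φ) (v w)) := by
  have hdv : ∀ y ∈ W, DifferentiableAt 𝕜 v y := fun y hy => differentiableAt_of_contDiffOn hW hv hy
  have hpv : ∀ j, DifferentiableAt 𝕜 (pd β fun y => v y j) w := fun j =>
    differentiableAt_pd hW (contDiffOn_pi.1 hv j) hw β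
  have hpφ : ∀ j, DifferentiableAt 𝕜 (pd j φ) (v w) := differentiableAt_pd hU hφ (hmaps hw)
  have hcomp : ∀ j, DifferentiableAt 𝕜 (fun y => pd j φ (v y)) w := fun j =>
    (hpφ j).comp w (hdv w hw)
  rw [pd_congr_of_isOpen hW hw α fun y hy =>
    pd_comp β (differentiableAt_of_contDiffOn hU hφ (hmaps hy)) (hdv y hy),
    pd_sum _ _ fun j _ => (hpv j).fun_mul (hcomp j)]
  exact Finset.sum_congr rfl fun j _ => by
    rw [pd_mul α (hpv j) (hcomp j), pd_comp α (hpφ j) (hdv w hw)]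

theorem HasCovariantHessian.pd_pd_comp (hφ : HasCovariantHessian U G φ ξ) (hU : IsOpen U)
    (hW : IsOpen W) (hφs : ContDiffOn 𝕜 ∞ φ U) (hv : ContDiffOn 𝕜 ∞ v W)
    (hmaps : Set.MapsTo v W U) (hw : w ∈ W) (α β : Fin N) :
    pd α (pd β fun y => φ (v y)) w =
      ∑ p, (pd α (pd β fun y => v y p) w + ∑ j, ∑ i,
        christoffel G p i j (v w) * pd α (fun y => v y i) w * pd β (fun y => v y j) w)
          * pd p φ (v w)
      + ∑ i, pd α (fun y => v y i) w * pd β (fun y => v y i) w * pd i ξ (v w) := by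
  rw [FiniteGap.pd_pd_comp hU hW hφs hv hmaps hw]
  simp only [hφ _ (hmaps hw), mul_add, add_mul, Finset.sum_add_distrib, mul_ite, mul_zero,
    Finset.sum_ite_eq', Finset.mem_univ, if_true, Finset.mul_sum, Finset.sum_mul, ← add_assoc]
  rw [Finset.sum_comm (f := fun p j => ∑ i, _ * _ * _ * pd p φ (v w))]
  congr 1
  · congr 1
    refine Finset.sum_congr rfl fun j _ => ?_
    rw [Finset.sum_comm]
    exact Finset.sum_congr rfl fun p _ => Finset.sum_congr rfl fun i _ => by ring
  · exact Finset.sum_congr rfl fun j _ => by ring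

namespace IsBranch

theorem contDiffOn_apply (B : IsBranch U x W v) (k : Fin N) : ContDiffOn 𝕜 ∞ (fun y => v y k) W :=
  contDiffOn_pi.1 B.smooth k

theorem pd_comp_eq_ite (B : IsBranch U x W v) (hw : w ∈ W) (β k : Fin N) :
    pd β (fun y => x (v y) k) w = if β = k then 1 else 0 := by
  rw [pd_congr_of_isOpen B.isOpen hw β (g := fun y => y k) fun y hy => by rw [B.rightInv y hy],
    pd_coord]

theorem jacobian_mul_jacobian (B : IsBranch U x W v) (hx : DifferentiableAt 𝕜 x (v w))
    (hw : w ∈ W) : jacobian x (v w) * jacobian v w = 1 := by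
  ext k β
  rw [Matrix.one_apply, Matrix.mul_apply]
  simp only [eq_comm (a := k), ← B.pd_comp_eq_ite hw,
    pd_comp (f := fun y => x y k) β (differentiableAt_pi.1 hx k)
      (differentiableAt_of_contDiffOn B.isOpen B.smooth hw), jacobian, Matrix.of_apply, mul_comm]

end IsBranch

namespace HasFlatCoordinates

theorem sum_christoffel_add_pd_pd_eq_zero (hG : HasFlatCoordinates U G η x)
    (B : IsBranch U x W v) (hw : w ∈ W) (α β p : Fin N) :
    pd α (pd β fun y => v y p) w + ∑ j, ∑ i,
      christoffel G p i j (v w) * pd α (fun y => v y i) w * pd β (fun y => v y j) w = 0 := by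
  refine congrFun (hG.eq_zero_of_sum_mul_pd_eq_zero (B.mapsTo hw) (c := fun p =>
    pd α (pd β fun y => v y p) w + ∑ j, ∑ i,
      christoffel G p i j (v w) * pd α (fun y => v y i) w * pd β (fun y => v y j) w) fun k => ?_) p
  have hx := (hG.hasCovariantHessian k).pd_pd_comp hG.isOpen B.isOpen (hG.contDiffOn_apply k)
    B.smooth B.mapsTo hw α β
  rw [pd_congr_of_isOpen B.isOpen hw α fun y hy => B.pd_comp_eq_ite hy β k, pd_const] at hx
  simpa only [pd_const, mul_zero, Finset.sum_const_zero, add_zero] using hx.symm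

theorem pd_pd_comp_branch (hG : HasFlatCoordinates U G η x) (hφ : HasCovariantHessian U G φ ξ)
    (hφs : ContDiffOn 𝕜 ∞ φ U) (B : IsBranch U x W v) (hw : w ∈ W) (α β : Fin N) :
    pd α (pd β fun y => φ (v y)) w =
      ∑ i, pd α (fun y => v y i) w * pd β (fun y => v y i) w * pd i ξ (v w) := by
  simp only [hφ.pd_pd_comp hG.isOpen B.isOpen hφs B.smooth B.mapsTo hw,
    hG.sum_christoffel_add_pd_pd_eq_zero B hw, zero_mul, Finset.sum_const_zero, zero_add]

theorem exists_branch (hG : HasFlatCoordinates U G η x) (hu : u ∈ U) :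
    ∃ (r : ℝ) (v : (Fin N → 𝕜) → Fin N → 𝕜), 0 < r ∧ IsBranch U x (Metric.ball (x u) r) v ∧
      v (x u) = u := by
  have hequiv : ∀ y ∈ U, ∃ E : (Fin N → 𝕜) ≃L[𝕜] (Fin N → 𝕜),
      HasFDerivAt x (E : (Fin N → 𝕜) →L[𝕜] (Fin N → 𝕜)) y := fun y hy => by
    obtain ⟨L, hL⟩ := hG.exists_comp_fderiv_eq_id hy
    have hinj : Function.Injective (fderiv 𝕜 x y : (Fin N → 𝕜) →ₗ[𝕜] (Fin N → 𝕜)) :=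
      Function.LeftInverse.injective (g := L) fun c => DFunLike.congr_fun hL c
    exact ⟨(LinearEquiv.ofInjectiveEndo _ hinj).toContinuousLinearEquiv,
      (differentiableAt_of_contDiffOn hG.isOpen hG.smooth_x hy).hasFDerivAt⟩
  have hsmooth : ∀ y ∈ U, ContDiffAt 𝕜 ∞ x y := fun y hy =>
    hG.smooth_x.contDiffAt (hG.isOpen.mem_nhds hy)
  obtain ⟨E, hE⟩ := hequiv u hu
  let Ψ := (hsmooth u hu).toOpenPartialHomeomorph x hE (by simp)
  have hΨ : (Ψ : (Fin N → 𝕜) → Fin N → 𝕜) = x :=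
    (hsmooth u hu).toOpenPartialHomeomorph_coe hE (by simp)
  have hsource : u ∈ Ψ.source := (hsmooth u hu).mem_toOpenPartialHomeomorph_source hE (by simp)
  have hsymm : Ψ.symm (x u) = u := hΨ ▸ Ψ.left_inv hsource
  obtain ⟨r, hr, hball⟩ := Metric.isOpen_iff.1 (Ψ.isOpen_inter_preimage_symm hG.isOpen) (x u)
    ⟨hΨ ▸ Ψ.map_source hsource, by rwa [Set.mem_preimage, hsymm]⟩
  refine ⟨r, Ψ.symm, hr, ⟨Metric.isOpen_ball, fun y hy => ?_, fun y hy => (hball hy).2,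
    fun y hy => hΨ ▸ Ψ.right_inv (hball hy).1⟩, hsymm⟩
  obtain ⟨E', hE'⟩ := hequiv _ (hball hy).2
  exact (Ψ.contDiffAt_symm (hball hy).1 (f₀' := E') (hΨ ▸ hE')
    (hΨ ▸ hsmooth _ (hball hy).2)).contDiffWithinAt

end HasFlatCoordinates

namespace IsFlatFrame

theorem g_mul_pd (F : IsFlatFrame U g η x f) (B : IsBranch U x W v) (hw : w ∈ W)
    (i γ : Fin N) : g (v w) i * pd γ (fun y => v y i) w =
      ∑ m, η γ m * pd i (fun y => x y m) (v w) := by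
  have hmat : Matrix.diagonal (g (v w)) * jacobian v w = (jacobian x (v w)).transpose * η := by
    rw [← F.jacobian_transpose_mul_mul (B.mapsTo hw), Matrix.mul_assoc, B.jacobian_mul_jacobian
      (differentiableAt_of_contDiffOn F.isOpen F.smooth_x (B.mapsTo hw)) hw, Matrix.mul_one]
  have hentry := congrFun (congrFun hmat i) γ
  rw [Matrix.diagonal_mul, Matrix.mul_apply] at hentry
  simpa only [jacobian, Matrix.of_apply, Matrix.transpose_apply, mul_comm,
    F.η_symm.apply γ] using hentry

theorem correlator_eq_sum_g (hg : ∀ u ∈ U, ∀ i, e i * H u i ^ 2 = g u i) (B : IsBranch U x W v)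
    (hw : w ∈ W) (α β γ : Fin N) : correlator e H v α β γ w =
      ∑ i, g (v w) i * pd α (fun y => v y i) w * pd β (fun y => v y i) w
        * pd γ (fun y => v y i) w := by
  simp only [correlator, hg _ (B.mapsTo hw)]

theorem correlator_eq_sum_η (F : IsFlatFrame U g η x f)
    (hg : ∀ u ∈ U, ∀ i, e i * H u i ^ 2 = g u i) (B : IsBranch U x W v) (hw : w ∈ W)
    (α β γ : Fin N) : correlator e H v α β γ w =
      ∑ m, η γ m * ∑ i, pd α (fun y => v y i) w * pd β (fun y => v y i) w
        * pd i (fun y => x y m) (v w) := by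
  simp only [Finset.mul_sum, correlator_eq_sum_g hg B hw]
  rw [Finset.sum_comm]
  refine Finset.sum_congr rfl fun i _ => ?_
  calc _ = pd α (fun y => v y i) w * pd β (fun y => v y i) w *
        (g (v w) i * pd γ (fun y => v y i) w) := by ring
    _ = _ := by
        rw [F.g_mul_pd B hw, Finset.mul_sum]
        exact Finset.sum_congr rfl fun m _ => by ring

theorem sum_correlator_mul_correlator (F : IsFlatFrame U g η x f)
    (hg : ∀ u ∈ U, ∀ i, e i * H u i ^ 2 = g u i) (B : IsBranch U x W v) (hw : w ∈ W)
    (α β γ δ : Fin N) :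
    ∑ p, ∑ q, correlator e H v α β p w * η⁻¹ p q * correlator e H v γ δ q w =
      ∑ i, g (v w) i * pd α (fun y => v y i) w * pd β (fun y => v y i) w
        * (pd γ (fun y => v y i) w * pd δ (fun y => v y i) w) := by
  set a : Fin N → 𝕜 := fun i => g (v w) i * pd α (fun y => v y i) w * pd β (fun y => v y i) w
  set b : Fin N → 𝕜 := fun i => pd γ (fun y => v y i) w * pd δ (fun y => v y i) w
  have ha : (fun p => correlator e H v α β p w) = Matrix.vecMul a (jacobian v w) :=
    funext fun p => correlator_eq_sum_g hg B hw α β p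
  have hb : (fun q => correlator e H v γ δ q w) = (η * jacobian x (v w)).mulVec b := by
    rw [← Matrix.mulVec_mulVec]
    funext q
    simp only [F.correlator_eq_sum_η hg B hw, ← jacobian_mulVec]
    rfl
  have hjac := mul_eq_one_comm.1 (B.jacobian_mul_jacobian
    (differentiableAt_of_contDiffOn F.isOpen F.smooth_x (B.mapsTo hw)) hw)
  calc _ = Matrix.vecMul a (jacobian v w) ⬝ᵥ η⁻¹.mulVec ((η * jacobian x (v w)).mulVec b) := by
        rw [← ha, ← hb]
        simp only [dotProduct, Matrix.mulVec, Finset.mul_sum, mul_assoc]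
    _ = a ⬝ᵥ b := by
        rw [Matrix.mulVec_mulVec, ← Matrix.mul_assoc,
          Matrix.nonsing_inv_mul _ F.η_det.isUnit, Matrix.one_mul, ← Matrix.dotProduct_mulVec,
          Matrix.mulVec_mulVec, hjac, Matrix.one_mulVec]

theorem givesAssociativity (F : IsFlatFrame U g η x f)
    (hg : ∀ u ∈ U, ∀ i, e i * H u i ^ 2 = g u i) : GivesAssociativity U e H η x := by
  intro u hu
  obtain ⟨r, v, hr, B, hvu⟩ := F.exists_branch hu
  have hf : ∀ m, ContDiffOn 𝕜 ∞ (fun y => f (v y) m) (Metric.ball (x u) r) := fun m =>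
    (F.contDiffOn_f_apply m).comp B.smooth B.mapsTo
  have hpd : ∀ w ∈ Metric.ball (x u) r, ∀ α β γ,
      pd α (pd β fun y => ∑ m, η γ m * f (v y) m) w = correlator e H v α β γ w := by
    intro w hw α β γ
    have hfd : ∀ y ∈ Metric.ball (x u) r, ∀ m, DifferentiableAt 𝕜 (fun y => f (v y) m) y :=
      fun y hy m => differentiableAt_of_contDiffOn B.isOpen (hf m) hy
    rw [pd_congr_of_isOpen B.isOpen hw α fun y hy => (pd_sum _ β fun m _ =>
        (hfd y hy m).const_mul (η γ m)).trans (Finset.sum_congr rfl fun m _ =>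
          pd_const_mul β (η γ m) (hfd y hy m)),
      pd_sum _ _ fun m _ => (differentiableAt_pd B.isOpen (hf m) hw β).const_mul (η γ m),
      F.correlator_eq_sum_η hg B hw]
    exact Finset.sum_congr rfl fun m _ => by
      rw [pd_const_mul α (η γ m) (differentiableAt_pd B.isOpen (hf m) hw β),
        F.pd_pd_comp_branch (F.hasCovariantHessian_f m) (F.contDiffOn_f_apply m) B hw]
  obtain ⟨Φ, hΦ, hΦp⟩ := exists_pd3_eq (fun γ => ContDiffOn.sum fun m _ =>
    contDiffOn_const.mul (hf m)) fun w hw α β γ => by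
      rw [hpd w hw, hpd w hw, correlator, correlator]
      exact Finset.sum_congr rfl fun i _ => by ring
  have hcorr : ∀ w ∈ Metric.ball (x u) r, ∀ α β γ, pd3 Φ α β γ w = correlator e H v α β γ w :=
    fun w hw α β γ => (hΦp w hw α β γ).trans (hpd w hw α β γ)
  refine ⟨_, v, Φ, B, Metric.mem_ball_self hr, hvu, hΦ, hcorr, fun w hw α β γ δ => ?_⟩
  simp only [hcorr w hw, F.sum_correlator_mul_correlator hg B hw]
  exact Finset.sum_congr rfl fun i _ => by ring

end IsFlatFrame

end Branches

section Homogeneity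

variable {𝕜 : Type*} [RCLike 𝕜] {N : ℕ} {U W : Set (Fin N → 𝕜)} {w : Fin N → 𝕜}
  {g x f v : (Fin N → 𝕜) → Fin N → 𝕜} {η : Matrix (Fin N) (Fin N) 𝕜}

/-- Euler's relation of degree `a` at the point `w`. -/
def EulerAt (a : 𝕜) (φ : (Fin N → 𝕜) → 𝕜) (w : Fin N → 𝕜) : Prop :=
  DifferentiableAt 𝕜 φ w ∧ fderiv 𝕜 φ w w = a * φ w

namespace EulerAt

variable {a b : 𝕜} {φ χ : (Fin N → 𝕜) → 𝕜}

theorem mul (hφ : EulerAt a φ w) (hχ : EulerAt b χ w) :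
    EulerAt (a + b) (fun y => φ y * χ y) w := by
  refine ⟨hφ.1.mul hχ.1, ?_⟩
  rw [fderiv_fun_mul hφ.1 hχ.1]
  simp only [add_apply, smul_apply, smul_eq_mul, hφ.2, hχ.2]
  ring

theorem const_mul (c : 𝕜) (hφ : EulerAt a φ w) : EulerAt a (fun y => c * φ y) w := by
  refine ⟨hφ.1.const_mul c, ?_⟩
  rw [fderiv_const_mul hφ.1, smul_apply, smul_eq_mul, hφ.2]
  ring

theorem sum {ι : Type*} {s : Finset ι} {φ : ι → (Fin N → 𝕜) → 𝕜}
    (hφ : ∀ i ∈ s, EulerAt a (φ i) w) : EulerAt a (fun y => ∑ i ∈ s, φ i y) w := by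
  refine ⟨DifferentiableAt.fun_sum fun i hi => (hφ i hi).1, ?_⟩
  rw [fderiv_fun_sum fun i hi => (hφ i hi).1, sum_apply, Finset.mul_sum]
  exact Finset.sum_congr rfl fun i hi => (hφ i hi).2

end EulerAt

theorem apply_smul_of_eulerAt {φ : (Fin N → 𝕜) → 𝕜} {c : 𝕜} (hc : c ≠ 0)
    (hφ : ∀ y ∈ segment ℝ w (c • w), EulerAt (-1) φ y) : φ (c • w) = c⁻¹ * φ w := by
  let s : ℝ → 𝕜 := fun t => 1 + (t : 𝕜) * (c - 1)
  have hmem : ∀ t ∈ Set.Icc (0 : ℝ) 1, s t • w ∈ segment ℝ w (c • w) := by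
    intro t ht
    rw [segment_eq_image ℝ]
    refine ⟨t, ht, ?_⟩
    ext i
    simp only [s, Pi.add_apply, Pi.smul_apply, smul_eq_mul, RCLike.real_smul_eq_coe_mul]
    push_cast
    ring
  have hs : ∀ t, HasDerivAt s (c - 1) t := fun t => by
    simpa [s] using
      (((RCLike.ofRealCLM (K := 𝕜)).hasDerivAt (x := t)).mul_const (c - 1)).const_add 1
  have hderiv : ∀ t ∈ Set.Icc (0 : ℝ) 1, HasDerivAt (fun t => s t * φ (s t • w)) 0 t := by
    intro t ht
    obtain ⟨hd, heuler⟩ := hφ _ (hmem t ht)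
    have hcomp : HasDerivAt (fun t => φ (s t • w)) (fderiv 𝕜 φ (s t • w) ((c - 1) • w)) t :=
      HasFDerivAt.comp_hasDerivAt (f := fun t => s t • w) t
        (hd.hasFDerivAt.restrictScalars ℝ) ((hs t).smul_const w)
    convert (hs t).fun_mul hcomp using 1
    rw [map_smul, smul_eq_mul] at heuler ⊢
    linear_combination -(c - 1) * heuler
  have hconst := constant_of_derivWithin_zero (f := fun t => s t * φ (s t • w)) (a := 0) (b := 1)
    (fun t ht => (hderiv t ht).differentiableAt.differentiableWithinAt)
    (fun t ht => ((hderiv t ⟨ht.1, ht.2.le⟩).hasDerivWithinAt).derivWithin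
      (uniqueDiffOn_Icc zero_lt_one t ⟨ht.1, ht.2.le⟩)) 1 (by simp)
  simp only [s, RCLike.ofReal_one, one_mul, add_sub_cancel, RCLike.ofReal_zero, zero_mul, add_zero,
    one_smul] at hconst
  rw [← hconst, inv_mul_cancel_left₀ hc]

namespace HasFlatCoordinates

variable {G : (Fin N → 𝕜) → Matrix (Fin N) (Fin N) 𝕜} {ρ : 𝕜}

theorem sum_mul_pd_branch (hG : HasFlatCoordinates U G η x)
    (hx : ∀ u ∈ U, ∀ k, ∑ i, pd i (fun y => x y k) u = ρ * x u k) (B : IsBranch U x W v)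
    (hw : w ∈ W) (i : Fin N) : ∑ α, w α * pd α (fun y => v y i) w = ρ⁻¹ := by
  have hJx : (jacobian x (v w)).mulVec 1 = ρ • w := by
    funext k
    simp only [jacobian_mulVec, Pi.one_apply, one_mul, hx _ (B.mapsTo hw), B.rightInv w hw,
      Pi.smul_apply, smul_eq_mul]
  have hJv : ρ • (jacobian v w).mulVec w = 1 := by
    rw [← Matrix.mulVec_smul, ← hJx, Matrix.mulVec_mulVec, mul_eq_one_comm.1
      (B.jacobian_mul_jacobian
        (differentiableAt_of_contDiffOn hG.isOpen hG.smooth_x (B.mapsTo hw)) hw),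
      Matrix.one_mulVec]
  rw [← jacobian_mulVec]
  exact eq_inv_of_mul_eq_one_right (congrFun hJv i)

theorem eulerAt_comp_branch (hG : HasFlatCoordinates U G η x) (hρ : ρ ≠ 0)
    (hx : ∀ u ∈ U, ∀ k, ∑ i, pd i (fun y => x y k) u = ρ * x u k) (B : IsBranch U x W v)
    (hw : w ∈ W) {φ : (Fin N → 𝕜) → 𝕜} (hφ : DifferentiableAt 𝕜 φ (v w))
    (hφρ : ∑ i, pd i φ (v w) = ρ * φ (v w)) : EulerAt 1 (fun y => φ (v y)) w := by
  have hv := differentiableAt_of_contDiffOn B.isOpen B.smooth hw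
  refine ⟨hφ.comp w hv, ?_⟩
  simp only [fderiv_apply_eq_sum_pd, pd_comp _ hφ hv, Finset.mul_sum]
  rw [Finset.sum_comm]
  simp only [← mul_assoc, ← Finset.sum_mul, hG.sum_mul_pd_branch hx B hw]
  rw [← Finset.mul_sum, hφρ, inv_mul_cancel_left₀ hρ, one_mul]

theorem eulerAt_pd_branch (hG : HasFlatCoordinates U G η x)
    (hx : ∀ u ∈ U, ∀ k, ∑ i, pd i (fun y => x y k) u = ρ * x u k) (B : IsBranch U x W v)
    (hw : w ∈ W) (β i : Fin N) : EulerAt (-1) (pd β fun y => v y i) w := by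
  have hd : ∀ α, DifferentiableAt 𝕜 (pd α fun y => v y i) w :=
    differentiableAt_pd B.isOpen (B.contDiffOn_apply i) hw
  refine ⟨hd β, ?_⟩
  have hcoord : ∀ α, DifferentiableAt 𝕜 (fun y : Fin N → 𝕜 => y α) w := fun α => by fun_prop
  have hdiff := pd_congr_of_isOpen B.isOpen hw β fun y hy => hG.sum_mul_pd_branch hx B hy i
  rw [pd_const, pd_sum _ _ fun α _ => (hcoord α).fun_mul (hd α)] at hdiff
  simp only [pd_mul β (hcoord _) (hd _), pd_coord, ite_mul, one_mul, zero_mul,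
    Finset.sum_add_distrib, Finset.sum_ite_eq, Finset.mem_univ, if_true] at hdiff
  rw [fderiv_apply_eq_sum_pd]
  simp only [pd_comm B.isOpen (B.contDiffOn_apply i) hw _ β]
  linear_combination hdiff

end HasFlatCoordinates

theorem IsFlatFrame.correlatorsHomogeneous {e : Fin N → 𝕜} {H : (Fin N → 𝕜) → Fin N → 𝕜} {ρ : 𝕜}
    (F : IsFlatFrame U g η x f) (hg : ∀ u ∈ U, ∀ i, e i * H u i ^ 2 = g u i) (hρ : ρ ≠ 0)
    (hx : ∀ u ∈ U, ∀ k, ∑ i, pd i (fun y => x y k) u = ρ * x u k) :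
    CorrelatorsHomogeneous U e H x := by
  intro W v B w _ c hc hseg α β γ
  have hpdx : ∀ u ∈ U, ∀ i m, ∑ j, pd j (pd i fun y => x y m) u = ρ * pd i (fun y => x y m) u := by
    intro u hu i m
    simp only [pd_comm F.isOpen (F.contDiffOn_apply m) hu _ i]
    rw [← pd_sum _ _ fun j _ => differentiableAt_pd F.isOpen (F.contDiffOn_apply m) hu j,
      pd_congr_of_isOpen F.isOpen hu i fun y hy => hx y hy m,
      pd_const_mul i ρ (differentiableAt_of_contDiffOn F.isOpen (F.contDiffOn_apply m) hu)]
  rw [F.correlator_eq_sum_η hg B (hseg (left_mem_segment ℝ _ _)),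
    F.correlator_eq_sum_η hg B (hseg (right_mem_segment ℝ _ _))]
  refine apply_smul_of_eulerAt (φ := fun y => ∑ m, η γ m * ∑ i, pd α (fun y => v y i) y
    * pd β (fun y => v y i) y * pd i (fun y => x y m) (v y)) hc fun y hy => ?_
  have hyW := hseg hy
  refine EulerAt.sum fun m _ => (EulerAt.sum fun i _ => ?_).const_mul _
  have hprod := ((F.eulerAt_pd_branch hx B hyW α i).mul
    (F.eulerAt_pd_branch hx B hyW β i)).mul (F.eulerAt_comp_branch hρ hx B hyW
      (differentiableAt_pd F.isOpen (F.contDiffOn_apply m) (B.mapsTo hyW) i)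
      (hpdx _ (B.mapsTo hyW) i m))
  rwa [show (-1 : 𝕜) + -1 + 1 = -1 by ring] at hprod

end Homogeneity

section RealPoints

variable {N : ℕ} {V : Set (Fin N → ℂ)} {φ : (Fin N → ℂ) → ℂ} {u : Fin N → ℝ}

/-- The inclusion of the real points `ℝ^N` into `ℂ^N`. -/
noncomputable def ofRealVec : (Fin N → ℝ) →L[ℝ] (Fin N → ℂ) :=
  ContinuousLinearMap.pi fun i => Complex.ofRealCLM.comp (ContinuousLinearMap.proj i)

theorem ofRealVec_apply (u : Fin N → ℝ) (i : Fin N) : ofRealVec u i = u i := rfl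

theorem ofRealVec_single (i : Fin N) : ofRealVec (Pi.single i (1 : ℝ)) = Pi.single i (1 : ℂ) := by
  ext j
  rw [ofRealVec_apply, Pi.single_apply, Pi.single_apply, apply_ite Complex.ofReal,
    Complex.ofReal_one, Complex.ofReal_zero]

theorem isOpen_preimage_ofRealVec (hV : IsOpen V) : IsOpen (ofRealVec ⁻¹' V : Set (Fin N → ℝ)) :=
  hV.preimage ofRealVec.continuous

theorem contDiffOn_re (hφ : ContDiffOn ℂ ∞ φ V) :
    ContDiffOn ℝ ∞ (fun y => (φ (ofRealVec y)).re) (ofRealVec ⁻¹' V) :=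
  Complex.reCLM.contDiff.comp_contDiffOn
    ((hφ.restrict_scalars ℝ).comp ofRealVec.contDiff.contDiffOn fun _ hy => hy)

theorem pd_comp_ofRealVec (L : ℂ →L[ℝ] ℝ) (hφ : DifferentiableAt ℂ φ (ofRealVec u)) (i : Fin N) :
    pd i (fun y => L (φ (ofRealVec y))) u = L (pd i φ (ofRealVec u)) := by
  have hcomp : HasFDerivAt (fun y => L (φ (ofRealVec y)))
      (L.comp (((fderiv ℂ φ (ofRealVec u)).restrictScalars ℝ).comp ofRealVec)) u :=
    L.hasFDerivAt.comp u ((hφ.hasFDerivAt.restrictScalars ℝ).comp u ofRealVec.hasFDerivAt)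
  rw [pd, hcomp.fderiv, pd, ← ofRealVec_single]
  rfl

theorem pd_re (hφ : DifferentiableAt ℂ φ (ofRealVec u)) (i : Fin N) :
    pd i (fun y => (φ (ofRealVec y)).re) u = (pd i φ (ofRealVec u)).re :=
  pd_comp_ofRealVec Complex.reCLM hφ i

theorem pd_pd_re (hV : IsOpen V) (hφ : ContDiffOn ℂ ∞ φ V) (hu : ofRealVec u ∈ V) (i j : Fin N) :
    pd i (pd j fun y => (φ (ofRealVec y)).re) u = (pd i (pd j φ) (ofRealVec u)).re := by
  rw [← pd_re (differentiableAt_pd hV hφ hu j)]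
  exact pd_congr_of_isOpen (isOpen_preimage_ofRealVec hV) hu i fun y hy =>
    pd_re (differentiableAt_of_contDiffOn hV hφ hy) j

theorem pd_ofRealVec_eq_ofReal (hV : IsOpen V) (hφ : ContDiffOn ℂ ∞ φ V)
    (hreal : ∀ u : Fin N → ℝ, ofRealVec u ∈ V → (φ (ofRealVec u)).im = 0) (hu : ofRealVec u ∈ V)
    (i : Fin N) :
    pd i φ (ofRealVec u) = ((pd i (fun y => (φ (ofRealVec y)).re) u : ℝ) : ℂ) := by
  have hd := differentiableAt_of_contDiffOn hV hφ hu
  refine Complex.ext (pd_re hd i).symm ?_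
  rw [Complex.ofReal_im, ← Complex.imCLM_apply, ← pd_comp_ofRealVec Complex.imCLM hd, ← pd_const i]
  exact pd_congr_of_isOpen (isOpen_preimage_ofRealVec hV) hu i hreal

variable {g x f : (Fin N → ℂ) → Fin N → ℂ} {η : Matrix (Fin N) (Fin N) ℂ}

theorem HasFlatCoordinates.re {G : (Fin N → ℂ) → Matrix (Fin N) (Fin N) ℂ}
    (hG : HasFlatCoordinates V G η x) (hη : ∀ k m, (η k m).im = 0)
    (hx : ∀ u : Fin N → ℝ, ofRealVec u ∈ V → ∀ k, (x (ofRealVec u) k).im = 0) :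
    HasFlatCoordinates (ofRealVec ⁻¹' V) (fun u => (G (ofRealVec u)).map Complex.re)
      (η.map Complex.re) fun u k => (x (ofRealVec u) k).re := by
  have hη' : ∀ k m, η k m = ((η.map Complex.re k m : ℝ) : ℂ) := fun k m =>
    Complex.ext rfl (hη k m)
  have hmetric : ∀ u : Fin N → ℝ, ofRealVec u ∈ V → ∀ i j, G (ofRealVec u) i j =
      ((∑ k, ∑ m, η.map Complex.re k m * pd i (fun y => (x (ofRealVec y) k).re) u
        * pd j (fun y => (x (ofRealVec y) m).re) u : ℝ) : ℂ) := by
    intro u hu i j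
    rw [← hG.metric_eq _ hu]
    simp only [fun i k => pd_ofRealVec_eq_ofReal hG.isOpen (hG.contDiffOn_apply k)
      (fun y hy => hx y hy k) hu i, Complex.ofReal_sum, Complex.ofReal_mul, ← hη']
  exact
    { isOpen := isOpen_preimage_ofRealVec hG.isOpen
      smooth_x := contDiffOn_pi.2 fun k => contDiffOn_re (hG.contDiffOn_apply k)
      η_symm := hG.η_symm.map _
      det_ne_zero := fun u hu h0 => hG.det_ne_zero _ hu <| by
        rw [show G (ofRealVec u) = ((G (ofRealVec u)).map Complex.re).map Complex.ofRealHom from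
          Matrix.ext fun i j => by
            simp only [Matrix.map_apply, hmetric u hu, Complex.ofReal_re, Complex.ofRealHom_eq_coe],
          ← RingHom.mapMatrix_apply, ← RingHom.map_det, h0, map_zero]
      metric_eq := fun u hu i j => by
        rw [Matrix.map_apply, hmetric u hu, Complex.ofReal_re] }

theorem IsFlatFrame.re (F : IsFlatFrame V g η x f) (hη : ∀ k m, (η k m).im = 0)
    (hx : ∀ u : Fin N → ℝ, ofRealVec u ∈ V → ∀ k, (x (ofRealVec u) k).im = 0)
    (hf : ∀ u : Fin N → ℝ, ofRealVec u ∈ V → ∀ k, (f (ofRealVec u) k).im = 0) :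
    IsFlatFrame (ofRealVec ⁻¹' V) (fun u i => (g (ofRealVec u) i).re) (η.map Complex.re)
      (fun u k => (x (ofRealVec u) k).re) fun u k => (f (ofRealVec u) k).re := by
  have hcoord := F.toHasFlatCoordinates.re hη hx
  simp only [Matrix.diagonal_map Complex.zero_re] at hcoord
  have hpx : ∀ u : Fin N → ℝ, ofRealVec u ∈ V → ∀ i k, pd i (fun y => x y k) (ofRealVec u) =
      ((pd i (fun y => (x (ofRealVec y) k).re) u : ℝ) : ℂ) := fun u hu i k =>
    pd_ofRealVec_eq_ofReal F.isOpen (F.contDiffOn_apply k) (fun y hy => hx y hy k) hu i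
  have hpf : ∀ u : Fin N → ℝ, ofRealVec u ∈ V → ∀ i k, pd i (fun y => f y k) (ofRealVec u) =
      ((pd i (fun y => (f (ofRealVec y) k).re) u : ℝ) : ℂ) := fun u hu i k =>
    pd_ofRealVec_eq_ofReal F.isOpen (F.contDiffOn_f_apply k) (fun y hy => hf y hy k) hu i
  refine
    { hcoord with
      η_det := fun h0 => F.η_det ?_
      smooth_f := contDiffOn_pi.2 fun k => contDiffOn_re (F.contDiffOn_f_apply k)
      hessian := fun u hu i j => ?_ }
  · rw [show η = (η.map Complex.re).map Complex.ofRealHom from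
        Matrix.ext fun k m => Complex.ext rfl (hη k m),
      ← RingHom.mapMatrix_apply, ← RingHom.map_det, h0, map_zero]
  · obtain ⟨Γ, hΓ⟩ := F.hessian _ hu i j
    refine ⟨fun p => (Γ p).re, fun k => ⟨?_, ?_⟩⟩
    · rw [pd_pd_re F.isOpen (F.contDiffOn_apply k) hu, (hΓ k).1]
      simp only [hpx u hu, Complex.re_sum, Complex.re_mul_ofReal]
    · rw [pd_pd_re F.isOpen (F.contDiffOn_f_apply k) hu, (hΓ k).2]
      simp only [hpx u hu, hpf u hu, Complex.add_re, Complex.re_sum, Complex.re_mul_ofReal,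
        apply_ite Complex.re, Complex.ofReal_re, Complex.zero_re]

end RealPoints

open Polynomial

section RootProducts

variable {K : Type*} [CommRing K]

/-- The monic polynomial with a prescribed multiset of roots. -/
noncomputable def rootProd (s : Multiset K) : K[X] := (s.map fun a => X - C a).prod

theorem rootProd_add (s t : Multiset K) : rootProd (s + t) = rootProd s * rootProd t := by
  rw [rootProd, Multiset.map_add, Multiset.prod_add, rootProd, rootProd]

theorem rootProd_monic (s : Multiset K) : (rootProd s).Monic :=
  monic_multiset_prod_of_monic _ _ fun a _ => monic_X_sub_C a

theorem natDegree_rootProd [Nontrivial K] (s : Multiset K) : (rootProd s).natDegree = s.card :=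
  natDegree_multiset_prod_X_sub_C_eq_card s

theorem coeff_rootProd_card [Nontrivial K] (s : Multiset K) : (rootProd s).coeff s.card = 1 := by
  rw [← natDegree_rootProd]
  exact rootProd_monic s

theorem map_rootProd {L : Type*} [CommRing L] (σ : K →+* L) (s : Multiset K) :
    (rootProd s).map σ = rootProd (s.map σ) := by
  rw [rootProd, rootProd, Polynomial.map_multiset_prod, Multiset.map_map, Multiset.map_map]
  simp only [Function.comp_def, Polynomial.map_sub, map_X, map_C]

theorem rootProd_comp_neg_X (s : Multiset K) :
    (rootProd s).comp (-X) = (-1) ^ s.card * rootProd (s.map Neg.neg) := by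
  have hlin : ∀ a : K, (X - C a).comp (-X) = -1 * (X - C (-a)) := fun a => by
    rw [sub_comp, X_comp, C_comp, C_neg]
    ring
  rw [rootProd, rootProd, multiset_prod_comp, Multiset.map_map, Multiset.map_map]
  simp only [Function.comp_def, hlin]
  rw [Multiset.prod_map_mul, Multiset.map_const', Multiset.prod_replicate]

variable [IsDomain K]

theorem rootMultiplicity_rootProd [DecidableEq K] (s : Multiset K) (a : K) :
    (rootProd s).rootMultiplicity a = s.count a := by
  rw [← count_roots, rootProd, roots_multiset_prod_X_sub_C]

theorem eval_rootProd_eq_zero_iff {s : Multiset K} {a : K} :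
    (rootProd s).eval a = 0 ↔ a ∈ s := by
  rw [← IsRoot.def, ← mem_roots (rootProd_monic s).ne_zero, rootProd, roots_multiset_prod_X_sub_C]

theorem eval_rootProd_ne_zero {s : Multiset K} {a : K} (ha : a ∉ s) : (rootProd s).eval a ≠ 0 :=
  eval_rootProd_eq_zero_iff.not.2 ha

theorem rootProd_dvd {s : Finset K} {p : K[X]} (h : ∀ a ∈ s, p.eval a = 0) :
    rootProd s.val ∣ p := by
  rcases eq_or_ne p 0 with rfl | hp
  · exact dvd_zero _
  · exact (Multiset.prod_X_sub_C_dvd_iff_le_roots hp s.val).2 <|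
      (Multiset.le_iff_subset s.nodup).2 fun a ha => (mem_roots hp).2 (h a ha)

end RootProducts

section PolynomialsAtInfinity

open Bornology

theorem eval_reflect_inv_mul_pow {K : Type*} [Field K] {p : K[X]} {n : ℕ} (hp : p.natDegree ≤ n)
    {z : K} (hz : z ≠ 0) : (reflect n p).eval z⁻¹ * z ^ n = p.eval z := by
  let _ := invertibleOfNonzero hz
  rw [← invOf_eq_inv]
  exact eval₂_reflect_mul_pow (RingHom.id K) z n p hp

theorem eval_zero_reflect {K : Type*} [CommSemiring K] (p : K[X]) (n : ℕ) :
    (reflect n p).eval 0 = p.coeff n := by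
  rw [← coeff_zero_eq_eval_zero, coeff_reflect, revAt_zero]

variable {𝕜 : Type*} [NontriviallyNormedField 𝕜]

theorem tendsto_eval_div_pow {p : 𝕜[X]} {n : ℕ} (hp : p.natDegree ≤ n) :
    Tendsto (fun z => p.eval z / z ^ n) (cobounded 𝕜) (𝓝 (p.coeff n)) := by
  have hlim : Tendsto (fun z : 𝕜 => (reflect n p).eval z⁻¹) (cobounded 𝕜) (𝓝 (p.coeff n)) := by
    rw [← eval_zero_reflect]
    exact ((reflect n p).continuous.tendsto 0).comp tendsto_inv₀_cobounded
  refine hlim.congr' ?_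
  filter_upwards [eventually_ne_cobounded (0 : 𝕜)] with z hz
  rw [← eval_reflect_inv_mul_pow hp hz, mul_div_cancel_right₀ _ (pow_ne_zero n hz)]

theorem tendsto_eval_div_rootProd {p : 𝕜[X]} {s : Multiset 𝕜} (hp : p.natDegree ≤ s.card) :
    Tendsto (fun z => p.eval z / (rootProd s).eval z) (cobounded 𝕜) (𝓝 (p.coeff s.card)) := by
  have hlim := (tendsto_eval_div_pow hp).div (tendsto_eval_div_pow (natDegree_rootProd s).le)
    (by rw [coeff_rootProd_card]; exact one_ne_zero)
  rw [coeff_rootProd_card, div_one] at hlim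
  refine hlim.congr' ?_
  filter_upwards [eventually_ne_cobounded (0 : 𝕜)] with z hz
  rw [Pi.div_apply, div_div_div_cancel_right₀ (pow_ne_zero _ hz)]

theorem analyticAt_eval (p : 𝕜[X]) (z : 𝕜) : AnalyticAt 𝕜 (fun y => p.eval y) z :=
  AnalyticOnNhd.eval_polynomial p z (Set.mem_univ z)

theorem exists_analyticAt_eq_eval_inv_div_rootProd {p : 𝕜[X]} {s : Multiset 𝕜}
    (hp : p.natDegree ≤ s.card) : ∃ g : 𝕜 → 𝕜, AnalyticAt 𝕜 g 0 ∧
      ∀ w ≠ 0, g w = p.eval w⁻¹ / (rootProd s).eval w⁻¹ := by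
  refine ⟨fun w => (reflect s.card p).eval w / (reflect s.card (rootProd s)).eval w,
    (analyticAt_eval _ 0).fun_div (analyticAt_eval _ 0) ?_, fun w hw => ?_⟩
  · rw [eval_zero_reflect, coeff_rootProd_card]
    exact one_ne_zero
  · rw [← eval_reflect_inv_mul_pow hp (inv_ne_zero hw),
      ← eval_reflect_inv_mul_pow (natDegree_rootProd s).le (inv_ne_zero hw), inv_inv,
      mul_div_mul_right _ _ (pow_ne_zero _ (inv_ne_zero hw))]

theorem eventually_cobounded_notMem (s : Multiset 𝕜) : ∀ᶠ z in cobounded 𝕜, z ∉ s := by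
  classical
  filter_upwards [isBounded_def.1 s.toFinset.finite_toSet.isBounded] with z hz
  rwa [Set.mem_compl_iff, Finset.mem_coe, Multiset.mem_toFinset] at hz

end PolynomialsAtInfinity

section MeromorphicFunctions

open Bornology

variable {ψ : ℂ → ℂ} {s : Multiset ℂ}

theorem meromorphicOrderAt_eval {𝕜 : Type*} [NontriviallyNormedField 𝕜] {p : 𝕜[X]} (hp : p ≠ 0)
    (z : 𝕜) : meromorphicOrderAt (fun y => p.eval y) z = (p.rootMultiplicity z : ℤ) := by
  rw [meromorphicOrderAt_eq_int_iff (analyticAt_eval p z).meromorphicAt]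
  obtain ⟨q, hq, hdvd⟩ := p.exists_eq_pow_rootMultiplicity_mul_and_not_dvd hp z
  refine ⟨fun y => q.eval y, analyticAt_eval q z, fun h0 => hdvd (dvd_iff_isRoot.2 h0),
    Eventually.of_forall fun y => ?_⟩
  conv_lhs => rw [hq]
  rw [eval_mul, eval_pow, eval_sub, eval_X, eval_C, smul_eq_mul, zpow_natCast]

theorem neg_count_le_meromorphicOrderAt_div {f : ℂ → ℂ} {z : ℂ} (hf : AnalyticAt ℂ f z) :
    ((-(s.count z : ℤ) : ℤ) : WithTop ℤ) ≤
      meromorphicOrderAt (fun y => f y / (rootProd s).eval y) z := by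
  have hinv : meromorphicOrderAt (fun y => ((rootProd s).eval y)⁻¹) z = (-(s.count z : ℤ) : ℤ) := by
    rw [← rootMultiplicity_rootProd, WithTop.LinearOrderedAddCommGroup.coe_neg,
      ← meromorphicOrderAt_eval (rootProd_monic s).ne_zero]
    exact meromorphicOrderAt_inv
  simp only [div_eq_mul_inv]
  rw [← hinv]
  refine (le_add_of_nonneg_left hf.meromorphicOrderAt_nonneg).trans_eq
    (meromorphicOrderAt_mul hf.meromorphicAt ?_).symm
  exact (analyticAt_eval (rootProd s) z).meromorphicAt.fun_inv

theorem exists_entire_eq_of_meromorphicOrderAt_nonneg {f : ℂ → ℂ} (hf : ∀ z, MeromorphicAt f z)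
    (h : ∀ z, 0 ≤ meromorphicOrderAt f z) :
    ∃ g : ℂ → ℂ, Differentiable ℂ g ∧ ∀ z, AnalyticAt ℂ f z → g z = f z := by
  have hm : MeromorphicOn f Set.univ := fun z _ => hf z
  refine ⟨toMeromorphicNFOn f Set.univ, fun z => ?_, fun z hz => ?_⟩
  · refine AnalyticAt.differentiableAt <| ((meromorphicNFOn_toMeromorphicNFOn f Set.univ)
      (Set.mem_univ z)).meromorphicOrderAt_nonneg_iff_analyticAt.1 ?_
    rw [meromorphicOrderAt_toMeromorphicNFOn hm (Set.mem_univ z)]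
    exact h z
  · rw [toMeromorphicNFOn_eq_toMeromorphicNFAt hm (Set.mem_univ z),
      toMeromorphicNFAt_eq_self.2 hz.meromorphicNFAt]

theorem exists_polynomial_eq_of_tendsto_div_pow {n : ℕ} {f : ℂ → ℂ} {c : ℂ}
    (hf : Differentiable ℂ f) (h : Tendsto (fun z => f z / z ^ n) (cobounded ℂ) (𝓝 c)) :
    ∃ p : ℂ[X], p.natDegree ≤ n ∧ ∀ z, f z = p.eval z := by
  induction n generalizing f with
  | zero =>
    simp only [pow_zero, div_one, Metric.cobounded_eq_cocompact] at h
    exact ⟨C c, (natDegree_C c).le, fun z => by rw [hf.apply_eq_of_tendsto_cocompact z h, eval_C]⟩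
  | succ n ih =>
    have hslope : Differentiable ℂ (dslope f 0) := differentiableOn_univ.1 <|
      (Complex.differentiableOn_dslope Filter.univ_mem).2 hf.differentiableOn
    have hconst : Tendsto (fun z => f 0 / z ^ (n + 1)) (cobounded ℂ) (𝓝 0) := by
      simpa only [zero_pow n.succ_ne_zero, mul_zero, inv_pow, ← div_eq_mul_inv] using
        ((tendsto_inv₀_cobounded (α := ℂ)).pow (n + 1)).const_mul (f 0)
    have hlim := h.sub hconst
    rw [sub_zero] at hlim
    obtain ⟨p, hp, hpe⟩ := ih hslope <| hlim.congr' <| by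
      filter_upwards [eventually_ne_cobounded (0 : ℂ)] with z hz
      rw [dslope_of_ne _ hz, slope_def_field, sub_zero, ← sub_div, div_div, pow_succ']
    refine ⟨C (f 0) + X * p, ?_, fun z => ?_⟩
    · compute_degree
      omega
    · rw [eval_add, eval_C, eval_mul, eval_X, ← hpe, ← smul_eq_mul]
      nth_rw 2 [← sub_zero z]
      rw [sub_smul_dslope, add_sub_cancel]

theorem exists_eq_eval_div_rootProd_mul_exp {c : ℂ} {g : ℂ → ℂ}
    (hmer : ∀ z, MeromorphicAt ψ z) (han : ∀ z ∉ s, AnalyticAt ℂ ψ z)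
    (hpoles : ∀ z, ((-(s.count z : ℤ) : ℤ) : WithTop ℤ) ≤ meromorphicOrderAt ψ z)
    (hg : ContinuousAt g 0) (hinf : ∀ᶠ w in 𝓝[≠] 0, g w = ψ w⁻¹ * Complex.exp (-(c * w⁻¹))) :
    ∃ p : ℂ[X], p.natDegree ≤ s.card ∧
      ∀ z ∉ s, ψ z = p.eval z / (rootProd s).eval z * Complex.exp (c * z) := by
  have hexp : ∀ z, AnalyticAt ℂ (fun y => Complex.exp (-(c * y))) z := fun z => by fun_prop
  have hfac : ∀ z, AnalyticAt ℂ (fun y => (rootProd s).eval y * Complex.exp (-(c * y))) z :=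
    fun z => (analyticAt_eval _ z).mul (hexp z)
  obtain ⟨f, hf, hfψ⟩ := exists_entire_eq_of_meromorphicOrderAt_nonneg
    (f := fun z => ψ z * ((rootProd s).eval z * Complex.exp (-(c * z))))
    (fun z => (hmer z).mul (hfac z).meromorphicAt) fun z => by
      rw [← Pi.mul_def ψ, meromorphicOrderAt_mul (hmer z) (hfac z).meromorphicAt]
      have hadd : ((-(s.count z : ℤ) : ℤ) : WithTop ℤ) +
          meromorphicOrderAt (fun y => (rootProd s).eval y * Complex.exp (-(c * y))) z = 0 := by
        rw [← Pi.mul_def, meromorphicOrderAt_mul (analyticAt_eval _ z).meromorphicAt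
          (hexp z).meromorphicAt, meromorphicOrderAt_eval (rootProd_monic s).ne_zero,
          rootMultiplicity_rootProd, (hexp z).meromorphicOrderAt_eq,
          (hexp z).analyticOrderAt_eq_zero.2 (Complex.exp_ne_zero _), ENat.map_zero, Nat.cast_zero,
          WithTop.coe_zero, add_zero, ← WithTop.coe_add, neg_add_cancel, WithTop.coe_zero]
      rw [← hadd]
      gcongr
      exact hpoles z
  have hf' : ∀ z ∉ s, f z = ψ z * ((rootProd s).eval z * Complex.exp (-(c * z))) := fun z hz =>
    hfψ z ((han z hz).mul (hfac z))
  have hlim : Tendsto (fun z => f z / z ^ s.card) (cobounded ℂ) (𝓝 (g 0 * 1)) := by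
    rw [← coeff_rootProd_card s]
    refine ((hg.tendsto.comp tendsto_inv₀_cobounded).mul
      (tendsto_eval_div_pow (natDegree_rootProd s).le)).congr' ?_
    filter_upwards [tendsto_inv₀_cobounded'.eventually hinf, eventually_cobounded_notMem s]
      with z hgz hz
    rw [Function.comp_apply, hgz, hf' z hz, inv_inv]
    ring
  obtain ⟨p, hp, hpf⟩ := exists_polynomial_eq_of_tendsto_div_pow hf hlim
  refine ⟨p, hp, fun z hz => ?_⟩
  rw [← hpf, hf' z hz, Complex.exp_neg]
  field_simp [eval_rootProd_ne_zero hz, Complex.exp_ne_zero]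

end MeromorphicFunctions

namespace SpectralData

open Bornology

variable {N l : ℕ} (S : SpectralData N l)

section WaveFunctions

/-- The monic polynomial on `Γ_i` whose zero divisor is the part of `D` on `Γ_i`. -/
noncomputable def polePoly (i : Fin N) : ℂ[X] := rootProd (S.D i)

/-- The value at the point `z` of `Γ_i` of the function that is `A_i / D_i · exp (uⁱ z_i)` on
`Γ_i`, as a linear function of the numerators `A`. -/
noncomputable def wave (u : Fin N → ℂ) (i : Fin N) (z : ℂ) : (Fin N → ℂ[X]) →ₗ[ℂ] ℂ :=
  (Complex.exp (u i * z) / (S.polePoly i).eval z) • leval z ∘ₗ LinearMap.proj i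

/-- The numerators `A` of the functions `A_i / D_i · exp (uⁱ z_i)` that descend to `Γ`. -/
noncomputable def gluedWaves (u : Fin N → ℂ) : Submodule ℂ (Fin N → ℂ[X]) :=
  ⨅ i, ⨅ j, ⨅ a ∈ S.glue i j, LinearMap.ker (S.wave u i a - S.wave u j a)

/-- The numerators of the functions on `Γ` that vanish at the normalization points. -/
noncomputable def nullWaves (u : Fin N → ℂ) : Submodule ℂ (Fin N → ℂ[X]) :=
  S.gluedWaves u ⊓ ⨅ k, LinearMap.ker (S.wave u (S.R k).1 (S.R k).2)

variable {S} {u : Fin N → ℂ} {A : Fin N → ℂ[X]}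

theorem wave_apply (i : Fin N) (z : ℂ) :
    S.wave u i z A = (A i).eval z / (S.polePoly i).eval z * Complex.exp (u i * z) := by
  rw [wave, LinearMap.smul_apply, LinearMap.comp_apply, LinearMap.proj_apply, leval_apply,
    smul_eq_mul]
  ring

theorem mem_gluedWaves :
    A ∈ S.gluedWaves u ↔ ∀ i j, ∀ a ∈ S.glue i j, S.wave u i a A = S.wave u j a A := by
  simp only [gluedWaves, Submodule.mem_iInf, LinearMap.mem_ker, LinearMap.sub_apply, sub_eq_zero]

theorem eval_polePoly_ne_zero {i : Fin N} {z : ℂ} (hz : z ∉ S.D i) : (S.polePoly i).eval z ≠ 0 :=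
  eval_rootProd_ne_zero hz

theorem wave_eq_zero_iff {i : Fin N} {z : ℂ} (hz : z ∉ S.D i) :
    S.wave u i z A = 0 ↔ (A i).eval z = 0 := by
  rw [wave_apply, mul_eq_zero_iff_right (Complex.exp_ne_zero _),
    div_eq_zero_iff, or_iff_left (eval_polePoly_ne_zero hz)]

theorem mem_nullWaves :
    A ∈ S.nullWaves u ↔ A ∈ S.gluedWaves u ∧ ∀ k, (A (S.R k).1).eval (S.R k).2 = 0 := by
  simp only [nullWaves, Submodule.mem_inf, Submodule.mem_iInf, LinearMap.mem_ker,
    wave_eq_zero_iff (S.D_not_R _).1]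

theorem isBakerAkhiezer_wave (hA : A ∈ S.gluedWaves u) (hdeg : ∀ i, (A i).natDegree ≤ (S.D i).card)
    (hnorm : ∀ k, S.wave u (S.R k).1 (S.R k).2 A = S.d k) :
    S.IsBakerAkhiezer u fun i z => S.wave u i z A where
  analytic i z hz := by
    simp only [wave_apply]
    exact ((analyticAt_eval _ z).fun_div (analyticAt_eval _ z) (eval_polePoly_ne_zero hz)).mul
      (by fun_prop)
  meromorphic i z := by
    simp only [wave_apply]
    refine ((analyticAt_eval _ z).meromorphicAt.fun_div
      (analyticAt_eval _ z).meromorphicAt).fun_mul (AnalyticAt.meromorphicAt ?_)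
    fun_prop
  poles i z := by
    simp only [wave_apply, div_mul_eq_mul_div]
    refine neg_count_le_meromorphicOrderAt_div ((analyticAt_eval _ z).fun_mul ?_)
    fun_prop
  infinity i := by
    obtain ⟨g, hg, hgA⟩ := exists_analyticAt_eq_eval_inv_div_rootProd (hdeg i)
    refine ⟨g, hg, ?_⟩
    filter_upwards [self_mem_nhdsWithin] with w hw
    rw [hgA w hw, wave_apply, mul_assoc, ← Complex.exp_add, add_neg_cancel, Complex.exp_zero,
      mul_one, polePoly]
  glue := mem_gluedWaves.1 hA
  norm := hnorm

theorem notMem_D_of_mem_glue {i j : Fin N} {a : ℂ} (ha : a ∈ S.glue i j) :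
    a ∉ S.D i ∧ a ∉ S.D j :=
  ⟨fun h => S.D_not_glue i j a h ha, fun h => S.D_not_glue j i a h (S.glue_symm i j ▸ ha)⟩

theorem IsBakerAkhiezer.exists_wave {ψ : Fin N → ℂ → ℂ} (hψ : S.IsBakerAkhiezer u ψ) :
    ∃ A ∈ S.gluedWaves u, (∀ i, (A i).natDegree ≤ (S.D i).card) ∧
      ∀ i, ∀ z ∉ S.D i, ψ i z = S.wave u i z A := by
  have hcomp : ∀ i, ∃ p : ℂ[X], p.natDegree ≤ (S.D i).card ∧
      ∀ z ∉ S.D i, ψ i z = p.eval z / (rootProd (S.D i)).eval z * Complex.exp (u i * z) := by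
    intro i
    obtain ⟨g, hg, hinf⟩ := hψ.infinity i
    exact exists_eq_eval_div_rootProd_mul_exp (hψ.meromorphic i) (hψ.analytic i) (hψ.poles i)
      hg.continuousAt hinf
  choose A hdeg hA using hcomp
  have hψA : ∀ i, ∀ z ∉ S.D i, ψ i z = S.wave u i z A := fun i z hz => by
    rw [hA i z hz, wave_apply, polePoly]
  refine ⟨A, mem_gluedWaves.2 fun i j a ha => ?_, hdeg, hψA⟩
  obtain ⟨hi, hj⟩ := notMem_D_of_mem_glue ha
  rw [← hψA i a hi, ← hψA j a hj, hψ.glue i j a ha]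

theorem coeff_card_eq_of_tendsto {ψ : ℂ → ℂ} {i : Fin N} {h : ℂ}
    (hdeg : (A i).natDegree ≤ (S.D i).card) (hψ : ∀ z ∉ S.D i, ψ z = S.wave u i z A)
    (hh : Tendsto (fun z => ψ z * Complex.exp (-(u i * z))) (cobounded ℂ) (𝓝 h)) :
    (A i).coeff (S.D i).card = h := by
  refine tendsto_nhds_unique ((tendsto_eval_div_rootProd hdeg).congr' ?_) hh
  filter_upwards [eventually_cobounded_notMem (S.D i)] with z hz
  rw [hψ z hz, wave_apply, mul_assoc, ← Complex.exp_add, add_neg_cancel, Complex.exp_zero, mul_one,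
    polePoly]

theorem eq_zero_of_forall_wave_eq_zero (h : ∀ i, ∀ z ∉ S.D i, S.wave u i z A = 0) : A = 0 := by
  funext i
  have hfin : {z | z ∈ S.D i}.Finite := by
    classical
    exact (S.D i).toFinset.finite_toSet.subset fun z => Multiset.mem_toFinset.2
  refine eq_zero_of_infinite_isRoot _ (hfin.infinite_compl.mono fun z hz => ?_)
  exact (wave_eq_zero_iff hz).1 (h i z hz)

theorem IsUniqueBakerAkhiezer.eq_zero {ψ : Fin N → ℂ → ℂ} (hψ : S.IsUniqueBakerAkhiezer u ψ)
    (hA : A ∈ S.nullWaves u) (hdeg : ∀ i, (A i).natDegree ≤ (S.D i).card) : A = 0 := by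
  obtain ⟨B, hB, hBdeg, hψB⟩ := hψ.1.exists_wave
  obtain ⟨hglue, hR⟩ := mem_nullWaves.1 hA
  have hsum : S.IsBakerAkhiezer u fun i z => S.wave u i z (B + A) := by
    refine isBakerAkhiezer_wave (add_mem hB hglue)
      (fun i => natDegree_add_le_of_degree_le (hBdeg i) (hdeg i)) fun k => ?_
    rw [map_add, (wave_eq_zero_iff (S.D_not_R k).1).2 (hR k), add_zero, ← hψB _ _ (S.D_not_R k).1,
      hψ.1.norm]
  refine eq_zero_of_forall_wave_eq_zero (S := S) (u := u) fun i z hz => ?_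
  have heq := hψ.2 _ hsum i z hz
  rwa [map_add, hψB i z hz, add_eq_left] at heq

end WaveFunctions

end SpectralData

section Residues

theorem coeff_rootProd_mul {K : Type*} [CommRing K] [Nontrivial K] {s : Multiset K} {p : K[X]}
    {n : ℕ} (hp : p.natDegree ≤ n) : (rootProd s * p).coeff (s.card + n) = p.coeff n := by
  rw [coeff_mul_add_eq_of_natDegree_le (natDegree_rootProd s).le hp, coeff_rootProd_card, one_mul]

theorem natDegree_le_of_natDegree_rootProd_mul_le {K : Type*} [CommRing K] [Nontrivial K]
    {s : Multiset K} {p : K[X]} {n : ℕ} (h : (rootProd s * p).natDegree ≤ s.card + n) :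
    p.natDegree ≤ n := by
  rcases eq_or_ne p 0 with rfl | hp
  · exact natDegree_zero.trans_le n.zero_le
  · rw [(rootProd_monic s).natDegree_mul' hp, natDegree_rootProd] at h
    exact Nat.le_of_add_le_add_left h

/-- The multiset `s + σs` for the involution `σ(z) = -z`. -/
def symmetrize (s : Multiset ℂ) : Multiset ℂ := s + s.map Neg.neg

theorem count_symmetrize (s : Multiset ℂ) (a : ℂ) :
    (symmetrize s).count a = s.count a + s.count (-a) := by
  rw [symmetrize, Multiset.count_add]
  congr 1
  conv_lhs => rw [← neg_neg a]
  exact Multiset.count_map_eq_count' _ _ neg_injective _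

theorem card_symmetrize (s : Multiset ℂ) : (symmetrize s).card = s.card + s.card := by
  rw [symmetrize, Multiset.card_add, Multiset.card_map]

theorem rootProd_symmetrize (s : Multiset ℂ) :
    rootProd (symmetrize s) = (-1) ^ s.card * (rootProd s * (rootProd s).comp (-X)) := by
  rw [symmetrize, rootProd_add, rootProd_comp_neg_X, mul_left_comm, ← mul_assoc ((-1) ^ s.card),
    ← mul_pow, neg_one_mul, neg_neg, one_pow, one_mul]

theorem eval_rootProd_symmetrize (s : Multiset ℂ) (a : ℂ) :
    (rootProd (symmetrize s)).eval a =
      (-1) ^ s.card * ((rootProd s).eval a * (rootProd s).eval (-a)) := by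
  rw [rootProd_symmetrize, eval_mul, eval_mul, eval_comp, eval_neg, eval_X, eval_pow, eval_neg,
    eval_one]

theorem rootProd_symmetrize_dvd_mul_comp_neg_X {s : Multiset ℂ} {p q : ℂ[X]}
    (hp : rootProd s ∣ p) (hq : rootProd s ∣ q) :
    rootProd (symmetrize s) ∣ p * q.comp (-X) := by
  obtain ⟨r, rfl⟩ := hq
  rw [rootProd_symmetrize, ((isUnit_one.neg).pow s.card).mul_left_dvd, mul_comp]
  exact mul_dvd_mul hp (Dvd.intro _ rfl)

theorem natDegree_comp_neg_X_le {K : Type*} [CommRing K] {p : K[X]} {n : ℕ}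
    (hp : p.natDegree ≤ n) : (p.comp (-X)).natDegree ≤ n := by
  refine natDegree_comp_le.trans ?_
  rw [natDegree_neg]
  exact (Nat.mul_le_mul hp natDegree_X_le).trans (mul_one n).le

theorem coeff_comp_neg_X {K : Type*} [CommRing K] (p : K[X]) (n : ℕ) :
    (p.comp (-X)).coeff n = p.coeff n * (-1) ^ n := by
  rw [← neg_one_mul (X : K[X]), ← C_1, ← C_neg, comp_C_mul_X_coeff]

theorem eval_derivative_rootProd {K : Type*} [Field K] [DecidableEq K] {s : Finset K} {a : K}
    (ha : a ∈ s) :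
    (rootProd s.val).derivative.eval a = ∏ b ∈ s.erase a, (a - b) :=
  (Lagrange.eval_nodal_derivative_eval_node_eq (v := id) ha).trans Lagrange.eval_nodal

theorem eval_derivative_rootProd_ne_zero {K : Type*} [Field K] {s : Finset K} {a : K}
    (ha : a ∈ s) : (rootProd s.val).derivative.eval a ≠ 0 := by
  classical
  rw [eval_derivative_rootProd ha]
  exact Finset.prod_ne_zero_iff.2 fun b hb => sub_ne_zero.2 (Finset.ne_of_mem_erase hb).symm

theorem sum_eval_div_derivative_rootProd {K : Type*} [Field K] {p : K[X]} {s : Finset K}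
    (hp : p.degree < s.card) :
    ∑ a ∈ s, p.eval a / (rootProd s.val).derivative.eval a = p.coeff (s.card - 1) := by
  classical
  rw [Lagrange.coeff_eq_sum (v := id) Function.injective_id.injOn hp]
  exact Finset.sum_congr rfl fun a ha => by rw [eval_derivative_rootProd ha]; rfl

theorem simpleResidue_eq_div {r : RatFunc ℂ} {p q : ℂ[X]} {a : ℂ} (h : r.num * q = p * r.denom)
    (hq : q.eval a = 0) (hq' : q.derivative.eval a ≠ 0) :
    simpleResidue r a = p.eval a / q.derivative.eval a := by
  rw [simpleResidue]
  split_ifs with hden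
  · have hder : r.num.eval a * q.derivative.eval a = p.eval a * r.denom.derivative.eval a := by
      simpa only [derivative_mul, eval_add, eval_mul, hq, hden, mul_zero, zero_add] using
        congrArg (fun f => eval a (derivative f)) h
    have hnum : r.num.eval a ≠ 0 := fun h0 => by
      obtain ⟨f, g, hfg⟩ := r.isCoprime_num_denom
      simpa only [eval_add, eval_mul, h0, hden, mul_zero, add_zero, eval_one, zero_ne_one] using
        congrArg (eval a) hfg
    have hden' : r.denom.derivative.eval a ≠ 0 := fun h0 =>
      mul_ne_zero hnum hq' (by rw [hder, h0, mul_zero])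
    exact (div_eq_div_iff hden' hq').2 hder
  · have hp : p.eval a * r.denom.eval a = 0 := by
      simpa only [eval_mul, hq, mul_zero] using (congrArg (eval a) h).symm
    rw [(mul_eq_zero_iff_right hden).1 hp, zero_div]

end Residues

namespace SpectralData

section Differential

variable {N l : ℕ} {S : SpectralData N l} {i : Fin N} {a : ℂ}

variable (S i) in
/-- The coordinates of the double points of `Γ_i` and of the point `Q_i`: the poles of the
differential `ψ(u, z) ψ(u, -z) Ω` on `Γ_i`. -/
noncomputable def nodes : Finset ℂ := insert 0 (Finset.univ.biUnion fun j => S.glue i j)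

variable (S i) in
/-- The coordinates of the normalization points on `Γ_i`. -/
noncomputable def normPts : Finset ℂ :=
  (Finset.univ.filter fun k => (S.R k).1 = i).image fun k => (S.R k).2

theorem mem_nodes : a ∈ S.nodes i ↔ a = 0 ∨ ∃ j, a ∈ S.glue i j := by
  simp only [nodes, Finset.mem_insert, Finset.mem_biUnion, Finset.mem_univ, true_and]

theorem zero_mem_nodes : (0 : ℂ) ∈ S.nodes i := mem_nodes.2 (Or.inl rfl)

theorem mem_normPts : a ∈ S.normPts i ↔ ∃ k, S.R k = (i, a) := by
  simp only [normPts, Finset.mem_image, Finset.mem_filter, Finset.mem_univ, true_and, Prod.ext_iff]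

theorem neg_mem_nodes (ha : a ∈ S.nodes i) : -a ∈ S.nodes i := by
  rw [mem_nodes] at ha ⊢
  exact ha.imp neg_eq_zero.2 fun ⟨j, hj⟩ => ⟨j, S.glue_neg i j a hj⟩

theorem notMem_D_of_mem_nodes (ha : a ∈ S.nodes i) : a ∉ S.D i := fun h => by
  obtain rfl | ⟨j, hj⟩ := mem_nodes.1 ha
  · exact S.D_ne_zero i 0 h rfl
  · exact S.D_not_glue i j a h hj

theorem notMem_normPts_of_mem_nodes (ha : a ∈ S.nodes i) : a ∉ S.normPts i := fun h => by
  obtain ⟨k, hk⟩ := mem_normPts.1 h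
  obtain rfl | ⟨j, hj⟩ := mem_nodes.1 ha
  · exact S.R_ne_zero k (by rw [hk])
  · exact S.R_not_glue k j (by rw [hk]; exact hj)

theorem sum_nodes {M : Type*} [AddCommMonoid M] (f : ℂ → M) :
    ∑ a ∈ S.nodes i, f a = f 0 + ∑ j, ∑ a ∈ S.glue i j, f a := by
  rw [nodes, Finset.sum_insert, Finset.sum_biUnion]
  · exact fun j _ k _ hjk => S.glue_double i j k hjk
  · simp only [Finset.mem_biUnion, Finset.mem_univ, true_and, not_exists]
    exact fun j hj => S.glue_ne_zero i j 0 hj rfl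

theorem roots_num_add :
    (S.Ω i).num.roots + (symmetrize (S.normPts i).val + (S.nodes i).val) =
      symmetrize (S.D i) + (S.Ω i).denom.roots := by
  ext a
  have hR : ∀ b, (S.normPts i).val.count b = if ∃ k, S.R k = (i, b) then 1 else 0 := fun b => by
    rw [Multiset.count_eq_of_nodup (S.normPts i).nodup]
    simp only [Finset.mem_val, mem_normPts]
  have hnodes : (S.nodes i).val.count a =
      (if a = 0 then 1 else 0) + (if ∃ j, a ∈ S.glue i j then 1 else 0) := by
    rw [Multiset.count_eq_of_nodup (S.nodes i).nodup]
    simp only [Finset.mem_val, mem_nodes]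
    by_cases h0 : a = 0
    · have h1 : ¬ ∃ j, a ∈ S.glue i j := fun ⟨j, hj⟩ => S.glue_ne_zero i j a hj h0
      simp only [h0, h0 ▸ h1, true_or, if_true, if_false, add_zero]
    · simp only [h0, false_or, if_false, zero_add]
  have hord := S.Ω_ord i a
  simp only [diffOrd] at hord
  simp only [Multiset.count_add, count_symmetrize, count_roots, hR, hnodes]
  zify
  linarith

theorem two_mul_card_normPts :
    2 * (S.normPts i).card + (S.nodes i).card = 2 * (S.D i).card + 3 := by
  have hcard := congrArg Multiset.card (S.roots_num_add (i := i))
  have hroots : ∀ p : ℂ[X], p.roots.card = p.natDegree := fun p =>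
    splits_iff_card_roots.1 (IsAlgClosed.splits p)
  simp only [Multiset.card_add, card_symmetrize, hroots, Finset.card_val] at hcard
  have hord := S.Ω_ord_infty i
  simp only [diffOrdInfty, RatFunc.intDegree] at hord
  omega

theorem epsSq_eq_neg_leadingCoeff : S.epsSq i = -(S.Ω i).num.leadingCoeff := by
  rw [epsSq, inftyCoeff, (S.Ω i).monic_denom.leadingCoeff, div_one]

theorem epsSq_ne_zero (i : Fin N) : S.epsSq i ≠ 0 := by
  rw [epsSq_eq_neg_leadingCoeff, neg_ne_zero, leadingCoeff_ne_zero, Ne, RatFunc.num_eq_zero_iff]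
  intro h0
  have hord := S.Ω_ord_infty i
  rw [h0, diffOrdInfty, RatFunc.intDegree_zero] at hord
  omega

theorem num_mul_rootProd :
    (S.Ω i).num * (rootProd (symmetrize (S.normPts i).val) * rootProd (S.nodes i).val) =
      C (-S.epsSq i) * rootProd (symmetrize (S.D i)) * (S.Ω i).denom := by
  have hfactor : ∀ p : ℂ[X], p = C p.leadingCoeff * rootProd p.roots := fun p =>
    (C_leadingCoeff_mul_prod_multiset_X_sub_C
      (splits_iff_card_roots.1 (IsAlgClosed.splits p))).symm
  rw [epsSq_eq_neg_leadingCoeff, neg_neg]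
  conv_lhs => rw [hfactor (S.Ω i).num]
  conv_rhs => rw [hfactor (S.Ω i).denom, (S.Ω i).monic_denom.leadingCoeff, C_1, one_mul]
  rw [mul_assoc, mul_assoc, ← rootProd_add, ← rootProd_add, ← rootProd_add, roots_num_add]

theorem eval_rootProd_symmetrize_ne_zero {s : Multiset ℂ} (hs : ∀ a ∈ S.nodes i, a ∉ s)
    (ha : a ∈ S.nodes i) : (rootProd (symmetrize s)).eval a ≠ 0 := by
  rw [eval_rootProd_symmetrize]
  exact mul_ne_zero (pow_ne_zero _ (neg_ne_zero.2 one_ne_zero)) <|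
    mul_ne_zero (eval_rootProd_ne_zero (hs a ha)) (eval_rootProd_ne_zero (hs _ (neg_mem_nodes ha)))

theorem simpleResidue_eq (ha : a ∈ S.nodes i) :
    simpleResidue (S.Ω i) a = -S.epsSq i * (rootProd (symmetrize (S.D i))).eval a /
      ((rootProd (symmetrize (S.normPts i).val)).eval a *
        (rootProd (S.nodes i).val).derivative.eval a) := by
  have hnode : (rootProd (S.nodes i).val).eval a = 0 := eval_rootProd_eq_zero_iff.2 ha
  have hder : (rootProd (symmetrize (S.normPts i).val) *
      rootProd (S.nodes i).val).derivative.eval a =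
        (rootProd (symmetrize (S.normPts i).val)).eval a *
          (rootProd (S.nodes i).val).derivative.eval a := by
    rw [derivative_mul, eval_add, eval_mul, eval_mul, hnode, mul_zero, zero_add]
  rw [simpleResidue_eq_div num_mul_rootProd (by rw [eval_mul, hnode, mul_zero]), hder, eval_mul,
    eval_C]
  rw [hder]
  exact mul_ne_zero (eval_rootProd_symmetrize_ne_zero (fun _ => notMem_normPts_of_mem_nodes) ha)
    (eval_derivative_rootProd_ne_zero ha)

theorem eta_det_ne_zero : S.eta.det ≠ 0 := by
  rw [eta, Matrix.det_diagonal]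
  refine Finset.prod_ne_zero_iff.2 fun i _ => ?_
  rw [simpleResidue_eq zero_mem_nodes]
  exact div_ne_zero (mul_ne_zero (neg_ne_zero.2 (S.epsSq_ne_zero i)) <|
      eval_rootProd_symmetrize_ne_zero (fun _ => notMem_D_of_mem_nodes) zero_mem_nodes)
    (mul_ne_zero (eval_rootProd_symmetrize_ne_zero (fun _ => notMem_normPts_of_mem_nodes)
      zero_mem_nodes) (eval_derivative_rootProd_ne_zero zero_mem_nodes))

end Differential

section ResidueTheorem

variable {N l : ℕ} {S : SpectralData N l} {i : Fin N} {u : Fin N → ℂ}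

theorem simpleResidue_mul_eq_of_mul_comp_neg_X_eq {A B p : ℂ[X]} {a : ℂ}
    (h : A * B.comp (-X) = rootProd (symmetrize (S.normPts i).val) * p) (ha : a ∈ S.nodes i) :
    simpleResidue (S.Ω i) a *
        (A.eval a / (S.polePoly i).eval a * (B.eval (-a) / (S.polePoly i).eval (-a))) =
      (-1) ^ ((S.D i).card + 1) * S.epsSq i *
        (p.eval a / (rootProd (S.nodes i).val).derivative.eval a) := by
  have hAB := congrArg (eval a) h
  rw [eval_mul, eval_mul, eval_comp, eval_neg, eval_X] at hAB
  have hR := eval_rootProd_symmetrize_ne_zero (S := S) (s := (S.normPts i).val)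
    (fun _ => notMem_normPts_of_mem_nodes) ha
  have hP := eval_polePoly_ne_zero (notMem_D_of_mem_nodes ha)
  have hPneg := eval_polePoly_ne_zero (notMem_D_of_mem_nodes (neg_mem_nodes ha))
  have hG := eval_derivative_rootProd_ne_zero ha
  rw [div_mul_div_comm, hAB, simpleResidue_eq ha, eval_rootProd_symmetrize (S.D i), ← polePoly]
  field_simp
  ring

theorem sum_nodes_simpleResidue_mul {A B : ℂ[X]} (hA : ∀ a ∈ S.normPts i, A.eval a = 0)
    (hB : ∀ a ∈ S.normPts i, B.eval a = 0) (hAdeg : A.natDegree ≤ (S.D i).card + 1)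
    (hBdeg : B.natDegree ≤ (S.D i).card + 1) :
    ∑ a ∈ S.nodes i, simpleResidue (S.Ω i) a *
        (A.eval a / (S.polePoly i).eval a * (B.eval (-a) / (S.polePoly i).eval (-a))) =
      S.epsSq i * (A.coeff ((S.D i).card + 1) * B.coeff ((S.D i).card + 1)) := by
  obtain ⟨p, hp⟩ :=
    rootProd_symmetrize_dvd_mul_comp_neg_X (rootProd_dvd hA) (rootProd_dvd hB)
  have hcard : (symmetrize (S.normPts i).val).card + ((S.nodes i).card - 1) =
      (S.D i).card + 1 + ((S.D i).card + 1) := by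
    have := S.two_mul_card_normPts (i := i)
    rw [card_symmetrize, Finset.card_val]
    have := Finset.card_pos.2 ⟨0, S.zero_mem_nodes (i := i)⟩
    omega
  have hdeg : p.natDegree ≤ (S.nodes i).card - 1 := by
    refine natDegree_le_of_natDegree_rootProd_mul_le (s := symmetrize (S.normPts i).val) ?_
    rw [← hp, hcard]
    exact natDegree_mul_le_of_le hAdeg (natDegree_comp_neg_X_le hBdeg)
  have hcoeff : p.coeff ((S.nodes i).card - 1) = (-1) ^ ((S.D i).card + 1) *
      (A.coeff ((S.D i).card + 1) * B.coeff ((S.D i).card + 1)) := by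
    have htop := coeff_mul_add_eq_of_natDegree_le hAdeg (natDegree_comp_neg_X_le hBdeg)
    rw [hp, ← hcard, coeff_rootProd_mul hdeg, coeff_comp_neg_X] at htop
    rw [htop]
    ring
  have hlt : p.degree < (S.nodes i).card :=
    degree_le_natDegree.trans_lt <| Nat.cast_lt.2 <| hdeg.trans_lt <|
      Nat.sub_one_lt (Finset.card_ne_zero_of_mem zero_mem_nodes)
  rw [Finset.sum_congr rfl fun a ha => simpleResidue_mul_eq_of_mul_comp_neg_X_eq hp ha,
    ← Finset.mul_sum, sum_eval_div_derivative_rootProd hlt, hcoeff, mul_right_comm, ← mul_assoc,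
    ← mul_pow, neg_one_mul, neg_neg, one_pow, one_mul, mul_comm]

theorem sum_sum_sum_glue_eq_zero {f : Fin N → ℂ → ℂ}
    (hf : ∀ i j, ∀ a ∈ S.glue i j, f i a = -f j a) : ∑ i, ∑ j, ∑ a ∈ S.glue i j, f i a = 0 := by
  refine self_eq_neg.1 ?_
  conv_rhs => rw [Finset.sum_comm]
  simp only [← Finset.sum_neg_distrib]
  refine Finset.sum_congr rfl fun i _ => Finset.sum_congr rfl fun j _ => ?_
  rw [S.glue_symm j i]
  exact Finset.sum_congr rfl (hf i j)

theorem eval_eq_zero_of_mem_nullWaves {A : Fin N → ℂ[X]} (hA : A ∈ S.nullWaves u) :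
    ∀ a ∈ S.normPts i, (A i).eval a = 0 := fun a ha => by
  obtain ⟨k, hk⟩ := mem_normPts.1 ha
  simpa only [hk] using (mem_nullWaves.1 hA).2 k

theorem sum_eta_mul_wave_mul_wave {A B : Fin N → ℂ[X]} (hA : A ∈ S.nullWaves u)
    (hB : B ∈ S.nullWaves u) (hAdeg : ∀ i, (A i).natDegree ≤ (S.D i).card + 1)
    (hBdeg : ∀ i, (B i).natDegree ≤ (S.D i).card + 1) :
    ∑ i, S.eta i i * (S.wave u i 0 A * S.wave u i 0 B) =
      ∑ i, S.epsSq i * ((A i).coeff ((S.D i).card + 1) * (B i).coeff ((S.D i).card + 1)) := by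
  have hglue := fun {C} (hC : C ∈ S.nullWaves u) => mem_gluedWaves.1 (mem_nullWaves.1 hC).1
  -- Evaluating `B` at `-a` cancels the exponentials, so the products are rational functions.
  let res i a := simpleResidue (S.Ω i) a * (S.wave u i a A * S.wave u i (-a) B)
  have hres : ∀ i a, res i a = simpleResidue (S.Ω i) a *
      ((A i).eval a / (S.polePoly i).eval a * ((B i).eval (-a) / (S.polePoly i).eval (-a))) :=
    fun i a => by
      have hexp : Complex.exp (u i * a) * Complex.exp (u i * -a) = 1 := by
        rw [← Complex.exp_add, mul_neg, add_neg_cancel, Complex.exp_zero]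
      simp only [res, wave_apply]
      rw [mul_mul_mul_comm, hexp, mul_one]
  have hanti : ∀ i j, ∀ a ∈ S.glue i j, res i a = -res j a := fun i j a ha => by
    simp only [res]
    rw [hglue hA i j a ha, hglue hB i j (-a) (S.glue_neg i j a ha),
      eq_neg_of_add_eq_zero_left (S.Ω_regular i j a ha), neg_mul]
  calc ∑ i, S.eta i i * (S.wave u i 0 A * S.wave u i 0 B)
      = ∑ i, (res i 0 + ∑ j, ∑ a ∈ S.glue i j, res i a) := by
        rw [Finset.sum_add_distrib, sum_sum_sum_glue_eq_zero hanti, add_zero]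
        simp only [res, neg_zero, eta, Matrix.diagonal_apply_eq]
    _ = _ := Finset.sum_congr rfl fun i _ => by
        rw [← sum_nodes, ← sum_nodes_simpleResidue_mul (eval_eq_zero_of_mem_nullWaves hA)
          (eval_eq_zero_of_mem_nullWaves hB) (hAdeg i) (hBdeg i)]
        exact Finset.sum_congr rfl fun a _ => hres i a

end ResidueTheorem

end SpectralData

section SmoothFamilies

variable {N : ℕ} {U : Set (Fin N → ℂ)} {d : Fin N → ℕ} {A : (Fin N → ℂ) → Fin N → ℂ[X]}
  {u : Fin N → ℂ} {j m : Fin N}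

/-- Over the open set `U`, `A` is a smooth family of vectors of polynomials of degrees at
most `d`. -/
structure IsSmoothFamily (U : Set (Fin N → ℂ)) (d : Fin N → ℕ)
    (A : (Fin N → ℂ) → Fin N → ℂ[X]) : Prop where
  isOpen : IsOpen U
  natDegree_le : ∀ u ∈ U, ∀ m, (A u m).natDegree ≤ d m
  contDiffOn_coeff : ∀ m t, ContDiffOn ℂ ∞ (fun u => (A u m).coeff t) U

/-- The coefficientwise derivative `∂A/∂uʲ` of a family of vectors of polynomials of degrees at
most `d`. -/
noncomputable def coeffDeriv (d : Fin N → ℕ) (j : Fin N) (A : (Fin N → ℂ) → Fin N → ℂ[X])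
    (u : Fin N → ℂ) (m : Fin N) : ℂ[X] :=
  ∑ t ∈ Finset.range (d m + 1), monomial t (pd j (fun y => (A y m).coeff t) u)

/-- The numerators of the derivatives with respect to `uʲ` of the functions with numerators `A`,
that is, the polynomials `exp (-uᵐ z) ∂/∂uʲ (A_m exp (uᵐ z))`. -/
noncomputable def waveDeriv (d : Fin N → ℕ) (j : Fin N) (A : (Fin N → ℂ) → Fin N → ℂ[X])
    (u : Fin N → ℂ) (m : Fin N) : ℂ[X] :=
  coeffDeriv d j A u m + (if m = j then X else 0) * A u m

theorem natDegree_coeffDeriv_le : (coeffDeriv d j A u m).natDegree ≤ d m :=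
  natDegree_sum_le_of_forall_le _ _ fun _ ht =>
    (natDegree_monomial_le _).trans (Nat.lt_succ_iff.1 (Finset.mem_range.1 ht))

namespace IsSmoothFamily

theorem differentiableAt_coeff (hA : IsSmoothFamily U d A) (hu : u ∈ U) (m : Fin N) (t : ℕ) :
    DifferentiableAt ℂ (fun y => (A y m).coeff t) u :=
  differentiableAt_of_contDiffOn hA.isOpen (hA.contDiffOn_coeff m t) hu

theorem coeff_coeffDeriv (hA : IsSmoothFamily U d A) (hu : u ∈ U) (j m : Fin N) (t : ℕ) :
    (coeffDeriv d j A u m).coeff t = pd j (fun y => (A y m).coeff t) u := by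
  simp only [coeffDeriv, finsetSum_coeff, coeff_monomial, Finset.sum_ite_eq', Finset.mem_range]
  refine ite_eq_left_iff.2 fun ht => ?_
  rw [pd_congr_of_isOpen hA.isOpen hu j (g := fun _ => 0) fun y hy =>
    coeff_eq_zero_of_natDegree_lt ((hA.natDegree_le y hy m).trans_lt (by omega)), pd_const]

theorem natDegree_waveDeriv_le (hA : IsSmoothFamily U d A) (hu : u ∈ U) (j m : Fin N) :
    (waveDeriv d j A u m).natDegree ≤ (d + Pi.single j 1 : Fin N → ℕ) m := by
  refine natDegree_add_le_of_degree_le (natDegree_coeffDeriv_le.trans (Nat.le_add_right _ _)) ?_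
  rw [Pi.add_apply, Pi.single_apply, add_comm]
  refine natDegree_mul_le_of_le ?_ (hA.natDegree_le u hu m)
  split_ifs
  · exact natDegree_X_le
  · exact natDegree_zero.le

theorem waveDeriv (hA : IsSmoothFamily U d A) (j : Fin N) :
    IsSmoothFamily U (d + Pi.single j 1) (waveDeriv d j A) where
  isOpen := hA.isOpen
  natDegree_le _ hu := hA.natDegree_waveDeriv_le hu j
  contDiffOn_coeff m t := by
    simp only [FiniteGap.waveDeriv, coeff_add]
    refine ((contDiffOn_pd hA.isOpen (hA.contDiffOn_coeff m t) j).congr fun u hu =>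
      hA.coeff_coeffDeriv hu j m t).add ?_
    split_ifs
    · cases t with
      | zero => simpa only [mul_coeff_zero, coeff_X_zero, zero_mul] using contDiffOn_const
      | succ t => simpa only [coeff_X_mul] using hA.contDiffOn_coeff m t
    · simpa only [zero_mul, coeff_zero] using contDiffOn_const

theorem eval_eq_sum (hA : IsSmoothFamily U d A) (hu : u ∈ U) (m : Fin N) (z : ℂ) :
    (A u m).eval z = ∑ t ∈ Finset.range (d m + 1), (A u m).coeff t * z ^ t :=
  eval_eq_sum_range' (Nat.lt_succ_of_le (hA.natDegree_le u hu m)) z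

theorem contDiffOn_eval (hA : IsSmoothFamily U d A) (m : Fin N) (z : ℂ) :
    ContDiffOn ℂ ∞ (fun y => (A y m).eval z) U :=
  (ContDiffOn.sum fun t _ => (hA.contDiffOn_coeff m t).mul contDiffOn_const).congr
    fun _ hu => hA.eval_eq_sum hu m z

theorem pd_eval (hA : IsSmoothFamily U d A) (hu : u ∈ U) (j m : Fin N) (z : ℂ) :
    pd j (fun y => (A y m).eval z) u = (coeffDeriv d j A u m).eval z := by
  have hd := hA.differentiableAt_coeff hu m
  rw [pd_congr_of_isOpen hA.isOpen hu j fun y hy => hA.eval_eq_sum hy m z,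
    pd_sum _ _ fun t _ => (hd t).mul_const _, coeffDeriv, eval_finsetSum]
  refine Finset.sum_congr rfl fun t _ => ?_
  rw [eval_monomial, pd_mul j (hd t) (differentiableAt_const _), pd_const, mul_zero, add_zero]

end IsSmoothFamily

end SmoothFamilies

namespace SpectralData

section Derivatives

variable {N l : ℕ} {S : SpectralData N l} {U : Set (Fin N → ℂ)} {d : Fin N → ℕ}
  {A : (Fin N → ℂ) → Fin N → ℂ[X]} {u : Fin N → ℂ}

theorem wave_eq_inv_mul (u : Fin N → ℂ) (m : Fin N) (z : ℂ) (B : Fin N → ℂ[X]) :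
    S.wave u m z B = ((S.polePoly m).eval z)⁻¹ * ((B m).eval z * Complex.exp (u m * z)) := by
  rw [wave_apply]
  ring

theorem contDiffOn_wave (hA : IsSmoothFamily U d A) (m : Fin N) (z : ℂ) :
    ContDiffOn ℂ ∞ (fun y => S.wave y m z (A y)) U := by
  simp only [wave_eq_inv_mul]
  exact contDiffOn_const.mul ((hA.contDiffOn_eval m z).mul (by fun_prop))

theorem pd_exp_mul (j m : Fin N) (z : ℂ) :
    pd j (fun y : Fin N → ℂ => Complex.exp (y m * z)) u =
      (if m = j then z else 0) * Complex.exp (u m * z) := by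
  have hexp : HasFDerivAt (fun y : Fin N → ℂ => Complex.exp (y m * z)) _ u :=
    ((hasFDerivAt_apply (𝕜 := ℂ) m u).mul_const z).cexp
  rw [pd, hexp.fderiv]
  simp [Pi.single_apply, mul_comm]

theorem pd_wave (hA : IsSmoothFamily U d A) (hu : u ∈ U) (j m : Fin N) (z : ℂ) :
    pd j (fun y => S.wave y m z (A y)) u = S.wave u m z (waveDeriv d j A u) := by
  have heval : DifferentiableAt ℂ (fun y => (A y m).eval z) u :=
    differentiableAt_of_contDiffOn hA.isOpen (hA.contDiffOn_eval m z) hu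
  have hexp : DifferentiableAt ℂ (fun y : Fin N → ℂ => Complex.exp (y m * z)) u := by fun_prop
  simp only [wave_eq_inv_mul]
  rw [pd_const_mul j _ (heval.fun_mul hexp), pd_mul j heval hexp, hA.pd_eval hu, pd_exp_mul,
    waveDeriv, eval_add, eval_mul, apply_ite (eval z), eval_X, eval_zero]
  ring

theorem waveDeriv_mem_gluedWaves (hA : IsSmoothFamily U d A) (hglue : ∀ y ∈ U, A y ∈ S.gluedWaves y)
    (hu : u ∈ U) (j : Fin N) : waveDeriv d j A u ∈ S.gluedWaves u := by
  refine mem_gluedWaves.2 fun m m' a ha => ?_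
  rw [← pd_wave hA hu, ← pd_wave hA hu]
  exact pd_congr_of_isOpen hA.isOpen hu j fun y hy => mem_gluedWaves.1 (hglue y hy) m m' a ha

theorem waveDeriv_mem_nullWaves (hA : IsSmoothFamily U d A) (hglue : ∀ y ∈ U, A y ∈ S.gluedWaves y)
    {c : Fin l → ℂ} (hnorm : ∀ y ∈ U, ∀ k, S.wave y (S.R k).1 (S.R k).2 (A y) = c k) (hu : u ∈ U)
    (j : Fin N) : waveDeriv d j A u ∈ S.nullWaves u := by
  refine mem_nullWaves.2 ⟨waveDeriv_mem_gluedWaves hA hglue hu j, fun k => ?_⟩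
  rw [← wave_eq_zero_iff (u := u) (S.D_not_R k).1, ← pd_wave hA hu,
    pd_congr_of_isOpen hA.isOpen hu j fun y hy => hnorm y hy k, pd_const]

/-- The derivative of `A_m exp (uᵐ z)` at `z = 0`, divided by the value of the denominator there,
as a linear function of the numerators `A`. It differs from the derivative at `z = 0` of the
function with numerators `A` by a constant multiple of the value of this function. -/
noncomputable def slopeAtZero (S : SpectralData N l) (u : Fin N → ℂ) (m : Fin N) :
    (Fin N → ℂ[X]) →ₗ[ℂ] ℂ :=
  ((S.polePoly m).eval 0)⁻¹ • (lcoeff ℂ 1 + u m • lcoeff ℂ 0) ∘ₗ LinearMap.proj m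

theorem slopeAtZero_apply (u : Fin N → ℂ) (m : Fin N) (B : Fin N → ℂ[X]) :
    S.slopeAtZero u m B =
      ((S.polePoly m).eval 0)⁻¹ * ((B m).coeff 1 + u m * (B m).coeff 0) := rfl

theorem contDiffOn_slopeAtZero (hA : IsSmoothFamily U d A) (m : Fin N) :
    ContDiffOn ℂ ∞ (fun y => S.slopeAtZero y m (A y)) U := by
  simp only [slopeAtZero_apply]
  exact contDiffOn_const.mul ((hA.contDiffOn_coeff m 1).add
    (ContDiffOn.mul (by fun_prop) (hA.contDiffOn_coeff m 0)))

theorem pd_slopeAtZero (hA : IsSmoothFamily U d A) (hu : u ∈ U) (j m : Fin N) :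
    pd j (fun y => S.slopeAtZero y m (A y)) u = S.slopeAtZero u m (waveDeriv d j A u) := by
  have hd := hA.differentiableAt_coeff hu m
  have hc : DifferentiableAt ℂ (fun y : Fin N → ℂ => y m) u := by fun_prop
  simp only [slopeAtZero_apply]
  rw [pd_const_mul j _ ((hd 1).fun_add (hc.fun_mul (hd 0))), pd_add j (hd 1) (hc.fun_mul (hd 0)),
    pd_mul j hc (hd 0), pd_coord, waveDeriv, coeff_add, coeff_add, hA.coeff_coeffDeriv hu,
    hA.coeff_coeffDeriv hu]
  obtain rfl | hm := eq_or_ne m j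
  · simp only [if_true, coeff_X_mul, mul_coeff_zero, coeff_X_zero]
    ring
  · simp only [if_neg hm, if_neg hm.symm, zero_mul, coeff_zero, add_zero, zero_add]

theorem wave_smul (p : ℂ[X]) (u : Fin N → ℂ) (m : Fin N) (z : ℂ) (B : Fin N → ℂ[X]) :
    S.wave u m z (p • B) = p.eval z * S.wave u m z B := by
  rw [wave_apply, wave_apply, Pi.smul_apply, smul_eq_mul, eval_mul]
  ring

theorem slopeAtZero_X_smul (u : Fin N → ℂ) (m : Fin N) (B : Fin N → ℂ[X]) :
    S.slopeAtZero u m ((X : ℂ[X]) • B) = S.wave u m 0 B := by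
  rw [slopeAtZero_apply, wave_apply, Pi.smul_apply, smul_eq_mul, coeff_X_mul, mul_coeff_zero,
    coeff_X_zero, coeff_zero_eq_eval_zero, mul_zero, Complex.exp_zero]
  ring

theorem smul_mem_gluedWaves (p : ℂ[X]) {B : Fin N → ℂ[X]} (hB : B ∈ S.gluedWaves u) :
    p • B ∈ S.gluedWaves u := by
  refine mem_gluedWaves.2 fun i j a ha => ?_
  rw [wave_smul, wave_smul, mem_gluedWaves.1 hB i j a ha]

theorem smul_mem_nullWaves (p : ℂ[X]) {B : Fin N → ℂ[X]} (hB : B ∈ S.nullWaves u) :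
    p • B ∈ S.nullWaves u := by
  obtain ⟨hglue, hR⟩ := mem_nullWaves.1 hB
  refine mem_nullWaves.2 ⟨smul_mem_gluedWaves p hglue, fun k => ?_⟩
  rw [Pi.smul_apply, smul_eq_mul, eval_mul, hR, mul_zero]

end Derivatives

section SmoothDependence

variable {N l : ℕ} {S : SpectralData N l} {u : Fin N → ℂ}

/-- The vectors of polynomials of degrees at most `deg D` as a function of their coefficients. -/
noncomputable def ofCoeffs (S : SpectralData N l) :
    (∀ i, Fin ((S.D i).card + 1) → ℂ) →ₗ[ℂ] (Fin N → ℂ[X]) :=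
  LinearMap.pi fun i => ofFn _ ∘ₗ LinearMap.proj i

/-- The left-hand sides of the linear equations for the numerators of a Baker--Akhiezer function:
the gluing conditions and the normalization conditions. -/
noncomputable def equations (S : SpectralData N l) (u : Fin N → ℂ) :
    (Fin N → ℂ[X]) →ₗ[ℂ] ((Σ i, Σ j, S.glue i j) ⊕ Fin l → ℂ) :=
  LinearMap.pi <| Sum.elim (fun e => S.wave u e.1 e.2.2 - S.wave u e.2.1 e.2.2)
    fun k => S.wave u (S.R k).1 (S.R k).2

theorem equations_eq_iff {A : Fin N → ℂ[X]} {c : Fin l → ℂ} :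
    S.equations u A = Sum.elim (fun _ => 0) c ↔
      A ∈ S.gluedWaves u ∧ ∀ k, S.wave u (S.R k).1 (S.R k).2 A = c k := by
  rw [mem_gluedWaves, funext_iff, Sum.forall, Sigma.forall]
  refine and_congr (forall_congr' fun i => ?_) Iff.rfl
  rw [Sigma.forall]
  exact forall_congr' fun j => Subtype.forall.trans (forall₂_congr fun _ _ => sub_eq_zero)

theorem ofCoeffs_coeff {A : Fin N → ℂ[X]} (hA : ∀ i, (A i).natDegree ≤ (S.D i).card) :
    S.ofCoeffs (fun i => toFn _ (A i)) = A :=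
  funext fun i => ofFn_comp_toFn_eq_id_of_natDegree_lt (Nat.lt_succ_of_le (hA i))

theorem natDegree_ofCoeffs_le (c : ∀ i, Fin ((S.D i).card + 1) → ℂ) (i : Fin N) :
    (S.ofCoeffs c i).natDegree ≤ (S.D i).card :=
  Nat.le_of_lt_succ (ofFn_natDegree_lt (Nat.le_add_left _ _) (c i))

theorem ofCoeffs_injective : Function.Injective S.ofCoeffs := fun _ _ h =>
  funext fun i => injective_ofFn _ (congrFun h i)

theorem contDiff_equations_ofCoeffs :
    ContDiff ℂ ∞ fun u => (S.equations u ∘ₗ S.ofCoeffs).toContinuousLinearMap := by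
  refine contDiff_clm_apply_iff.2 fun c => contDiff_pi.2 ?_
  have hwave : ∀ i z, ContDiff ℂ ∞ fun u => S.wave u i z (S.ofCoeffs c) := fun i z => by
    simp only [wave_apply]
    fun_prop
  rintro (e | k)
  · exact (hwave e.1 e.2.2).sub (hwave e.2.1 e.2.2)
  · exact hwave _ _

theorem IsUniqueBakerAkhiezer.equations_ofCoeffs_injective {ψ : Fin N → ℂ → ℂ}
    (hψ : S.IsUniqueBakerAkhiezer u ψ) : Function.Injective (S.equations u ∘ₗ S.ofCoeffs) := by
  refine (injective_iff_map_eq_zero _).2 fun c hc => ofCoeffs_injective ?_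
  rw [map_zero]
  have hsol : S.equations u (S.ofCoeffs c) = Sum.elim (fun _ => 0) fun _ => 0 :=
    hc.trans Sum.elim_zero_zero.symm
  obtain ⟨hglue, hnorm⟩ := equations_eq_iff.1 hsol
  exact hψ.eq_zero (mem_nullWaves.2 ⟨hglue, fun k =>
    (wave_eq_zero_iff (S.D_not_R k).1).1 (hnorm k)⟩) (natDegree_ofCoeffs_le c)

/-- `A` is the family of the numerators of the Baker--Akhiezer functions `ψ u`, `u ∈ U`. -/
structure IsNumeratorFamily (S : SpectralData N l) (U : Set (Fin N → ℂ))
    (ψ : (Fin N → ℂ) → Fin N → ℂ → ℂ) (A : (Fin N → ℂ) → Fin N → ℂ[X]) : Prop extends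
    IsSmoothFamily U (fun i => (S.D i).card) A where
  unique : ∀ u ∈ U, S.IsUniqueBakerAkhiezer u (ψ u)
  mem_gluedWaves : ∀ u ∈ U, A u ∈ S.gluedWaves u
  eq_wave : ∀ u ∈ U, ∀ i, ∀ z ∉ S.D i, ψ u i z = S.wave u i z (A u)

variable {U V : Set (Fin N → ℂ)} {ψ : (Fin N → ℂ) → Fin N → ℂ → ℂ}

theorem IsNumeratorFamily.mono {A : (Fin N → ℂ) → Fin N → ℂ[X]} (F : S.IsNumeratorFamily U ψ A)
    (hV : IsOpen V) (hVU : V ⊆ U) : S.IsNumeratorFamily V ψ A where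
  isOpen := hV
  natDegree_le u hu := F.natDegree_le u (hVU hu)
  contDiffOn_coeff m t := (F.contDiffOn_coeff m t).mono hVU
  unique u hu := F.unique u (hVU hu)
  mem_gluedWaves u hu := F.mem_gluedWaves u (hVU hu)
  eq_wave u hu := F.eq_wave u (hVU hu)

theorem IsNumeratorFamily.wave_R {A : (Fin N → ℂ) → Fin N → ℂ[X]}
    (F : S.IsNumeratorFamily U ψ A) (hu : u ∈ U) (k : Fin l) :
    S.wave u (S.R k).1 (S.R k).2 (A u) = S.d k := by
  rw [← F.eq_wave u hu _ _ (S.D_not_R k).1, (F.unique u hu).1.norm]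

theorem exists_isNumeratorFamily (hU : IsOpen U)
    (hψ : ∀ u ∈ U, S.IsUniqueBakerAkhiezer u (ψ u)) : ∃ A, S.IsNumeratorFamily U ψ A := by
  have hex := fun u (hu : u ∈ U) => (hψ u hu).1.exists_wave
  choose! A hglue hdeg heq using hex
  have hsol : ∀ u ∈ U, S.equations u (S.ofCoeffs fun i => toFn _ (A u i)) =
      Sum.elim (fun _ => 0) S.d := fun u hu => by
    rw [ofCoeffs_coeff (hdeg u hu), equations_eq_iff]
    refine ⟨hglue u hu, fun k => ?_⟩
    rw [← heq u hu _ _ (S.D_not_R k).1, (hψ u hu).1.norm]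
  have hsmooth : ContDiffOn ℂ ∞ (fun u i => toFn ((S.D i).card + 1) (A u i)) U := fun u hu => by
    obtain ⟨L, hL⟩ := LinearMap.exists_leftInverse_of_injective _
      (LinearMap.ker_eq_bot.2 (hψ u hu).equations_ofCoeffs_injective)
    refine (contDiffAt_of_apply_eq (L := L.toContinuousLinearMap)
      (b := fun _ => Sum.elim (fun _ => 0) S.d) ?_
      contDiff_equations_ofCoeffs.contDiffAt contDiffAt_const ?_).contDiffWithinAt
    · ext1 c
      exact LinearMap.congr_fun hL c
    · filter_upwards [hU.mem_nhds hu] with y hy using hsol y hy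
  refine ⟨A, ⟨hU, hdeg, fun m t => ?_⟩, hψ, hglue, heq⟩
  obtain ht | ht := le_or_gt t (S.D m).card
  · exact contDiffOn_pi.1 (contDiffOn_pi.1 hsmooth m) ⟨t, Nat.lt_succ_of_le ht⟩
  · exact contDiffOn_const.congr fun u hu =>
      coeff_eq_zero_of_natDegree_lt ((hdeg u hu m).trans_lt ht)

end SmoothDependence

end SpectralData

theorem coeff_waveDeriv_succ {N : ℕ} {d : Fin N → ℕ} {A : (Fin N → ℂ) → Fin N → ℂ[X]}
    {u : Fin N → ℂ} (j m : Fin N) :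
    (waveDeriv d j A u m).coeff (d m + 1) = if m = j then (A u m).coeff (d m) else 0 := by
  rw [waveDeriv, coeff_add,
    coeff_eq_zero_of_natDegree_lt (Nat.lt_succ_of_le natDegree_coeffDeriv_le), zero_add]
  split_ifs
  · exact coeff_X_mul _ _
  · rw [zero_mul, coeff_zero]

namespace SpectralData

variable {N l : ℕ} {S : SpectralData N l} {U : Set (Fin N → ℂ)} {u : Fin N → ℂ}
  {ψ : (Fin N → ℂ) → Fin N → ℂ → ℂ} {A : (Fin N → ℂ) → Fin N → ℂ[X]} {B : Fin N → ℂ[X]}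

namespace IsNumeratorFamily

theorem natDegree_waveDeriv_le_card_add_one (F : S.IsNumeratorFamily U ψ A) (hu : u ∈ U)
    (j m : Fin N) : (waveDeriv (fun i => (S.D i).card) j A u m).natDegree ≤ (S.D m).card + 1 := by
  refine (F.natDegree_waveDeriv_le hu j m).trans (Nat.add_le_add_left ?_ _)
  rw [Pi.single_apply]
  split_ifs <;> simp

theorem waveDeriv_mem_nullWaves (F : S.IsNumeratorFamily U ψ A) (hu : u ∈ U) (j : Fin N) :
    waveDeriv (fun i => (S.D i).card) j A u ∈ S.nullWaves u :=
  SpectralData.waveDeriv_mem_nullWaves F.toIsSmoothFamily F.mem_gluedWaves (fun _ => F.wave_R) hu j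

theorem eq_sum_smul_waveDeriv (F : S.IsNumeratorFamily U ψ A) (hu : u ∈ U)
    (hlead : ∀ i, (A u i).coeff (S.D i).card ≠ 0) (hB : B ∈ S.nullWaves u)
    (hdeg : ∀ m, (B m).natDegree ≤ (S.D m).card + 1) :
    B = ∑ p, ((B p).coeff ((S.D p).card + 1) / (A u p).coeff (S.D p).card) •
      waveDeriv (fun i => (S.D i).card) p A u := by
  refine sub_eq_zero.1 ((F.unique u hu).eq_zero (sub_mem hB (sum_mem fun p _ =>
    Submodule.smul_mem _ _ (F.waveDeriv_mem_nullWaves hu p))) fun m => ?_)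
  refine natDegree_le_pred (n := (S.D m).card + 1) ?_ ?_
  · simp only [Pi.sub_apply, Finset.sum_apply, Pi.smul_apply]
    exact (natDegree_sub_le _ _).trans (max_le (hdeg m) (natDegree_sum_le_of_forall_le _ _
      fun p _ => (natDegree_smul_le _ _).trans (F.natDegree_waveDeriv_le_card_add_one hu p m)))
  · simp only [Pi.sub_apply, Finset.sum_apply, coeff_sub, finsetSum_coeff, Pi.smul_apply,
      coeff_smul, coeff_waveDeriv_succ (d := fun i => (S.D i).card) _ m, smul_eq_mul, mul_ite,
      mul_zero, Finset.sum_ite_eq, Finset.mem_univ, if_true]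
    rw [div_mul_cancel₀ _ (hlead m), sub_self]

theorem waveDeriv_waveDeriv_mem_nullWaves (F : S.IsNumeratorFamily U ψ A) (hu : u ∈ U)
    (i j : Fin N) :
    waveDeriv ((fun i => (S.D i).card) + Pi.single j 1) i (waveDeriv (fun i => (S.D i).card) j A) u
      ∈ S.nullWaves u := by
  refine SpectralData.waveDeriv_mem_nullWaves (c := fun _ => 0) (F.toIsSmoothFamily.waveDeriv j)
    (fun y hy => (mem_nullWaves.1 (F.waveDeriv_mem_nullWaves hy j)).1) (fun y hy k => ?_) hu i
  rw [wave_eq_zero_iff (S.D_not_R k).1]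
  exact (mem_nullWaves.1 (F.waveDeriv_mem_nullWaves hy j)).2 k

/-- The second derivative `∂²/∂uⁱ∂uʲ` of a Baker--Akhiezer function vanishes at the normalization
points and has leading term `δ_{ij} z_i²` at `P_i`, which is removed by subtracting
`δ_{ij} z ∂/∂uⁱ`. -/
theorem exists_waveDeriv_waveDeriv_eq (F : S.IsNumeratorFamily U ψ A) (hu : u ∈ U)
    (hlead : ∀ i, (A u i).coeff (S.D i).card ≠ 0) (i j : Fin N) : ∃ Γ : Fin N → ℂ,
    waveDeriv ((fun i => (S.D i).card) + Pi.single j 1) i (waveDeriv (fun i => (S.D i).card) j A) u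
      = ∑ p, Γ p • waveDeriv (fun i => (S.D i).card) p A u +
        (if i = j then X else 0 : ℂ[X]) • waveDeriv (fun i => (S.D i).card) i A u := by
  refine ⟨_, sub_eq_iff_eq_add.1 (F.eq_sum_smul_waveDeriv hu hlead
    (sub_mem (F.waveDeriv_waveDeriv_mem_nullWaves hu i j)
      (smul_mem_nullWaves _ (F.waveDeriv_mem_nullWaves hu i))) fun m => ?_)⟩
  have hcoeff : (coeffDeriv ((fun i => (S.D i).card) + Pi.single j 1) i
      (waveDeriv (fun i => (S.D i).card) j A) u m).natDegree ≤ (S.D m).card + 1 := by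
    refine natDegree_coeffDeriv_le.trans (Nat.add_le_add_left ?_ _)
    rw [Pi.single_apply]
    split_ifs <;> simp
  have hX : ∀ p, m ≠ p →
      (X * waveDeriv (fun i => (S.D i).card) p A u m).natDegree ≤ (S.D m).card + 1 := by
    intro p hp
    have hdeg := F.natDegree_waveDeriv_le hu p m
    rw [Pi.add_apply, Pi.single_eq_of_ne hp, add_zero] at hdeg
    rw [add_comm]
    exact natDegree_mul_le_of_le natDegree_X_le hdeg
  rw [Pi.sub_apply, Pi.smul_apply, smul_eq_mul, waveDeriv, add_sub_assoc]
  refine natDegree_add_le_of_degree_le hcoeff ?_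
  obtain rfl | hij := eq_or_ne i j <;> obtain rfl | hm := eq_or_ne m i
  · rw [sub_self, natDegree_zero]
    exact Nat.zero_le _
  · rw [if_neg hm, if_pos rfl, zero_mul, zero_sub, natDegree_neg]
    exact hX i hm
  · rw [if_pos rfl, if_neg hij, zero_mul, sub_zero]
    exact hX j hij
  · rw [if_neg hm, if_neg hij, zero_mul, zero_mul, sub_zero, natDegree_zero]
    exact Nat.zero_le _

theorem apply_zero_eq_wave (F : S.IsNumeratorFamily U ψ A) (hu : u ∈ U) (k : Fin N) :
    ψ u k 0 = S.wave u k 0 (A u) :=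
  F.eq_wave u hu k 0 fun h0 => S.D_ne_zero k 0 h0 rfl

theorem pd_apply_zero (F : S.IsNumeratorFamily U ψ A) (hu : u ∈ U) (j k : Fin N) :
    pd j (fun y => ψ y k 0) u = S.wave u k 0 (waveDeriv (fun i => (S.D i).card) j A u) := by
  rw [pd_congr_of_isOpen F.isOpen hu j fun y hy => F.apply_zero_eq_wave hy k,
    pd_wave F.toIsSmoothFamily hu]

theorem sum_pd_apply_zero (F : S.IsNumeratorFamily U ψ A) (hu : u ∈ U)
    (hlead : ∀ i, (A u i).coeff (S.D i).card ≠ 0) {r : ℂ} (hr : ∀ k, (S.R k).2 = r) (k : Fin N) :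
    ∑ i, pd i (fun y => ψ y k 0) u = -r * ψ u k 0 := by
  have hdeg : ∀ m, (((X - C r) • A u) m).natDegree ≤ (S.D m).card + 1 := fun m => by
    rw [add_comm]
    exact natDegree_mul_le_of_le (natDegree_X_sub_C_le r) (F.natDegree_le u hu m)
  have hnull : (X - C r) • A u ∈ S.nullWaves u :=
    mem_nullWaves.2 ⟨smul_mem_gluedWaves _ (F.mem_gluedWaves u hu), fun k => by
      rw [Pi.smul_apply, smul_eq_mul, eval_mul, eval_sub, eval_X, eval_C, hr, sub_self, zero_mul]⟩
  have hcoeff : ∀ p, (((X - C r) • A u) p).coeff ((S.D p).card + 1) =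
      (A u p).coeff (S.D p).card := fun p => by
    rw [Pi.smul_apply, smul_eq_mul, sub_mul, coeff_sub, coeff_X_mul, coeff_C_mul,
      coeff_eq_zero_of_natDegree_lt (Nat.lt_succ_of_le (F.natDegree_le u hu p)), mul_zero, sub_zero]
  have hwave := congrArg (S.wave u k 0) (F.eq_sum_smul_waveDeriv hu hlead hnull hdeg)
  simp only [hcoeff, div_self (hlead _), one_smul, map_sum, wave_smul, ← F.pd_apply_zero hu,
    ← F.apply_zero_eq_wave hu, eval_sub, eval_X, eval_C, zero_sub] at hwave
  exact hwave.symm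

theorem sum_eta_mul_pd_mul_pd (F : S.IsNumeratorFamily U ψ A) (hu : u ∈ U) (i j : Fin N) :
    ∑ k, ∑ m, S.eta k m * pd i (fun y => ψ y k 0) u * pd j (fun y => ψ y m 0) u =
      Matrix.diagonal (fun i => S.epsSq i * (A u i).coeff (S.D i).card ^ 2) i j := by
  have hdiag : ∀ k, ∑ m, S.eta k m * pd i (fun y => ψ y k 0) u * pd j (fun y => ψ y m 0) u =
      S.eta k k * (pd i (fun y => ψ y k 0) u * pd j (fun y => ψ y k 0) u) := fun k => by
    rw [Finset.sum_eq_single k (fun m _ hm => ?_) fun hk => (hk (Finset.mem_univ k)).elim,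
      mul_assoc]
    rw [eta, Matrix.diagonal_apply_ne' _ hm, zero_mul, zero_mul]
  rw [Finset.sum_congr rfl fun k _ => hdiag k]
  simp only [F.pd_apply_zero hu]
  rw [sum_eta_mul_wave_mul_wave (F.waveDeriv_mem_nullWaves hu i) (F.waveDeriv_mem_nullWaves hu j)
    (F.natDegree_waveDeriv_le_card_add_one hu i) (F.natDegree_waveDeriv_le_card_add_one hu j)]
  simp only [coeff_waveDeriv_succ (d := fun i => (S.D i).card),
    Matrix.diagonal_apply, ite_mul, zero_mul, mul_ite, mul_zero, Finset.sum_ite_eq',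
    Finset.mem_univ, if_true, ← sq]
  obtain rfl | hij := eq_or_ne i j
  · rfl
  · rw [if_neg hij, if_neg hij.symm]

theorem exists_hessian (F : S.IsNumeratorFamily U ψ A) (hu : u ∈ U)
    (hlead : ∀ i, (A u i).coeff (S.D i).card ≠ 0) (i j : Fin N) : ∃ Γ : Fin N → ℂ, ∀ k,
    (pd i (pd j fun y => ψ y k 0) u = ∑ p, Γ p * pd p (fun y => ψ y k 0) u) ∧
    pd i (pd j fun y => S.slopeAtZero y k (A y)) u =
      ∑ p, Γ p * pd p (fun y => S.slopeAtZero y k (A y)) u +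
        if i = j then pd i (fun y => ψ y k 0) u else 0 := by
  have hA := F.toIsSmoothFamily
  obtain ⟨Γ, hΓ⟩ := F.exists_waveDeriv_waveDeriv_eq hu hlead i j
  refine ⟨Γ, fun k => ⟨?_, ?_⟩⟩
  · rw [pd_congr_of_isOpen hA.isOpen hu i fun y hy => F.pd_apply_zero hy j k,
      pd_wave (hA.waveDeriv j) hu, hΓ]
    simp only [map_add, map_sum, map_smul, smul_eq_mul, wave_smul, apply_ite (eval (0 : ℂ)), eval_X,
      eval_zero, ite_self, zero_mul, add_zero, F.pd_apply_zero hu]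
  · rw [pd_congr_of_isOpen hA.isOpen hu i fun y hy => pd_slopeAtZero hA hy j k,
      pd_slopeAtZero (hA.waveDeriv j) hu, hΓ]
    simp only [map_add, map_sum, map_smul, smul_eq_mul, F.pd_apply_zero hu, pd_slopeAtZero hA hu]
    split_ifs
    · rw [slopeAtZero_X_smul]
    · rw [zero_smul, map_zero]

theorem isFlatFrame (F : S.IsNumeratorFamily U ψ A)
    (hlead : ∀ u ∈ U, ∀ i, (A u i).coeff (S.D i).card ≠ 0) :
    IsFlatFrame U (fun u i => S.epsSq i * (A u i).coeff (S.D i).card ^ 2) S.eta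
      (fun u k => ψ u k 0) fun u k => S.slopeAtZero u k (A u) where
  isOpen := F.isOpen
  smooth_x := contDiffOn_pi.2 fun k =>
    (contDiffOn_wave F.toIsSmoothFamily k 0).congr fun _ hu => F.apply_zero_eq_wave hu k
  η_symm := Matrix.diagonal_transpose _
  det_ne_zero u hu := by
    rw [Matrix.det_diagonal]
    exact Finset.prod_ne_zero_iff.2 fun i _ =>
      mul_ne_zero (S.epsSq_ne_zero i) (pow_ne_zero 2 (hlead u hu i))
  metric_eq _ hu := F.sum_eta_mul_pd_mul_pd hu
  η_det := eta_det_ne_zero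
  smooth_f := contDiffOn_pi.2 fun k => contDiffOn_slopeAtZero F.toIsSmoothFamily k
  hessian _ hu := F.exists_hessian hu (hlead _ hu)

end IsNumeratorFamily

end SpectralData

section Conjugation

theorem eval_map_conj (p : ℂ[X]) (z : ℂ) :
    (p.map (starRingEnd ℂ)).eval (conj z) = conj (p.eval z) := by
  rw [eval_map, eval₂_hom]

theorem conj_eval_of_map_eq {p : ℂ[X]} (hp : p.map (starRingEnd ℂ) = p) (z : ℂ) :
    conj (p.eval z) = p.eval (conj z) := by
  rw [← eval_map_conj, hp]

theorem coeff_im_of_map_eq {p : ℂ[X]} (hp : p.map (starRingEnd ℂ) = p) (n : ℕ) :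
    (p.coeff n).im = 0 :=
  Complex.conj_eq_iff_im.1 (by conv_rhs => rw [← hp, coeff_map])

theorem eval_zero_im_of_map_eq {p : ℂ[X]} (hp : p.map (starRingEnd ℂ) = p) :
    (p.eval 0).im = 0 := by
  rw [← coeff_zero_eq_eval_zero]
  exact coeff_im_of_map_eq hp 0

theorem sign_mul_abs_self (r : ℝ) : Real.sign r * |r| = r := by
  rcases lt_trichotomy r 0 with hr | rfl | hr
  · rw [Real.sign_of_neg hr, abs_of_neg hr, neg_one_mul, neg_neg]
  · rw [abs_zero, mul_zero]
  · rw [Real.sign_of_pos hr, abs_of_pos hr, one_mul]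

theorem sign_mul_sqrt_abs_mul_sq {a b : ℂ} (ha : a.im = 0) (hb : b.im = 0) :
    Real.sign a.re * (√|a.re| * b.re) ^ 2 = (a * b ^ 2).re := by
  lift a to ℝ using ha
  lift b to ℝ using hb
  rw [Complex.ofReal_re, Complex.ofReal_re, mul_pow, Real.sq_sqrt (abs_nonneg a), ← mul_assoc,
    sign_mul_abs_self, ← Complex.ofReal_pow, ← Complex.ofReal_mul, Complex.ofReal_re]

end Conjugation

namespace SpectralData

variable {N l : ℕ} {S : SpectralData N l}

namespace IsReal

theorem eta_im (hS : S.IsReal) (k m : Fin N) : (S.eta k m).im = 0 := by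
  obtain ⟨hnum, hdenom⟩ := hS.Ω k
  have hderiv : (S.Ω k).denom.derivative.map (starRingEnd ℂ) = (S.Ω k).denom.derivative := by
    rw [← derivative_map, hdenom]
  rw [eta, Matrix.diagonal_apply, simpleResidue]
  split_ifs
  · rw [Complex.div_im, eval_zero_im_of_map_eq hnum, eval_zero_im_of_map_eq hderiv]
    simp
  all_goals rfl

theorem epsSq_im (hS : S.IsReal) (i : Fin N) : (S.epsSq i).im = 0 := by
  rw [epsSq_eq_neg_leadingCoeff, Complex.neg_im, leadingCoeff, coeff_im_of_map_eq (hS.Ω i).1,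
    neg_zero]

theorem sign_epsSq (hS : S.IsReal) (i : Fin N) :
    Real.sign (S.epsSq i).re = 1 ∨ Real.sign (S.epsSq i).re = -1 :=
  (Real.sign_apply_eq_of_ne_zero _ fun hre =>
    S.epsSq_ne_zero i (Complex.ext hre (hS.epsSq_im i))).symm

theorem R_im (hS : S.IsReal) (hR : ∀ k m, (S.R k).2 = (S.R m).2) (k : Fin l) :
    (S.R k).2.im = 0 := by
  obtain ⟨m, hm, -⟩ := hS.R k
  exact Complex.conj_eq_iff_im.1 ((congrArg Prod.snd hm).symm.trans (hR m k))

theorem map_polePoly (hS : S.IsReal) (i : Fin N) :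
    (S.polePoly i).map (starRingEnd ℂ) = S.polePoly i := by
  rw [polePoly, map_rootProd, hS.D i]

theorem wave_map_conj (hS : S.IsReal) (u : Fin N → ℝ) (m : Fin N) (z : ℂ) (B : Fin N → ℂ[X]) :
    S.wave (ofRealVec u) m (conj z) (fun m => (B m).map (starRingEnd ℂ)) =
      conj (S.wave (ofRealVec u) m z B) := by
  rw [wave_apply, wave_apply, eval_map_conj, map_mul, map_div₀, ← Complex.exp_conj, map_mul,
    ofRealVec_apply, Complex.conj_ofReal, conj_eval_of_map_eq (hS.map_polePoly m)]

end IsReal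

namespace IsNumeratorFamily

variable {U : Set (Fin N → ℂ)} {ψ : (Fin N → ℂ) → Fin N → ℂ → ℂ}
  {A : (Fin N → ℂ) → Fin N → ℂ[X]}

section RealPoints

variable {u : Fin N → ℝ}

theorem map_conj (F : S.IsNumeratorFamily U ψ A) (hS : S.IsReal) (hu : ofRealVec u ∈ U)
    (m : Fin N) : (A (ofRealVec u) m).map (starRingEnd ℂ) = A (ofRealVec u) m := by
  have hwave : ∀ m z, S.wave (ofRealVec u) m z
      (fun m => (A (ofRealVec u) m).map (starRingEnd ℂ)) =
        conj (S.wave (ofRealVec u) m (conj z) (A (ofRealVec u))) := fun m z => by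
    rw [← hS.wave_map_conj, Complex.conj_conj]
  have hglue := SpectralData.mem_gluedWaves.1 (F.mem_gluedWaves _ hu)
  refine congrFun (sub_eq_zero.1 ((F.unique _ hu).eq_zero
    (A := (fun m => (A (ofRealVec u) m).map (starRingEnd ℂ)) - A (ofRealVec u))
    (mem_nullWaves.2 ⟨sub_mem (SpectralData.mem_gluedWaves.2 fun i j a ha => ?_)
      (F.mem_gluedWaves _ hu), fun k => ?_⟩) fun i => ?_)) m
  · rw [hwave, hwave, hglue i j _ (hS.glue i j a ha)]
  · obtain ⟨n, hn, hd⟩ := hS.R k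
    have hnorm := F.wave_R hu n
    rw [hn, hd] at hnorm
    rw [← wave_eq_zero_iff (u := ofRealVec u) (S.D_not_R k).1, map_sub, hwave, hnorm, F.wave_R hu,
      Complex.conj_conj, sub_self]
  · exact (natDegree_sub_le _ _).trans
      (max_le (natDegree_map_le.trans (F.natDegree_le _ hu i)) (F.natDegree_le _ hu i))

theorem apply_zero_im (F : S.IsNumeratorFamily U ψ A) (hS : S.IsReal) (hu : ofRealVec u ∈ U)
    (k : Fin N) : (ψ (ofRealVec u) k 0).im = 0 := by
  rw [F.apply_zero_eq_wave hu, wave_apply, mul_zero, Complex.exp_zero, mul_one, Complex.div_im,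
    eval_zero_im_of_map_eq (F.map_conj hS hu k), eval_zero_im_of_map_eq (hS.map_polePoly k)]
  simp

theorem slopeAtZero_im (F : S.IsNumeratorFamily U ψ A) (hS : S.IsReal) (hu : ofRealVec u ∈ U)
    (k : Fin N) : (S.slopeAtZero (ofRealVec u) k (A (ofRealVec u))).im = 0 := by
  have hcoeff := coeff_im_of_map_eq (F.map_conj hS hu k)
  simp [slopeAtZero_apply, Complex.mul_im, Complex.inv_im, hcoeff,
    eval_zero_im_of_map_eq (hS.map_polePoly k), ofRealVec_apply]

end RealPoints

theorem isFlatFrame_re (F : S.IsNumeratorFamily U ψ A) (hS : S.IsReal)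
    (hlead : ∀ u ∈ U, ∀ i, (A u i).coeff (S.D i).card ≠ 0) :
    IsFlatFrame (ofRealVec ⁻¹' U)
      (fun u i => (S.epsSq i * (A (ofRealVec u) i).coeff (S.D i).card ^ 2).re)
      (S.eta.map Complex.re) (fun u k => (ψ (ofRealVec u) k 0).re)
      fun u k => (S.slopeAtZero (ofRealVec u) k (A (ofRealVec u))).re :=
  (F.isFlatFrame hlead).re hS.eta_im (fun _ hu => F.apply_zero_im hS hu)
    fun _ hu => F.slopeAtZero_im hS hu

theorem correlatorsHomogeneous (F : S.IsNumeratorFamily U ψ A)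
    (hlead : ∀ u ∈ U, ∀ i, (A u i).coeff (S.D i).card ≠ 0) {e : Fin N → ℂ}
    {H : (Fin N → ℂ) → Fin N → ℂ}
    (hH : ∀ u ∈ U, ∀ i, e i * H u i ^ 2 = S.epsSq i * (A u i).coeff (S.D i).card ^ 2)
    (hR : ∀ k m, (S.R k).2 = (S.R m).2) : CorrelatorsHomogeneous U e H fun u k => ψ u k 0 := by
  obtain ⟨k₀, -⟩ := S.d_ne_zero
  exact (F.isFlatFrame hlead).correlatorsHomogeneous hH (neg_ne_zero.2 (S.R_ne_zero k₀))
    fun u hu => F.sum_pd_apply_zero hu (hlead u hu) fun k => hR k k₀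

theorem correlatorsHomogeneous_re (F : S.IsNumeratorFamily U ψ A) (hS : S.IsReal)
    (hlead : ∀ u ∈ U, ∀ i, (A u i).coeff (S.D i).card ≠ 0) {e : Fin N → ℝ}
    {H : (Fin N → ℝ) → Fin N → ℝ}
    (hH : ∀ u, ofRealVec u ∈ U → ∀ i,
      e i * H u i ^ 2 = (S.epsSq i * (A (ofRealVec u) i).coeff (S.D i).card ^ 2).re)
    (hR : ∀ k m, (S.R k).2 = (S.R m).2) :
    CorrelatorsHomogeneous (ofRealVec ⁻¹' U) e H fun u k => (ψ (ofRealVec u) k 0).re := by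
  obtain ⟨k₀, -⟩ := S.d_ne_zero
  have hr : (S.R k₀).2 = ((S.R k₀).2.re : ℂ) := Complex.ext rfl (hS.R_im hR k₀)
  have hr₀ : (S.R k₀).2.re ≠ 0 := fun h0 => S.R_ne_zero k₀ (by rw [hr, h0, Complex.ofReal_zero])
  refine (F.isFlatFrame_re hS hlead).correlatorsHomogeneous hH (neg_ne_zero.2 hr₀) fun u hu k => ?_
  have hsum := F.sum_pd_apply_zero hu (hlead _ hu) (fun k => (hR k k₀).trans hr) k
  have hd := differentiableAt_of_contDiffOn F.isOpen ((F.isFlatFrame hlead).contDiffOn_apply k) hu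
  rw [Finset.sum_congr rfl fun i _ => pd_re hd i, ← Complex.re_sum, hsum, ← Complex.ofReal_neg,
    Complex.re_ofReal_mul]

end IsNumeratorFamily

theorem exists_isNumeratorFamily_coeff_eq {U : Set (Fin N → ℂ)} (hU : IsOpen U)
    {ψ : (Fin N → ℂ) → Fin N → ℂ → ℂ} (hψ : ∀ u ∈ U, S.IsUniqueBakerAkhiezer u (ψ u))
    {h : (Fin N → ℂ) → Fin N → ℂ}
    (hh : ∀ u ∈ U, ∀ i, Tendsto (fun z => ψ u i z * Complex.exp (-(u i * z)))
      (Bornology.cobounded ℂ) (𝓝 (h u i))) :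
    ∃ A, S.IsNumeratorFamily {u | u ∈ U ∧ ∀ i, h u i ≠ 0} ψ A ∧
      ∀ u ∈ {u | u ∈ U ∧ ∀ i, h u i ≠ 0}, ∀ i, (A u i).coeff (S.D i).card = h u i := by
  obtain ⟨A, F⟩ := exists_isNumeratorFamily hU hψ
  have hcoeff : ∀ u ∈ U, ∀ i, (A u i).coeff (S.D i).card = h u i := fun u hu i =>
    coeff_card_eq_of_tendsto (F.natDegree_le u hu i) (F.eq_wave u hu i) (hh u hu i)
  refine ⟨A, F.mono (isOpen_iff_mem_nhds.2 fun u ⟨hu, hhu⟩ => ?_) fun u hu => hu.1,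
    fun u hu => hcoeff u hu.1⟩
  have hne : ∀ᶠ y in 𝓝 u, ∀ i, (A y i).coeff (S.D i).card ≠ 0 := eventually_all.2 fun i =>
    (F.differentiableAt_coeff hu i _).continuousAt.eventually_ne (hcoeff u hu i ▸ hhu i)
  filter_upwards [hne, hU.mem_nhds hu] with y hy hyU using ⟨hyU, fun i => hcoeff y hyU i ▸ hy i⟩

end SpectralData

end FiniteGap

open FiniteGap SpectralData in
theorem theorem5_general {N l : ℕ} (S : SpectralData N l)
    (U : Set (Fin N → ℂ)) (hU : IsOpen U)
    (ψ : (Fin N → ℂ) → Fin N → ℂ → ℂ)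
    (hψ : ∀ u ∈ U, S.IsUniqueBakerAkhiezer u (ψ u))
    (h : (Fin N → ℂ) → Fin N → ℂ)
    (hh : ∀ u ∈ U, ∀ i, Tendsto (fun z => ψ u i z * Complex.exp (-(u i * z)))
      (Bornology.cobounded ℂ) (𝓝 (h u i)))
    (ε : Fin N → ℂ) (hε : ∀ i, ε i ^ 2 = S.epsSq i)
    (V : Set (Fin N → ℂ)) (hV : V = {u | u ∈ U ∧ ∀ i, h u i ≠ 0})
    (V' : Set (Fin N → ℝ)) (hV' : V' = {u | (fun i => (u i : ℂ)) ∈ V}) :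
    (IsFlatEgorov V (fun _ => 1) (fun u i => ε i * h u i) S.eta (fun u k => ψ u k 0) ∧
      GivesAssociativity V (fun _ => 1) (fun u i => ε i * h u i) S.eta (fun u k => ψ u k 0) ∧
      ((∀ k m, (S.R k).2 = (S.R m).2) →
        CorrelatorsHomogeneous V (fun _ => 1) (fun u i => ε i * h u i) (fun u k => ψ u k 0))) ∧
    (S.IsReal →
      (∀ k, (S.eta k k).im = 0 ∧ (S.epsSq k).im = 0) ∧
      (∀ u ∈ V', ∀ k, (ψ (fun i => (u i : ℂ)) k 0).im = 0 ∧ (h (fun i => (u i : ℂ)) k).im = 0) ∧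
      IsFlatEgorov V' (fun i => Real.sign (S.epsSq i).re)
        (fun u i => √|(S.epsSq i).re| * (h (fun j => (u j : ℂ)) i).re)
        (S.eta.map Complex.re) (fun u k => (ψ (fun j => (u j : ℂ)) k 0).re) ∧
      GivesAssociativity V' (fun i => Real.sign (S.epsSq i).re)
        (fun u i => √|(S.epsSq i).re| * (h (fun j => (u j : ℂ)) i).re)
        (S.eta.map Complex.re) (fun u k => (ψ (fun j => (u j : ℂ)) k 0).re) ∧
      ((∀ k m, (S.R k).2 = (S.R m).2) →
        CorrelatorsHomogeneous V' (fun i => Real.sign (S.epsSq i).re)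
          (fun u i => √|(S.epsSq i).re| * (h (fun j => (u j : ℂ)) i).re)
          (fun u k => (ψ (fun j => (u j : ℂ)) k 0).re))) := by
  subst hV'
  obtain ⟨A, F, hA⟩ := exists_isNumeratorFamily_coeff_eq hU hψ hh
  rw [← hV] at F hA
  have hlead : ∀ u ∈ V, ∀ i, (A u i).coeff (S.D i).card ≠ 0 := fun u hu i =>
    (hA u hu i).trans_ne ((hV.subset hu).2 i)
  have hsmooth : ∀ i, ContDiffOn ℂ ∞ (fun u => h u i) V := fun i =>
    (F.contDiffOn_coeff i (S.D i).card).congr fun u hu => (hA u hu i).symm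
  have hg : ∀ u ∈ V, ∀ i, 1 * (ε i * h u i) ^ 2 =
      S.epsSq i * (A u i).coeff (S.D i).card ^ 2 := fun u hu i => by
    rw [one_mul, mul_pow, hε, hA u hu]
  have hframe := F.isFlatFrame hlead
  refine ⟨⟨hframe.isFlatEgorov (fun _ => Or.inl rfl)
      (contDiffOn_pi.2 fun i => contDiffOn_const.mul (hsmooth i)) hg,
    hframe.givesAssociativity hg, F.correlatorsHomogeneous hlead hg⟩, fun hS => ?_⟩
  have him : ∀ u, ofRealVec u ∈ V → ∀ i, (h (ofRealVec u) i).im = 0 := fun u hu i =>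
    hA _ hu i ▸ coeff_im_of_map_eq (F.map_conj hS hu i) _
  have hg' : ∀ u, ofRealVec u ∈ V → ∀ i,
      Real.sign (S.epsSq i).re * (√|(S.epsSq i).re| * (h (ofRealVec u) i).re) ^ 2 =
        (S.epsSq i * (A (ofRealVec u) i).coeff (S.D i).card ^ 2).re := fun u hu i => by
    rw [hA _ hu, sign_mul_sqrt_abs_mul_sq (hS.epsSq_im i) (him u hu i)]
  have hframe' := F.isFlatFrame_re hS hlead
  exact ⟨fun k => ⟨hS.eta_im k k, hS.epsSq_im k⟩,
    fun u hu k => ⟨F.apply_zero_im hS hu k, him u hu k⟩,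
    hframe'.isFlatEgorov hS.sign_epsSq
      (contDiffOn_pi.2 fun i => contDiffOn_const.mul (contDiffOn_re (hsmooth i))) hg',
    hframe'.givesAssociativity hg', F.correlatorsHomogeneous_re hS hlead hg'⟩

/-- `U` is an open set of parameters `u ∈ ℂ^N` for which the Baker--Akhiezer function `ψ` exists
and is unique, `h_i` is the limit of `ψ exp (-uⁱ z_i)` at `P_i`, `H_i = ε_i h_i`, and
`x^k(u) = ψ(u, Q_k)`. All claims concern the set `V` of those `u ∈ U` at which the metric
`∑ H_i² (duⁱ)²` is nondegenerate; `V'` is the set of its real points. -/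
theorem theorem5 {N l : ℕ} (S : FiniteGap.SpectralData N l)
    (U : Set (Fin N → ℂ)) (hU : IsOpen U)
    (ψ : (Fin N → ℂ) → Fin N → ℂ → ℂ)
    (hψ : ∀ u ∈ U, S.IsUniqueBakerAkhiezer u (ψ u))
    (h : (Fin N → ℂ) → Fin N → ℂ)
    (hh : ∀ u ∈ U, ∀ i, Tendsto (fun z => ψ u i z * Complex.exp (-(u i * z)))
      (Bornology.cobounded ℂ) (𝓝 (h u i)))
    (ε : Fin N → ℂ) (hε : ∀ i, ε i ^ 2 = S.epsSq i)
    (V : Set (Fin N → ℂ)) (hV : V = {u | u ∈ U ∧ ∀ i, h u i ≠ 0})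
    (V' : Set (Fin N → ℝ)) (hV' : V' = {u | (fun i => (u i : ℂ)) ∈ V}) :
    -- the holomorphic metric
    (FiniteGap.IsFlatEgorov V (fun _ => 1) (fun u i => ε i * h u i) S.eta (fun u k => ψ u k 0) ∧
      FiniteGap.GivesAssociativity V (fun _ => 1) (fun u i => ε i * h u i) S.eta
        (fun u k => ψ u k 0) ∧
      (S.CurveConnected → l = 1 → (∀ k, S.d k = 1) →
        FiniteGap.CorrelatorsHomogeneous V (fun _ => 1) (fun u i => ε i * h u i)
          (fun u k => ψ u k 0))) ∧
    -- the real metric, for real spectral data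
    (S.IsReal →
      (∀ k, (S.eta k k).im = 0 ∧ (S.epsSq k).im = 0) ∧
      (∀ u ∈ V', ∀ k, (ψ (fun i => (u i : ℂ)) k 0).im = 0 ∧ (h (fun i => (u i : ℂ)) k).im = 0) ∧
      FiniteGap.IsFlatEgorov V' (fun i => Real.sign (S.epsSq i).re)
        (fun u i => √|(S.epsSq i).re| * (h (fun j => (u j : ℂ)) i).re)
        (S.eta.map Complex.re) (fun u k => (ψ (fun j => (u j : ℂ)) k 0).re) ∧
      FiniteGap.GivesAssociativity V' (fun i => Real.sign (S.epsSq i).re)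
        (fun u i => √|(S.epsSq i).re| * (h (fun j => (u j : ℂ)) i).re)
        (S.eta.map Complex.re) (fun u k => (ψ (fun j => (u j : ℂ)) k 0).re) ∧
      (S.CurveConnected → l = 1 → (∀ k, S.d k = 1) →
        FiniteGap.CorrelatorsHomogeneous V' (fun i => Real.sign (S.epsSq i).re)
          (fun u i => √|(S.epsSq i).re| * (h (fun j => (u j : ℂ)) i).re)
          (fun u k => (ψ (fun j => (u j : ℂ)) k 0).re))) := by
  obtain ⟨⟨h₁, h₂, h₃⟩, hre⟩ := theorem5_general S U hU ψ hψ h hh ε hε V hV V' hV'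
  have hR (hl : l = 1) (k m : Fin l) : (S.R k).2 = (S.R m).2 := by subst hl; congr!
  exact ⟨⟨h₁, h₂, fun _ hl _ => h₃ (hR hl)⟩, fun hS =>
    (hre hS).imp_right (And.imp_right (And.imp_right (And.imp_right fun hC _ hl _ => hC (hR hl))))⟩
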